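/- Let $n,m\ge 0$. There are teams $1,\dots,n$ and participants $p_1,\dots,p_m$. Team $i$ has a quota $q_i\in\{0,\dots,m\}$ and a complete transitive preference $\succsim_i$ (ties allowed) over participants and $\varnothing$; participant $p$ has a complete transitive preference $\succsim_p$ (ties allowed) over teams and $\varnothing$. An allocation $A$ assigns to each participant $p$ an outcome $A(p)$, a team or $\varnothing$ (unassigned); $A_i=\{p: A(p)=i\}$. It is feasible if $|A_i|\le q_i$ for all $i$. For a team $i$ and finite collections $Q,R$ of participants and copies of $\varnothing$, write $Q\succsim_i^{\mathrm{SD}}R$ if there are $Q'\subseteq Q$ and a bijection $\pi\colon Q'\to R$ with $x\succsim_i\pi(x)$ for all $x\in Q'$. $A$ is weakly stable if (i) there are no participants $p,p'$ and team $j$ with $A(p')=j$, $j\succ_p A(p)$ and $p\succ_j p'$; (ii) $p\succsim_i\varnothing$ and $i\succsim_p\varnothing$ whenever $p\in A_i$; (iii) there are no participant $p$ and team $i$ with $i\succ_p A(p)$, $p\succsim_i\varnothing$ and $|A_i|<q_i$. $A$ is extended team-justified SD-EF1 if for all teams $i\ne j$ and every set $C\subseteq A_j$ with $|C|\le q_i$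 all of whose members $p$ satisfy $i\succsim_p j$ and $p\succ_i\varnothing$, there is $X\subseteq C$ with $|X|\le 1$ and $A_i\succsim_i^{\mathrm{SD}}C\setminus X$. A feasible $A$ is Pareto optimal if there is no feasible allocation $A'$ that every participant and every team finds weakly better than $A$ and some participant or team finds strictly better. Here team $i$ compares $A_i$ and $A'_i$ by $\succsim_i^{\mathrm{SD}}$ after each of the two sets has been supplemented by copies of $\varnothing$ up to $q_i$ elements. A mechanism $f$ (a map from instances to allocations) is group-strategyproof for participants if, whenever an instance $I'$ arises from an instance $I$ by replacing the preferences of the members of a non-empty set $X$ of participants, some $p\in X$ satisfies $f(I)(p)\succsim_p f(I')(p)$ with respect to her preference in $I$. Theorem. There is an algorithm, running in time polynomial in $n+m$, that for every instance returns a feasible allocation that is weakly stable, extended team-justified SD-EF1 and Pareto optimal, and whose input-output map is group-strategyproof for participants. -/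

import Mathlib

namespace TeamMatching

/-! ### Preferences, instances, allocations -/

/-- A complete and transitive preference (ties allowed); `rel a b` reads
"`a` is weakly preferred to `b`". -/
structure Pref (α : Type) where
  rel : α → α → Prop
  total : ∀ a b, rel a b ∨ rel b a
  trans : ∀ a b c, rel a b → rel b c → rel a c

/-- Strict preference. -/
def Pref.strict {α : Type} (r : Pref α) (a b : α) : Prop := r.rel a b ∧ ¬ r.rel b a

/-- An instance of the extended setting with `n` teams and `m` participants. The value `none` is
the outcome `∅`: "unassigned" for a participant, "an empty place" for a team. -/
structure MatchingInstance (n m : ℕ) where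
  quota : Fin n → ℕ
  quota_le : ∀ i, quota i ≤ m
  prefP : Fin m → Pref (Option (Fin n))
  prefT : Fin n → Pref (Option (Fin m))

/-- A possibly partial allocation: the team of each participant, or `none` if unassigned. -/
abbrev Allocation (n m : ℕ) := Fin m → Option (Fin n)

variable {n m : ℕ}

/-- The set `A_i` of participants allocated to team `i`. -/
def bundle (A : Allocation n m) (i : Fin n) : Finset (Fin m) :=
  Finset.univ.filter fun p => A p = some i

/-- The quotas are respected. -/
def Feasible (I : MatchingInstance n m) (A : Allocation n m) : Prop :=
  ∀ i, (bundle A i).card ≤ I.quota i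

/-! ### Stability -/

/-- No participant `p`, assigned or not, prefers the team `j` of some participant `p'` to her own
outcome while `j` prefers `p` to `p'`. -/
def ParticipantJustifiedEF (I : MatchingInstance n m) (A : Allocation n m) : Prop :=
  ¬ ∃ (p p' : Fin m) (j : Fin n), A p' = some j ∧ (I.prefP p).strict (some j) (A p) ∧
    (I.prefT j).strict (some p) (some p')

/-- Assigned participants and their teams weakly prefer each other to `∅`. -/
def IndividuallyRational (I : MatchingInstance n m) (A : Allocation n m) : Prop :=
  ∀ (p : Fin m) (i : Fin n), A p = some i →
    (I.prefT i).rel (some p) none ∧ (I.prefP p).rel (some i) none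

/-- No participant, assigned or not, prefers to her outcome a team that finds her acceptable and
has not filled its quota. -/
def NonWasteful (I : MatchingInstance n m) (A : Allocation n m) : Prop :=
  ¬ ∃ (p : Fin m) (i : Fin n), (I.prefP p).strict (some i) (A p) ∧
    (I.prefT i).rel (some p) none ∧ (bundle A i).card < I.quota i

/-- Weak stability. -/
def WeaklyStable (I : MatchingInstance n m) (A : Allocation n m) : Prop :=
  ParticipantJustifiedEF I A ∧ IndividuallyRational I A ∧ NonWasteful I A

/-! ### Stochastic dominance, fairness among teams, Pareto optimality -/

/-- Stochastic dominance: some part `Q'` of `Q` is in bijection with `R` so that each element of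
`Q'` is weakly preferred to its partner. -/
def SD {α : Type} (r : Pref α) (Q R : Multiset α) : Prop :=
  ∃ Q' ≤ Q, Multiset.Rel r.rel Q' R

/-- A set of participants as a collection of outcomes of team places. -/
def places (Q : Finset (Fin m)) : Multiset (Option (Fin m)) := Q.val.map some

/-- Extended team-justified SD-EF1. -/
def ExtendedTeamJustifiedSDEF1 (I : MatchingInstance n m) (A : Allocation n m) : Prop :=
  ∀ i j : Fin n, i ≠ j → ∀ C : Finset (Fin m), C ⊆ bundle A j →
    (∀ p ∈ C, (I.prefP p).rel (some i) (some j) ∧ (I.prefT i).strict (some p) none) →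
    C.card ≤ I.quota i →
    ∃ X ⊆ C, X.card ≤ 1 ∧ SD (I.prefT i) (places (bundle A i)) (places (C \ X))

/-- The places of team `i`: the participants in `Q`, the remaining places of its quota being
empty. -/
def filledPlaces (I : MatchingInstance n m) (i : Fin n) (Q : Finset (Fin m)) :
    Multiset (Option (Fin m)) :=
  places Q + Multiset.replicate (I.quota i - Q.card) none

/-- Team `i` finds `Q` weakly better than `R`: stochastic dominance over its places, an empty place
being ranked as `∅` is in its preference. -/
def TeamWeaklyPrefers (I : MatchingInstance n m) (i : Fin n) (Q R : Finset (Fin m)) : Prop :=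
  SD (I.prefT i) (filledPlaces I i Q) (filledPlaces I i R)

/-- `A'` makes every party weakly better off than `A` and some party strictly better off. -/
def ParetoDominates (I : MatchingInstance n m) (A' A : Allocation n m) : Prop :=
  (∀ p, (I.prefP p).rel (A' p) (A p)) ∧
  (∀ i, TeamWeaklyPrefers I i (bundle A' i) (bundle A i)) ∧
  ((∃ p, (I.prefP p).strict (A' p) (A p)) ∨
    ∃ i, ¬ TeamWeaklyPrefers I i (bundle A i) (bundle A' i))

/-- No allocation that respects the quotas Pareto dominates `A`. -/
def ParetoOptimal (I : MatchingInstance n m) (A : Allocation n m) : Prop :=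
  ¬ ∃ A' : Allocation n m, Feasible I A' ∧ ParetoDominates I A' A

/-! ### Mechanisms and group-strategyproofness -/

/-- The input-output map of an algorithm that returns an allocation for any instance. -/
abbrev Mechanism := ∀ n m : ℕ, MatchingInstance n m → Allocation n m

/-- `I'` arises from `I` when the participants in `X` report other preferences. -/
def Misreport (I I' : MatchingInstance n m) (X : Finset (Fin m)) : Prop :=
  I'.quota = I.quota ∧ I'.prefT = I.prefT ∧ ∀ p ∉ X, I'.prefP p = I.prefP p

/-- Whenever a nonempty group misreports, some member is weakly better off, by her original
preference, with the truthful outcome. -/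
def GroupStrategyproof (f : Mechanism) : Prop :=
  ∀ (n m : ℕ) (I I' : MatchingInstance n m) (X : Finset (Fin m)), X.Nonempty →
    Misreport I I' X → ∃ p ∈ X, (I.prefP p).rel (f n m I p) (f n m I' p)

/-! ### Running time

The machine is a random access machine in structured form, with unit costs. The memory consists of
arrays of natural numbers; an array cell is addressed by a finite tuple of numbers (the empty tuple
for a scalar variable). The arithmetic is addition, truncated subtraction and comparison. As there
is no multiplication, the numbers occurring in `t` steps have bit length linear in `t` plus that of
the input, so polynomial time on this machine is polynomial time on a Turing machine. -/

/-- Contents of the memory: the value of cell `idx` of array `x`. -/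
abbrev Memory := ℕ → List ℕ → ℕ

/-- Expressions. -/
inductive Expr : Type
  | const (k : ℕ) : Expr
  | read (x : ℕ) {k : ℕ} (idx : Fin k → Expr) : Expr
  | add (e₁ e₂ : Expr) : Expr
  | sub (e₁ e₂ : Expr) : Expr
  | eq (e₁ e₂ : Expr) : Expr
  | lt (e₁ e₂ : Expr) : Expr

/-- Value of an expression; a comparison gives `1` if true and `0` if false. -/
def Expr.eval (σ : Memory) : Expr → ℕ
  | .const k => k
  | .read x idx => σ x (List.ofFn fun j => (idx j).eval σ)
  | .add e₁ e₂ => e₁.eval σ + e₂.eval σ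
  | .sub e₁ e₂ => e₁.eval σ - e₂.eval σ
  | .eq e₁ e₂ => if e₁.eval σ = e₂.eval σ then 1 else 0
  | .lt e₁ e₂ => if e₁.eval σ < e₂.eval σ then 1 else 0

/-- Programs. -/
inductive Program : Type
  | skip : Program
  | assign (x : ℕ) {k : ℕ} (idx : Fin k → Expr) (e : Expr) : Program
  | seq (c₁ c₂ : Program) : Program
  | ite (e : Expr) (c₁ c₂ : Program) : Program
  | while (e : Expr) (c : Program) : Program

/-- The memory after writing `v` into cell `idx` of array `x`. -/
def Memory.write (σ : Memory) (x : ℕ) (idx : List ℕ) (v : ℕ) : Memory :=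
  fun y idy => if y = x ∧ idy = idx then v else σ y idy

/-- `Exec c σ σ' t`: started in memory `σ`, the program `c` halts after `t` steps in memory `σ'`.
Every assignment, every test of a condition (true when nonzero) and every `skip` is one step. A
program is fixed once for all inputs, so its expressions have bounded size. -/
inductive Exec : Program → Memory → Memory → ℕ → Prop
  | skip (σ : Memory) : Exec .skip σ σ 1
  | assign (σ : Memory) (x : ℕ) {k : ℕ} (idx : Fin k → Expr) (e : Expr) :
      Exec (.assign x idx e) σ
        (σ.write x (List.ofFn fun j => (idx j).eval σ) (e.eval σ)) 1
  | seq {c₁ c₂ : Program} {σ σ' σ'' : Memory} {t₁ t₂ : ℕ} :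
      Exec c₁ σ σ' t₁ → Exec c₂ σ' σ'' t₂ → Exec (.seq c₁ c₂) σ σ'' (t₁ + t₂)
  | ite_true {e : Expr} {c₁ c₂ : Program} {σ σ' : Memory} {t : ℕ} :
      e.eval σ ≠ 0 → Exec c₁ σ σ' t → Exec (.ite e c₁ c₂) σ σ' (t + 1)
  | ite_false {e : Expr} {c₁ c₂ : Program} {σ σ' : Memory} {t : ℕ} :
      e.eval σ = 0 → Exec c₂ σ σ' t → Exec (.ite e c₁ c₂) σ σ' (t + 1)
  | while_true {e : Expr} {c : Program} {σ σ' σ'' : Memory} {t₁ t₂ : ℕ} :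
      e.eval σ ≠ 0 → Exec c σ σ' t₁ → Exec (.while e c) σ' σ'' t₂ →
      Exec (.while e c) σ σ'' (t₁ + t₂ + 1)
  | while_false {e : Expr} {c : Program} {σ : Memory} :
      e.eval σ = 0 → Exec (.while e c) σ σ 1

/-- The number that stands for an outcome: `0` for `∅`, and `i + 1` for the party with index `i`,
indices starting at `0`. -/
def code {k : ℕ} : Option (Fin k) → ℕ
  | none => 0
  | some i => i + 1

open Classical in
/-- The memory that holds the input `I` and is zero elsewhere: the scalars `0` and `1` hold the
numbers of teams and participants, array `2` holds the quotas, and arrays `3` and `4` hold the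
preferences of the participants and of the teams as tables of bits: `[p, a, b]` is `1` if party `p`
weakly prefers the outcome coded by `a` to the one coded by `b`. -/
noncomputable def MatchingInstance.toMemory (I : MatchingInstance n m) : Memory
  | 0, [] => n
  | 1, [] => m
  | 2, [i] => if h : i < n then I.quota ⟨i, h⟩ else 0
  | 3, [p, a, b] =>
      if ∃ (q : Fin m) (u v : Option (Fin n)),
        (q : ℕ) = p ∧ code u = a ∧ code v = b ∧ (I.prefP q).rel u v then 1 else 0
  | 4, [i, a, b] =>
      if ∃ (j : Fin n) (u v : Option (Fin m)),
        (j : ℕ) = i ∧ code u = a ∧ code v = b ∧ (I.prefT j).rel u v then 1 else 0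
  | _, _ => 0

/-- Some program computes `f` in a number of steps polynomial in the numbers of teams and
participants; it leaves the code of the outcome of participant `p` in cell `[p]` of array `5`. -/
def PolyTimeComputable (f : Mechanism) : Prop :=
  ∃ (c : Program) (B : Polynomial ℕ), ∀ (n m : ℕ) (I : MatchingInstance n m),
    ∃ (σ : Memory) (t : ℕ), Exec c I.toMemory σ t ∧ t ≤ B.eval (n + m) ∧
      ∀ p : Fin m, σ 5 [(p : ℕ)] = code (f n m I p)

end TeamMatching

/-!
The mechanism is an auction with tiers. Every team offers one slot for each place of its quota, and
every participant has a private slot, which stands for being unassigned. A participant values a slot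
by the rank that the team gives her, scaled so that earlier places dominate later ones, and positive
values of different participants are never congruent modulo `2 * m + 2` (`MatchingInstance.weight`,
`residues`). Her own preference enters only through the order in which she tries the slots: the
tiers of her preference are run through from the best one down, and within the current tier she
demands the slots that maximize value minus price. One participant after the other enters; while
somebody is without a slot, slots are passed on along a path of demands, or prices of overdemanded
slots rise, or a participant who cannot afford her current tier moves on to the next one.

Throughout, prices are as low as possible in the sense of `AuctionInv.reach`: no set of held slots
could become cheaper without somebody outside noticing. If an acceptable participant prefers a team
to her outcome, she cannot pay more than the price for any of its slots; so the prices of these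
slots are positive, the slots are occupied, and their holders have at least her rank
(`AuctionOutcome.holder_of_weight_le`); this gives weak stability, and, comparing place by place
within a tier, SD-EF1, the removed participant being the one whose place comes first. Duality of
prices and weights shows that the outcome maximizes the sum of the weights among the assignments
that put everybody into the same or a better tier (`AuctionOutcome.sum_weight_le`), and dominance
for the teams, together with the lexicographic scales, would raise that sum; this gives Pareto
optimality. Group-strategyproofness (`AuctionOutcome.group_strategyproof`) follows from the
minimality of the prices, by a counting argument in which the remainders break ties.

The auction is run by a program on the machine of the running time definition, whose total
correctness is derived with rules in the style of Hoare. The two reachability searches of a step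
(for demand paths to a possible move, and for the set whose prices rise) are one program,
`searchProgram`. The number of steps is polynomial because a step lowers a lexicographic quantity
(`AuctionState`): the number of tiers that are left, and then the number of participants not yet
connected to the participant without a slot. The sizes of the weights do not matter, as each rise of
the prices goes up to the next event.

The memory uses the following arrays. Array `6` holds the tiers of outcomes, `7` the scales, `8` the
weights, `9` the codes of the holders of the slots, `10` the prices and `11` the current tiers; `12`
holds surpluses and `13` the demand edges between participants; `14`, `15` and `20`, `21` hold the
results of the searches; `16`, `17` hold a free slot that a participant demands, and `18`, `19` the
slot that a participant has. The scalar `30` is the token, the code of the participant without a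
slot. The scalars `31` and `32` serve the searches, `33` is the rise of the prices, and `40` to `44`
are loop variables.
-/

namespace TeamMatching

/-! ### Auctions with budgets and tiers -/

section AuctionTheory

section Auction

variable {P S : Type}

/-- At prices `π`, the slot `s` lies in the current tier `t p` of `p` and maximizes there the
surplus `w p s - π s`, which is nonnegative. Weight `0` marks an impossible pair. -/
def Demands (w rk : P → S → ℕ) (π : S → ℕ) (t : P → ℕ) (p : P) (s : S) : Prop :=
  rk p s = t p ∧ 0 < w p s ∧ π s ≤ w p s ∧
    ∀ s', rk p s' = t p → w p s' + π s ≤ w p s + π s'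

/-- The price of `s` cannot rise without `p` noticing: `p` demands `s`, or `s` lies in a better
tier and its price is exactly what `p` can afford. -/
def Tight (w rk : P → S → ℕ) (π : S → ℕ) (t : P → ℕ) (p : P) (s : S) : Prop :=
  Demands w rk π t p s ∨ (rk p s < t p ∧ 0 < w p s ∧ w p s = π s)

/-- The invariant of the auction. `hold s` is the holder of slot `s`. The field `reach` says in
terms of sets that every holder can be reached along tight edges from an unmatched participant or
from the holder of a slot with price zero; it expresses that the prices are as low as possible. -/
structure AuctionInv (w rk : P → S → ℕ) (hold : S → Option P) (π : S → ℕ) (t : P → ℕ) :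
    Prop where
  inj : ∀ s s' p, hold s = some p → hold s' = some p → s = s'
  demands : ∀ s p, hold s = some p → Demands w rk π t p s
  rej : ∀ p s, rk p s < t p → w p s ≤ π s
  free : ∀ s, hold s = none → π s = 0
  reach : ∀ Q : Set P, Q.Nonempty →
    (∃ p ∈ Q, ∀ s, hold s ≠ some p) ∨
    (∃ p ∈ Q, ∃ s, hold s = some p ∧ π s = 0) ∨
    ∃ p ∈ Q, ∃ s, hold s = some p ∧ ∃ q ∉ Q, Tight w rk π t q s

variable {w rk : P → S → ℕ} {hold : S → Option P} {π : S → ℕ} {t : P → ℕ}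

theorem AuctionInv.init (w rk : P → S → ℕ) :
    AuctionInv w rk (fun _ => none) (fun _ => 0) (fun _ => 0) where
  inj := by simp
  demands := by simp
  rej := by simp
  free := by simp
  reach := fun Q ⟨p, hp⟩ => Or.inl ⟨p, hp, by simp⟩

/-- An unmatched participant may take a slot that she demands, free or not. -/
theorem AuctionInv.take [DecidableEq S] (h : AuctionInv w rk hold π t) {r : P} {s : S}
    (hr : ∀ s, hold s ≠ some r) (hd : Demands w rk π t r s) :
    AuctionInv w rk (Function.update hold s (some r)) π t := by
  have key : ∀ s' p, Function.update hold s (some r) s' = some p →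
      (s' = s ∧ p = r) ∨ (s' ≠ s ∧ hold s' = some p ∧ p ≠ r) := by
    intro s' p hs
    by_cases e : s' = s
    · subst e
      simp only [Function.update_self, Option.some.injEq] at hs
      exact Or.inl ⟨rfl, hs.symm⟩
    · rw [Function.update_of_ne e] at hs
      exact Or.inr ⟨e, hs, fun e' => hr s' (e' ▸ hs)⟩
  refine ⟨?_, ?_, h.rej, ?_, ?_⟩
  · intro s₁ s₂ p h₁ h₂
    rcases key _ _ h₁ with ⟨a, b⟩ | ⟨a, b, c⟩ <;> rcases key _ _ h₂ with ⟨a', b'⟩ | ⟨a', b', c'⟩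
    · rw [a, a']
    · exact absurd b c'
    · exact absurd b' c
    · exact h.inj _ _ _ b b'
  · intro s' p hs
    rcases key _ _ hs with ⟨a, b⟩ | ⟨a, b, c⟩
    · subst a b; exact hd
    · exact h.demands _ _ b
  · intro s' hs
    by_cases e : s' = s
    · subst e; simp at hs
    · rw [Function.update_of_ne e] at hs; exact h.free _ hs
  · intro Q hQ
    by_contra hcon
    push Not at hcon
    obtain ⟨hU, hZ, hT⟩ := hcon
    have hrQ : r ∉ Q := by
      intro hrQ
      have hs : Function.update hold s (some r) s = some r := by simp
      rcases hh : hold s with _ | p₁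
      · exact hZ r hrQ s hs (h.free _ hh)
      · refine hT r hrQ s hs p₁ ?_ (Or.inl (h.demands _ _ hh))
        intro hp₁
        obtain ⟨s', hs'⟩ := hU p₁ hp₁
        rcases key _ _ hs' with ⟨a, b⟩ | ⟨a, b, c⟩
        · exact hr s (b ▸ hh)
        · exact a (h.inj _ _ _ b hh)
    have hold' : ∀ p ∈ Q, ∀ s', hold s' = some p →
        Function.update hold s (some r) s' = some p := by
      intro p hp s' hs'
      obtain ⟨s'', hs''⟩ := hU p hp
      rcases key _ _ hs'' with ⟨a, b⟩ | ⟨a, b, c⟩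
      · exact absurd (b ▸ hp) hrQ
      · rw [h.inj _ _ _ hs' b]; exact hs''
    rcases h.reach Q hQ with ⟨p, hp, h1⟩ | ⟨p, hp, s', h1, h2⟩ | ⟨p, hp, s', h1, q, hq, h2⟩
    · obtain ⟨s'', hs''⟩ := hU p hp
      rcases key _ _ hs'' with ⟨a, b⟩ | ⟨a, b, c⟩
      · exact hrQ (b ▸ hp)
      · exact h1 _ b
    · exact hZ p hp s' (hold' p hp s' h1) h2
    · exact hT p hp s' (hold' p hp s' h1) q hq h2

/-- An unmatched participant for whom no slot of the current tier has a positive surplus moves on to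
the next tier. -/
theorem AuctionInv.reject [DecidableEq P] (h : AuctionInv w rk hold π t) {r : P}
    (hr : ∀ s, hold s ≠ some r) (h0 : ∀ s, rk r s = t r → w r s ≤ π s) :
    AuctionInv w rk hold π (Function.update t r (t r + 1)) := by
  have hne : ∀ s p, hold s = some p → p ≠ r := fun s p hs e => hr s (e ▸ hs)
  have hdem : ∀ p s, p ≠ r → Demands w rk π t p s →
      Demands w rk π (Function.update t r (t r + 1)) p s := by
    intro p s hp hd
    unfold Demands at hd ⊢
    rwa [Function.update_of_ne hp]
  have htight : ∀ p s, Tight w rk π t p s →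
      Tight w rk π (Function.update t r (t r + 1)) p s := by
    intro p s hd
    by_cases hp : p = r
    · subst hp
      right
      rw [Function.update_self]
      rcases hd with ⟨h1, h2, h3, _⟩ | ⟨h1, h2, h3⟩
      · exact ⟨by omega, h2, le_antisymm (h0 s h1) h3⟩
      · exact ⟨by omega, h2, h3⟩
    · rcases hd with hd | hd
      · exact Or.inl (hdem _ _ hp hd)
      · right; rwa [Function.update_of_ne hp]
  refine ⟨h.inj, fun s p hs => hdem _ _ (hne _ _ hs) (h.demands _ _ hs), ?_, h.free, ?_⟩
  · intro p s hs
    by_cases hp : p = r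
    · subst hp
      rw [Function.update_self] at hs
      rcases Nat.lt_succ_iff_lt_or_eq.1 hs with h1 | h1
      · exact h.rej _ _ h1
      · exact h0 _ h1
    · rw [Function.update_of_ne hp] at hs; exact h.rej _ _ hs
  · intro Q hQ
    rcases h.reach Q hQ with h1 | h1 | ⟨p, hp, s', h1, q, hq, h2⟩
    · exact Or.inl h1
    · exact Or.inr (Or.inl h1)
    · exact Or.inr (Or.inr ⟨p, hp, s', h1, q, hq, htight _ _ h2⟩)

/-- Every member of `R` can be reached inside `R` from `r` along demand edges. -/
def ReachedFrom (w rk : P → S → ℕ) (hold : S → Option P) (π : S → ℕ) (t : P → ℕ) (r : P)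
    (R : Set P) : Prop :=
  r ∈ R ∧ ∀ Q ⊆ R, Q.Nonempty → r ∉ Q →
    ∃ q ∈ R, q ∉ Q ∧ ∃ p ∈ Q, ∃ s, hold s = some p ∧ Demands w rk π t q s

open Classical in
/-- The prices after the slots held by members of `R` have become dearer by `δ`. -/
noncomputable def raise (hold : S → Option P) (R : Set P) (δ : ℕ) (π : S → ℕ) (s : S) : ℕ :=
  if ∃ p ∈ R, hold s = some p then π s + δ else π s

/-- A demand edge from `R` to a slot held by `R` survives a rise of the prices. -/
theorem Demands.raise {R : Set P} {δ : ℕ}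
    (hδ : ∀ p ∈ R, ∀ s, Demands w rk π t p s → π s + δ ≤ w p s ∧
      ∀ s', rk p s' = t p → (¬ ∃ q ∈ R, hold s' = some q) → w p s' + (π s + δ) ≤ w p s + π s')
    {p : P} {s : S} (hp : p ∈ R) (hs : ∃ q ∈ R, hold s = some q) (h : Demands w rk π t p s) :
    Demands w rk (raise hold R δ π) t p s := by
  obtain ⟨h1, h2⟩ := hδ p hp s h
  have e : TeamMatching.raise hold R δ π s = π s + δ := if_pos hs
  refine ⟨h.1, h.2.1, by rw [e]; exact h1, ?_⟩
  intro s' hs'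
  rw [e]
  by_cases c : ∃ q ∈ R, hold s' = some q
  · have e' : TeamMatching.raise hold R δ π s' = π s' + δ := if_pos c
    rw [e']; have := h.2.2.2 s' hs'; omega
  · have e' : TeamMatching.raise hold R δ π s' = π s' := if_neg c
    rw [e']; exact h2 s' hs' c

theorem le_raise (hold : S → Option P) (R : Set P) (δ : ℕ) (π : S → ℕ) (s : S) :
    π s ≤ raise hold R δ π s := by
  unfold raise; split_ifs <;> omega

/-- The prices of the slots held by the set `R` reached from an unmatched participant may rise, as
long as the surplus of its members stays nonnegative and at least that of the other slots. -/
theorem AuctionInv.raise (h : AuctionInv w rk hold π t) {r : P} {R : Set P} {δ : ℕ}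
    (hr : ∀ s, hold s ≠ some r) (hR : ReachedFrom w rk hold π t r R)
    (hδ : ∀ p ∈ R, ∀ s, Demands w rk π t p s → π s + δ ≤ w p s ∧
      ∀ s', rk p s' = t p → (¬ ∃ q ∈ R, hold s' = some q) → w p s' + (π s + δ) ≤ w p s + π s') :
    AuctionInv w rk hold (raise hold R δ π) t := by
  have hout : ∀ p s, (¬ ∃ q ∈ R, hold s = some q) → Demands w rk π t p s →
      Demands w rk (TeamMatching.raise hold R δ π) t p s := by
    intro p s hs hd
    have e : TeamMatching.raise hold R δ π s = π s := if_neg hs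
    refine ⟨hd.1, hd.2.1, by rw [e]; exact hd.2.2.1, ?_⟩
    intro s' hs'
    have := hd.2.2.2 s' hs'
    have := le_raise hold R δ π s'
    rw [e]; omega
  refine ⟨h.inj, ?_, ?_, ?_, ?_⟩
  · intro s p hs
    by_cases hp : p ∈ R
    · exact (h.demands _ _ hs).raise hδ hp ⟨p, hp, hs⟩
    · refine hout p s ?_ (h.demands _ _ hs)
      rintro ⟨q, hq, hq'⟩
      rw [hs] at hq'
      exact hp (Option.some.inj hq' ▸ hq)
  · intro p s hs
    exact (h.rej p s hs).trans (le_raise _ _ _ _ _)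
  · intro s hs
    have e : TeamMatching.raise hold R δ π s = π s := if_neg (by simp [hs])
    rw [e, h.free s hs]
  · intro Q hQ
    by_cases hQR : (Q ∩ R).Nonempty
    · by_cases hrQ : r ∈ Q
      · exact Or.inl ⟨r, hrQ, hr⟩
      · obtain ⟨q, hqR, hq, p, hp, s, hs, hd⟩ := hR.2 (Q ∩ R) (by simp) hQR (fun c => hrQ c.1)
        refine Or.inr (Or.inr ⟨p, hp.1, s, hs, q, fun c => hq ⟨c, hqR⟩, Or.inl ?_⟩)
        exact hd.raise hδ hqR ⟨p, hp.2, hs⟩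
    · have hd : ∀ p ∈ Q, p ∉ R := fun p hp hp' => hQR ⟨p, hp, hp'⟩
      have hN : ∀ p ∈ Q, ∀ s, hold s = some p → ¬ ∃ q ∈ R, hold s = some q := by
        rintro p hp s hs ⟨q, hq, hq'⟩
        rw [hs] at hq'
        exact hd p hp (Option.some.inj hq' ▸ hq)
      rcases h.reach Q hQ with h1 | ⟨p, hp, s, h1, h2⟩ | ⟨p, hp, s, h1, q, hq, h2⟩
      · exact Or.inl h1
      · refine Or.inr (Or.inl ⟨p, hp, s, h1, ?_⟩)
        have e : TeamMatching.raise hold R δ π s = π s := if_neg (hN p hp s h1)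
        rw [e, h2]
      · refine Or.inr (Or.inr ⟨p, hp, s, h1, q, hq, ?_⟩)
        rcases h2 with h2 | ⟨h2, h3, h4⟩
        · exact Or.inl (hout _ _ (hN p hp s h1) h2)
        · refine Or.inr ⟨h2, h3, ?_⟩
          have e : TeamMatching.raise hold R δ π s = π s := if_neg (hN p hp s h1)
          rw [e, h4]

/-- After a rise of the prices the members of `R` are still reached from `r`. -/
theorem ReachedFrom.raise {r : P} {R : Set P} {δ : ℕ} (hR : ReachedFrom w rk hold π t r R)
    (hδ : ∀ p ∈ R, ∀ s, Demands w rk π t p s → π s + δ ≤ w p s ∧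
      ∀ s', rk p s' = t p → (¬ ∃ q ∈ R, hold s' = some q) → w p s' + (π s + δ) ≤ w p s + π s') :
    ReachedFrom w rk hold (raise hold R δ π) t r R := by
  refine ⟨hR.1, fun Q hQ hne hr => ?_⟩
  obtain ⟨q, hqR, hq, p, hp, s, hs, hd⟩ := hR.2 Q hQ hne hr
  exact ⟨q, hqR, hq, p, hp, s, hs, hd.raise hδ hqR ⟨p, hQ hp, hs⟩⟩

theorem ReachedFrom.insert {r : P} {R : Set P} (hR : ReachedFrom w rk hold π t r R) {q p : P}
    {s : S} (hq : q ∈ R) (hs : hold s = some p) (hd : Demands w rk π t q s) :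
    ReachedFrom w rk hold π t r (insert p R) := by
  refine ⟨Or.inr hR.1, fun Q hQ hne hr => ?_⟩
  by_cases hqQ : q ∈ Q
  · obtain ⟨q', hqR, hq', p', hp', s', hs', hd'⟩ :=
      hR.2 (Q ∩ R) (by simp) ⟨q, hqQ, hq⟩ (fun c => hr c.1)
    exact ⟨q', Or.inr hqR, fun c => hq' ⟨c, hqR⟩, p', hp'.1, s', hs', hd'⟩
  · by_cases hQR : (Q ∩ R).Nonempty
    · obtain ⟨q', hqR, hq', p', hp', s', hs', hd'⟩ := hR.2 (Q ∩ R) (by simp) hQR (fun c => hr c.1)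
      exact ⟨q', Or.inr hqR, fun c => hq' ⟨c, hqR⟩, p', hp'.1, s', hs', hd'⟩
    · obtain ⟨x, hx⟩ := hne
      rcases hQ hx with e | e
      · exact ⟨q, Or.inr hq, hqQ, p, e ▸ hx, s, hs, hd⟩
      · exact absurd ⟨x, hx, e⟩ hQR

/-- The outcome of a finished auction: every participant has a slot, nobody could afford a slot in a
better tier, and the prices are as low as possible. -/
structure AuctionOutcome (w rk : P → S → ℕ) (μ : P → S) (π : S → ℕ) : Prop where
  inj : Function.Injective μ
  demands : ∀ p, Demands w rk π (fun q => rk q (μ q)) p (μ p)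
  rej : ∀ p s, rk p s < rk p (μ p) → w p s ≤ π s
  free : ∀ s, s ∉ Set.range μ → π s = 0
  reach : ∀ Q : Set P, Q.Nonempty →
    (∃ p ∈ Q, π (μ p) = 0) ∨
    ∃ p ∈ Q, ∃ q ∉ Q, Tight w rk π (fun q => rk q (μ q)) q (μ p)

theorem AuctionInv.outcome (h : AuctionInv w rk hold π t) {μ : P → S}
    (hμ : ∀ p, hold (μ p) = some p) : AuctionOutcome w rk μ π := by
  have ht : t = fun q => rk q (μ q) := funext fun q => (h.demands _ _ (hμ q)).1.symm
  subst ht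
  refine ⟨?_, fun p => h.demands _ _ (hμ p), h.rej, ?_, ?_⟩
  · intro p q e
    have := hμ p
    rw [e, hμ q] at this
    exact (Option.some.inj this).symm
  · intro s hs
    apply h.free
    rcases e : hold s with _ | p
    · rfl
    · exact absurd ⟨p, h.inj _ _ _ (hμ p) e⟩ hs
  · intro Q hQ
    rcases h.reach Q hQ with ⟨p, _, h1⟩ | ⟨p, hp, s, h1, h2⟩ | ⟨p, hp, s, h1, q, hq, h2⟩
    · exact absurd (hμ p) (h1 _)
    · rw [h.inj _ _ _ h1 (hμ p)] at h2
      exact Or.inl ⟨p, hp, h2⟩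
    · rw [h.inj _ _ _ h1 (hμ p)] at h2
      exact Or.inr ⟨p, hp, q, hq, h2⟩

/-- The positive weights of a participant leave a nonzero remainder modulo `B` that identifies
her. -/
structure Residues (w : P → S → ℕ) (o : P → ℕ) (B : ℕ) : Prop where
  mod_eq : ∀ p s, 0 < w p s → w p s % B = o p
  inj : Function.Injective o
  ne_zero : ∀ p, o p ≠ 0

variable {o : P → ℕ} {B : ℕ} {μ : P → S}

/-- Slots demanded by the same participant have prices congruent modulo `B`. -/
theorem Demands.mod_eq (hB : Residues w o B) {p : P} {s s' : S} (h : Demands w rk π t p s)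
    (h' : Demands w rk π t p s') : π s % B = π s' % B := by
  have h1 := h.2.2.2 s' h'.1
  have h2 := h'.2.2.2 s h.1
  have e : w p s' + π s = w p s + π s' := le_antisymm h1 h2
  have e1 := hB.mod_eq p s h.2.1
  have e2 := hB.mod_eq p s' h'.2.1
  have e3 : w p s' + π s ≡ w p s' + π s' [MOD B] := by
    rw [e]
    exact Nat.ModEq.add_right _ (e1.trans e2.symm)
  exact Nat.ModEq.add_left_cancel' _ e3

/-- In a finished auction everybody has a positive surplus. -/
theorem AuctionOutcome.price_lt (h : AuctionOutcome w rk μ π) (hB : Residues w o B) (p : P) :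
    π (μ p) < w p (μ p) := by
  refine lt_of_le_of_ne (h.demands p).2.2.1 fun e => ?_
  have hp : π (μ p) % B = o p := by rw [e]; exact hB.mod_eq _ _ (h.demands p).2.1
  rcases h.reach {a | π (μ a) % B = o p} ⟨p, hp⟩ with ⟨a, ha, h0⟩ | ⟨a, ha, q, hq, hT⟩
  · simp only [Set.mem_ofPred_eq, h0, Nat.zero_mod] at ha
    exact hB.ne_zero p ha.symm
  · simp only [Set.mem_ofPred_eq] at ha hq
    rcases hT with hT | ⟨_, h2, h3⟩
    · exact hq ((Demands.mod_eq hB (h.demands q) hT).trans ha)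
    · rw [← h3, hB.mod_eq _ _ h2] at ha
      rw [hB.inj ha] at hq
      exact hq hp

/-- An assignment that puts everybody into the same or a better tier has no larger total weight,
and a smaller one if somebody gets into a better tier. -/
theorem AuctionOutcome.sum_weight_le [Fintype P] [Fintype S] (h : AuctionOutcome w rk μ π)
    (hB : Residues w o B) {μ' : P → S}
    (hinj : Function.Injective μ') (hle : ∀ p, rk p (μ' p) ≤ rk p (μ p)) :
    ∑ p, w p (μ' p) ≤ ∑ p, w p (μ p) ∧
      ((∃ p, rk p (μ' p) < rk p (μ p)) → ∑ p, w p (μ' p) < ∑ p, w p (μ p)) := by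
  classical
  have h1 : ∀ p, w p (μ' p) + π (μ p) ≤ w p (μ p) + π (μ' p) := by
    intro p
    rcases (hle p).lt_or_eq with hlt | e
    · have := h.rej p _ hlt
      have := (h.demands p).2.2.1
      omega
    · exact (h.demands p).2.2.2 _ e
  have h2 : ∑ p, π (μ' p) ≤ ∑ p, π (μ p) := by
    have e : ∑ p, π (μ p) = ∑ s, π s := by
      rw [← Finset.sum_image (f := π) (s := Finset.univ) (g := μ) (fun a _ b _ e => h.inj e)]
      refine Finset.sum_subset (Finset.subset_univ _) fun s _ hs => h.free s ?_
      simpa using hs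
    rw [e, ← Finset.sum_image (f := π) (s := Finset.univ) (g := μ') (fun a _ b _ e => hinj e)]
    exact Finset.sum_le_sum_of_subset (Finset.subset_univ _)
  have h3 := Finset.sum_le_sum fun p (_ : p ∈ Finset.univ) => h1 p
  rw [Finset.sum_add_distrib, Finset.sum_add_distrib] at h3
  refine ⟨by omega, ?_⟩
  rintro ⟨p, hp⟩
  have h4 : ∑ p, (w p (μ' p) + π (μ p)) < ∑ p, (w p (μ p) + π (μ' p)) := by
    refine Finset.sum_lt_sum (fun p _ => h1 p) ⟨p, Finset.mem_univ _, ?_⟩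
    have := h.rej p _ hp
    have := h.price_lt hB p
    omega
  rw [Finset.sum_add_distrib, Finset.sum_add_distrib] at h4
  omega

/-- No group `X` can get all its members into better tiers by reporting other tiers. Compare the
truthful outcome `μ`, `π` with the other outcome `ν`, `ρ`. Let `Y` be the set of participants who
are better off with `ν`, by tier and then by surplus. Counting shows that they hold under `μ` slots
whose price is lower with `ρ`, or equal and with the residue of a member of `Y`; but no tight edge
can enter the set of such participants, so its prices are not as low as possible. -/
theorem AuctionOutcome.group_strategyproof [Fintype P] [Fintype S] {rk' : P → S → ℕ}
    {ν : P → S} {ρ : S → ℕ}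
    (h : AuctionOutcome w rk μ π) (h' : AuctionOutcome w rk' ν ρ) (hB : Residues w o B)
    {X : Set P} (hX : X.Nonempty) (htruth : ∀ p ∉ X, rk' p = rk p) :
    ∃ p ∈ X, rk p (μ p) ≤ rk p (ν p) := by
  classical
  by_contra hcon
  push Not at hcon
  set Y : Set P := {p | rk p (ν p) < rk p (μ p) ∨
    (rk p (ν p) = rk p (μ p) ∧ w p (μ p) + ρ (ν p) < w p (ν p) + π (μ p))} with hY
  have hXY : X ⊆ Y := fun p hp => Or.inl (hcon p hp)
  set V' : Set S := {s | ∃ y ∈ Y, π s % B = o y} with hV'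
  set D : Set S := {s | ρ s < π s ∨ (π s = ρ s ∧ s ∈ V')} with hD
  have hpos : ∀ s ∈ V', π s ≠ 0 := by
    rintro s ⟨y, _, hy⟩ e
    rw [e, Nat.zero_mod] at hy
    exact hB.ne_zero y hy.symm
  -- A truthful participant to whom `s` is tight profits from a lower price of `s`.
  have hlow : ∀ q s, Tight w rk π (fun q => rk q (μ q)) q s → ρ s < π s → q ∈ Y := by
    intro q s hT hlt
    by_contra hq
    have hqX : q ∉ X := fun c => hq (hXY c)
    have hr := htruth q hqX
    have hrej := h'.rej q s
    have hdem := (h'.demands q).2.2.2 s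
    simp only [hr] at hrej hdem
    simp only [hY, Set.mem_ofPred_eq, not_or, not_lt, not_and] at hq
    rcases hT with hT | ⟨h1, h2, h3⟩
    · have e : rk q s = rk q (μ q) := hT.1
      have h4 := hT.2.2.2 _ rfl
      have h5 := hT.2.2.1
      rcases hq.1.lt_or_eq with hlt' | e'
      · have := hrej (by omega); omega
      · have := hdem (by omega)
        have := hq.2 e'.symm
        omega
    · have h1' : rk q s < rk q (μ q) := h1
      have := hrej (by omega)
      omega
  have hmap : ∀ a, a ∈ Y ∨ μ a ∈ D → ν a ∈ D := by
    intro a ha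
    by_cases haY : a ∈ Y
    · rcases haY with hlt | ⟨e, hlt⟩
      · have h1 := h.rej a _ hlt
        have h2 := (h'.demands a).2.2.1
        rcases (h2.trans h1).lt_or_eq with h3 | h3
        · exact Or.inl h3
        · refine Or.inr ⟨h3.symm, a, Or.inl hlt, ?_⟩
          have : π (ν a) = w a (ν a) := by omega
          rw [this]
          exact hB.mod_eq _ _ (h'.demands a).2.1
      · have := (h.demands a).2.2.2 _ e
        exact Or.inl (by omega)
    · have hD' := ha.resolve_left haY
      rcases hD' with hlt | ⟨e, y, hy, hm⟩
      · exact absurd (hlow a _ (Or.inl (h.demands a)) hlt) haY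
      · have haX : a ∉ X := fun c => haY (hXY c)
        have hr := htruth a haX
        have hrej := h'.rej a (μ a)
        have hdem := (h'.demands a).2.2.2 (μ a)
        have hp := h.price_lt hB a
        simp only [hr] at hrej hdem
        have haY' := haY
        simp only [hY, Set.mem_ofPred_eq, not_or, not_lt, not_and] at haY'
        have hrk : rk a (ν a) = rk a (μ a) := by
          refine le_antisymm ?_ haY'.1
          by_contra hgt
          have := hrej (by omega)
          omega
        have h1 := hdem hrk.symm
        have h2 := haY'.2 hrk
        have h3 := (h.demands a).2.2.2 _ hrk
        have h4 : ρ (ν a) ≤ π (ν a) := by omega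
        rcases h4.lt_or_eq with h5 | h5
        · exact Or.inl h5
        · refine Or.inr ⟨h5.symm, y, hy, ?_⟩
          rw [← hm]
          refine Demands.mod_eq hB ?_ (h.demands a)
          refine ⟨hrk, (h'.demands a).2.1, ?_, ?_⟩
          · have := (h'.demands a).2.2.1; omega
          · intro s' hs'
            have := (h.demands a).2.2.2 s' hs'
            omega
  have hrange : ∀ s ∈ D, ∃ a, μ a = s := by
    intro s hs
    by_contra hno
    have h0 := h.free s (by simpa using hno)
    rcases hs with hs | ⟨_, hs⟩
    · omega
    · exact hpos s hs h0
  -- `ν` maps the set on the left injectively into `D`, which has as many elements as the right one.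
  have hYD : ∀ a ∈ Y, μ a ∈ D := by
    set A : Finset P := Finset.univ.filter fun a => a ∈ Y ∨ μ a ∈ D
    set Q : Finset P := Finset.univ.filter fun a => μ a ∈ D
    have hQA : Q ⊆ A := by
      intro a ha
      simp only [Q, A, Finset.mem_filter, Finset.mem_univ, true_and] at ha ⊢
      exact Or.inr ha
    have hcard : A.card ≤ Q.card := by
      have e1 : (A.image ν).card = A.card := Finset.card_image_of_injective _ h'.inj
      have e2 : (Q.image μ).card = Q.card := Finset.card_image_of_injective _ h.inj
      rw [← e1, ← e2]
      refine Finset.card_le_card fun s hs => ?_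
      simp only [Finset.mem_image, A, Finset.mem_filter, Finset.mem_univ, true_and] at hs
      obtain ⟨a, ha, rfl⟩ := hs
      have hD := hmap a ha
      obtain ⟨b, hb⟩ := hrange _ hD
      simp only [Finset.mem_image, Q, Finset.mem_filter, Finset.mem_univ, true_and]
      exact ⟨b, hb ▸ hD, hb⟩
    have := Finset.eq_of_subset_of_card_le hQA hcard
    intro a ha
    have haA : a ∈ A := by simp [A, ha]
    rw [← this] at haA
    simpa [Q] using haA
  obtain ⟨x, hx⟩ := hX
  rcases h.reach {a | ρ (μ a) < π (μ a) ∨ μ a ∈ V'}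
      ⟨x, (hYD x (hXY hx)).imp id And.right⟩ with ⟨a, ha, h0⟩ | ⟨a, ha, q, hq, hT⟩
  · rcases ha with ha | ha
    · omega
    · exact hpos _ ha h0
  · have hqY : q ∉ Y := fun c => hq ((hYD q c).imp id And.right)
    rcases ha with ha | ⟨y, hy, hm⟩
    · exact hqY (hlow q _ hT ha)
    · rcases hT with hT | ⟨_, h2, h3⟩
      · exact hq (Or.inr ⟨y, hy, (Demands.mod_eq hB (h.demands q) hT).trans hm⟩)
      · rw [← h3, hB.mod_eq _ _ h2] at hm
        exact hqY (hB.inj hm ▸ hy)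

end Auction

end AuctionTheory

/-! ### Places of teams as the slots of an auction -/

section Weights

variable {n m : ℕ}

/-- The slots of the auction: `(i + 1, k)` is place `k` of team `i`, and `(0, p)` is a private slot
of participant `p` that stands for being unassigned. -/
abbrev Slot (n m : ℕ) := Fin (n + 1) × Fin m

/-- The outcome with a given code. -/
def outcomeOf (a : Fin (n + 1)) : Option (Fin n) := Fin.cases none some a

@[simp] theorem outcomeOf_zero : outcomeOf (0 : Fin (n + 1)) = none := rfl

@[simp] theorem outcomeOf_succ (i : Fin n) : outcomeOf i.succ = some i := rfl

theorem mem_bundle {A : Allocation n m} {p : Fin m} {i : Fin n} :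
    p ∈ bundle A i ↔ A p = some i := by
  simp [bundle]

theorem code_outcomeOf (a : Fin (n + 1)) : code (outcomeOf a) = a := by
  cases a using Fin.cases <;> simp [code]

theorem outcomeOf_eq_none {a : Fin (n + 1)} : outcomeOf a = none ↔ a = 0 := by
  cases a using Fin.cases <;> simp

theorem outcomeOf_eq_some {a : Fin (n + 1)} {i : Fin n} :
    outcomeOf a = some i ↔ a = i.succ := by
  cases a using Fin.cases <;> simp [eq_comm, Fin.succ_ne_zero]

theorem Pref.refl {α : Type} (r : Pref α) (a : α) : r.rel a a := (r.total a a).elim id id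

theorem Pref.rel_of_not {α : Type} (r : Pref α) {a b : α} (h : ¬ r.rel a b) : r.rel b a :=
  (r.total a b).resolve_left h

open Classical in
/-- The tier of an outcome in a preference: the number of strictly better outcomes. -/
noncomputable def Pref.tier {α : Type} [Fintype α] (r : Pref α) (a : α) : ℕ :=
  (Finset.univ.filter fun b => ¬ r.rel a b).card

theorem Pref.tier_le_iff {α : Type} [Fintype α] (r : Pref α) {a b : α} :
    r.tier a ≤ r.tier b ↔ r.rel a b := by
  classical
  constructor
  · intro h
    by_contra hab
    refine absurd h (not_le.2 (Finset.card_lt_card ?_))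
    rw [Finset.ssubset_iff_of_subset]
    · exact ⟨b, by simp [hab], by simp [r.refl b]⟩
    · intro c hc
      simp only [Finset.mem_filter, Finset.mem_univ, true_and] at hc ⊢
      exact fun h' => hc (r.trans _ _ _ (r.rel_of_not hab) h')
  · intro h
    refine Finset.card_le_card fun c hc => ?_
    simp only [Finset.mem_filter, Finset.mem_univ, true_and] at hc ⊢
    exact fun h' => hc (r.trans _ _ _ h h')

theorem Pref.tier_lt_iff {α : Type} [Fintype α] (r : Pref α) {a b : α} :
    r.tier a < r.tier b ↔ r.strict a b := by
  rw [Pref.strict, ← not_le, r.tier_le_iff]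
  exact ⟨fun h => ⟨r.rel_of_not h, h⟩, fun h => h.2⟩

open Classical in
/-- The rank of `x` above `∅` in a preference of a team: the number of outcomes that are worse than
`x` but acceptable. -/
noncomputable def Pref.rank (r : Pref (Option (Fin m))) (x : Option (Fin m)) : ℕ :=
  (Finset.univ.filter fun y => ¬ r.rel y x ∧ r.rel y none).card

theorem Pref.rank_mono (r : Pref (Option (Fin m))) {x y : Option (Fin m)} (h : r.rel x y) :
    r.rank y ≤ r.rank x := by
  classical
  refine Finset.card_le_card fun c hc => ?_
  simp only [Finset.mem_filter, Finset.mem_univ, true_and] at hc ⊢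
  exact ⟨fun h' => hc.1 (r.trans _ _ _ h' h), hc.2⟩

theorem Pref.rank_lt (r : Pref (Option (Fin m))) {x y : Option (Fin m)} (h : ¬ r.rel y x)
    (hy : r.rel y none) : r.rank y < r.rank x := by
  classical
  refine Finset.card_lt_card ?_
  rw [Finset.ssubset_iff_of_subset]
  · exact ⟨y, by simp [h, hy], by simp [r.refl y]⟩
  · intro c hc
    simp only [Finset.mem_filter, Finset.mem_univ, true_and] at hc ⊢
    exact ⟨fun h' => hc.1 (r.trans _ _ _ h' (r.rel_of_not h)), hc.2⟩

theorem Pref.rank_none (r : Pref (Option (Fin m))) : r.rank none = 0 := by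
  classical
  simp [Pref.rank]

theorem Pref.rank_le (r : Pref (Option (Fin m))) (x : Option (Fin m)) : r.rank x ≤ m := by
  classical
  have : (Finset.univ.filter fun y => ¬ r.rel y x ∧ r.rel y none) ⊆ Finset.univ.erase x := by
    intro y hy
    simp only [Finset.mem_filter, Finset.mem_univ, true_and] at hy
    simp only [Finset.mem_erase, Finset.mem_univ, and_true]
    rintro rfl
    exact hy.1 (r.refl _)
  refine (Finset.card_le_card this).trans ?_
  simp

/-- The factor by which ranks count in place `k`. One unit in a place outweighs everything that can
be gained in a later place. -/
def placeScale (m k : ℕ) : ℕ := (2 * m + 2) * (m + 1) ^ (m - k)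

open Classical in
/-- The weight of a participant in a slot: her rank, scaled by the place, plus `p + 1` to break
ties; `0` if the slot is not available to her. -/
noncomputable def MatchingInstance.weight (I : MatchingInstance n m) (p : Fin m) (s : Slot n m) :
    ℕ :=
  match outcomeOf s.1 with
  | none => if s.2 = p then (p : ℕ) + 1 else 0
  | some i => if (s.2 : ℕ) < I.quota i ∧ (I.prefT i).rel (some p) none then
      (p : ℕ) + 1 + (I.prefT i).rank (some p) * placeScale m s.2 else 0

/-- The tier of a slot for a participant. -/
noncomputable def MatchingInstance.slotTier (I : MatchingInstance n m) (p : Fin m)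
    (s : Slot n m) : ℕ :=
  (I.prefP p).tier (outcomeOf s.1)

variable {I : MatchingInstance n m}

theorem weight_private (I : MatchingInstance n m) (p : Fin m) : I.weight p (0, p) = p + 1 := by
  simp [MatchingInstance.weight]

theorem eq_of_weight_private {p q : Fin m} (h : 0 < I.weight q (0, p)) : q = p := by
  by_contra hne
  have hne' : ¬ p = q := fun e => hne e.symm
  simp [MatchingInstance.weight, hne'] at h

theorem weight_succ {p k : Fin m} {i : Fin n} (hk : (k : ℕ) < I.quota i)
    (h : (I.prefT i).rel (some p) none) :
    I.weight p (i.succ, k) = p + 1 + (I.prefT i).rank (some p) * placeScale m k := by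
  simp [MatchingInstance.weight, hk, h]

theorem of_weight_succ_pos {p k : Fin m} {i : Fin n} (h : 0 < I.weight p (i.succ, k)) :
    (k : ℕ) < I.quota i ∧ (I.prefT i).rel (some p) none := by
  by_contra hne
  simp [MatchingInstance.weight, hne] at h

theorem residues (I : MatchingInstance n m) :
    Residues I.weight (fun p => (p : ℕ) + 1) (2 * m + 2) where
  mod_eq := by
    rintro p ⟨a, k⟩ h
    have hp : (p : ℕ) + 1 < 2 * m + 2 := by omega
    cases a using Fin.cases with
    | zero =>
      have e := eq_of_weight_private h
      subst e
      rw [weight_private, Nat.mod_eq_of_lt hp]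
    | succ i =>
      obtain ⟨h1, h2⟩ := of_weight_succ_pos h
      rw [weight_succ h1 h2, placeScale, mul_left_comm, Nat.add_mul_mod_self_left,
        Nat.mod_eq_of_lt hp]
  inj := fun p q h => Fin.ext (Nat.succ_injective h)
  ne_zero := fun p => Nat.succ_ne_zero _

/-- The allocation that belongs to an assignment of slots. -/
def allocationOf (μ : Fin m → Slot n m) : Allocation n m := fun p => outcomeOf (μ p).1

variable {μ : Fin m → Slot n m} {π : Slot n m → ℕ}

section Properties

variable (h : AuctionOutcome I.weight I.slotTier μ π)

theorem allocationOf_eq_some {p : Fin m} {i : Fin n} (hp : allocationOf μ p = some i) :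
    μ p = (i.succ, (μ p).2) :=
  Prod.ext (outcomeOf_eq_some.1 hp) rfl

include h

theorem AuctionOutcome.of_mem {p : Fin m} {i : Fin n} (hp : allocationOf μ p = some i) :
    ((μ p).2 : ℕ) < I.quota i ∧ (I.prefT i).rel (some p) none := by
  have := (h.demands p).2.1
  rw [allocationOf_eq_some hp] at this
  exact of_weight_succ_pos this

theorem AuctionOutcome.place_inj {p q : Fin m} {i : Fin n} (hp : allocationOf μ p = some i)
    (hq : allocationOf μ q = some i) (e : (μ p).2 = (μ q).2) : p = q :=
  h.inj (by rw [allocationOf_eq_some hp, allocationOf_eq_some hq, e])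

theorem AuctionOutcome.feasible : Feasible I (allocationOf μ) := by
  intro i
  rw [← Finset.card_range (I.quota i)]
  refine Finset.card_le_card_of_injOn (fun p => ((μ p).2 : ℕ)) ?_ ?_
  · intro p hp
    simp only [bundle, Finset.coe_filter, Finset.mem_univ, true_and] at hp
    simpa using (h.of_mem hp).1
  · intro p hp q hq e
    simp only [bundle, Finset.coe_filter, Finset.mem_univ, true_and] at hp hq
    exact h.place_inj hp hq (Fin.ext e)

/-- The slot at which the price reaches the weight of `p` is held by somebody whom the team does not
rank below `p`. -/
theorem AuctionOutcome.holder_of_weight_le {p k : Fin m} {i : Fin n}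
    (hk : (k : ℕ) < I.quota i) (hp : (I.prefT i).rel (some p) none)
    (hw : I.weight p (i.succ, k) ≤ π (i.succ, k)) :
    ∃ q, μ q = (i.succ, k) ∧ (I.prefT i).rel (some q) (some p) := by
  have hr : (i.succ, k) ∈ Set.range μ := by
    by_contra hr
    rw [h.free _ hr, weight_succ hk hp] at hw
    omega
  obtain ⟨q, hq⟩ := hr
  refine ⟨q, hq, ?_⟩
  by_contra hrel
  have h1 := (h.demands q).2.2.1
  have h2 := (of_weight_succ_pos (hq ▸ (h.demands q).2.1)).2
  rw [hq] at h1
  have h3 := hw.trans h1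
  rw [weight_succ hk hp, weight_succ hk h2] at h3
  have h4 : ((I.prefT i).rank (some q) + 1) * placeScale m k ≤
      (I.prefT i).rank (some p) * placeScale m k :=
    Nat.mul_le_mul_right _ ((I.prefT i).rank_lt hrel h2)
  have h5 : 2 * m + 2 ≤ placeScale m k := Nat.le_mul_of_pos_right _ (by positivity)
  rw [add_mul, one_mul] at h4
  have := q.2
  omega

theorem AuctionOutcome.holder_of_strict {p k : Fin m} {i : Fin n}
    (hpi : (I.prefP p).strict (some i) (allocationOf μ p)) (hk : (k : ℕ) < I.quota i)
    (hp : (I.prefT i).rel (some p) none) :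
    ∃ q, μ q = (i.succ, k) ∧ (I.prefT i).rel (some q) (some p) :=
  h.holder_of_weight_le hk hp (h.rej p _ ((I.prefP p).tier_lt_iff.2 hpi))

theorem AuctionOutcome.weaklyStable : WeaklyStable I (allocationOf μ) := by
  refine ⟨?_, ?_, ?_⟩
  · rintro ⟨p, p', j, hp', hpj, hpp'⟩
    obtain ⟨h1, h2⟩ := h.of_mem hp'
    obtain ⟨q, hq, hqp⟩ := h.holder_of_strict hpj h1 ((I.prefT j).trans _ _ _ hpp'.1 h2)
    have e : q = p' := h.inj (by rw [hq, allocationOf_eq_some hp'])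
    exact hpp'.2 (e ▸ hqp)
  · intro p i hp
    refine ⟨(h.of_mem hp).2, ?_⟩
    by_contra hrel
    have hlt : (I.prefP p).strict none (some i) := ⟨(I.prefP p).rel_of_not hrel, hrel⟩
    rw [← hp] at hlt
    have hw := h.rej p (0, p) ((I.prefP p).tier_lt_iff.2 hlt)
    rw [weight_private] at hw
    have hr : ((0 : Fin (n + 1)), p) ∈ Set.range μ := by
      by_contra hr
      rw [h.free _ hr] at hw
      omega
    obtain ⟨q, hq⟩ := hr
    have hqp := eq_of_weight_private (hq ▸ (h.demands q).2.1)
    subst hqp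
    rw [allocationOf_eq_some hp] at hq
    exact Fin.succ_ne_zero _ (congrArg Prod.fst hq)
  · rintro ⟨p, i, hpi, hp, hcard⟩
    refine absurd hcard (not_lt.2 ?_)
    have hq := I.quota_le i
    have key : ∀ k : Fin (I.quota i), ∃ q, μ q = (i.succ, Fin.castLE hq k) := fun k =>
      (h.holder_of_strict hpi (k := Fin.castLE hq k) k.2 hp).imp fun _ => And.left
    choose g hg using key
    conv_lhs => rw [← Finset.card_fin (I.quota i)]
    refine Finset.card_le_card_of_injOn g ?_ ?_
    · intro k _
      rw [Finset.mem_coe, mem_bundle, allocationOf, hg, outcomeOf_succ]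
    · intro k _ l _ e
      have := (hg k).symm.trans ((congrArg μ e).trans (hg l))
      exact Fin.castLE_injective hq (congrArg Prod.snd this)

/-- A team `i` that `p` weakly prefers to her own team `j` has, in each place before the place of
`p` in `j`, a participant whom it does not rank below `p`. -/
theorem AuctionOutcome.holder_of_place_lt {p l : Fin m} {i j : Fin n}
    (hpj : allocationOf μ p = some j) (hij : (I.prefP p).rel (some i) (some j))
    (hp : (I.prefT i).strict (some p) none) (hl : l < (μ p).2) (hq : (l : ℕ) < I.quota i) :
    ∃ q, μ q = (i.succ, l) ∧ (I.prefT i).rel (some q) (some p) := by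
  by_cases hji : (I.prefP p).rel (some j) (some i)
  swap
  · exact h.holder_of_strict (hpj ▸ ⟨hij, hji⟩) hq hp.1
  have htier : I.slotTier p (i.succ, l) = I.slotTier p (μ p) := by
    have e : outcomeOf (μ p).1 = some j := hpj
    simp only [MatchingInstance.slotTier, e, outcomeOf_succ]
    exact le_antisymm ((I.prefP p).tier_le_iff.2 hij) ((I.prefP p).tier_le_iff.2 hji)
  have h1 := (h.demands p).2.2.2 _ htier
  obtain ⟨h2, h3⟩ := h.of_mem hpj
  set k := (μ p).2 with hk
  have hμ : μ p = (j.succ, k) := allocationOf_eq_some hpj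
  rw [hμ, weight_succ h2 h3, weight_succ hq hp.1] at h1
  have h4 : (I.prefT j).rank (some p) * placeScale m k ≤ m * placeScale m k :=
    Nat.mul_le_mul_right _ ((I.prefT j).rank_le _)
  have h5 : 2 * m + 2 ≤ placeScale m k := Nat.le_mul_of_pos_right _ (by positivity)
  have h6 : (m + 1) * placeScale m k ≤ placeScale m l := by
    have hlk : (l : ℕ) < k := hl
    have hkm := k.2
    have : (m + 1) ^ (m - k + 1) ≤ (m + 1) ^ (m - (l : ℕ)) :=
      Nat.pow_le_pow_right (by omega) (by omega)
    calc (m + 1) * placeScale m k = (2 * m + 2) * (m + 1) ^ (m - k + 1) := by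
          rw [placeScale, pow_succ]; ring
      _ ≤ _ := Nat.mul_le_mul_left _ this
  rw [add_mul, one_mul] at h6
  have hlow : ∀ c, π (i.succ, l) ≤ m + c * placeScale m l →
      (c + 1) * placeScale m l ≤ (I.prefT i).rank (some p) * placeScale m l → False := by
    intro c hc1 hc2
    rw [add_mul, one_mul] at hc2
    have := p.2
    omega
  have hr : (i.succ, l) ∈ Set.range μ := by
    by_contra hr
    refine hlow 0 (by rw [h.free _ hr]; omega) (Nat.mul_le_mul_right _ ?_)
    have := (I.prefT i).rank_lt hp.2 ((I.prefT i).refl _)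
    omega
  obtain ⟨q, hq'⟩ := hr
  refine ⟨q, hq', ?_⟩
  by_contra hrel
  have h7 := (of_weight_succ_pos (hq' ▸ (h.demands q).2.1)).2
  have h8 := (h.demands q).2.2.1
  rw [hq', weight_succ hq h7] at h8
  have := q.2
  exact hlow _ (by omega) (Nat.mul_le_mul_right _ ((I.prefT i).rank_lt hrel h7))

theorem AuctionOutcome.extendedTeamJustifiedSDEF1 :
    ExtendedTeamJustifiedSDEF1 I (allocationOf μ) := by
  classical
  intro i j _ C hC hpref hcard
  have hCj : ∀ p ∈ C, allocationOf μ p = some j := fun p hp => by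
    simpa [bundle] using hC hp
  -- The number of members of `C` in earlier places of team `j`.
  set idx : Fin m → ℕ := fun p => (C.filter fun q => (μ q).2 < (μ p).2).card with hidx
  have hle : ∀ p ∈ C, idx p ≤ (μ p).2 := by
    intro p _
    rw [← Finset.card_range ((μ p).2 : ℕ)]
    refine Finset.card_le_card_of_injOn (fun q => ((μ q).2 : ℕ)) ?_ ?_
    · intro q hq
      simpa using (Finset.mem_filter.1 hq).2
    · intro q hq q' hq' e
      exact h.place_inj (hCj _ (Finset.mem_filter.1 hq).1) (hCj _ (Finset.mem_filter.1 hq').1)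
        (Fin.ext e)
  have hlt : ∀ p ∈ C, idx p < C.card := by
    intro p hp
    refine Finset.card_lt_card ?_
    rw [Finset.ssubset_iff_of_subset (Finset.filter_subset _ _)]
    exact ⟨p, hp, by simp⟩
  have hmono : ∀ p ∈ C, ∀ q ∈ C, (μ p).2 < (μ q).2 → idx p < idx q := by
    intro p hp q _ hpq
    refine Finset.card_lt_card ?_
    rw [Finset.ssubset_iff_of_subset]
    · exact ⟨p, by simp [hp, hpq], by simp⟩
    · intro r hr
      rw [Finset.mem_filter] at hr ⊢
      exact ⟨hr.1, hr.2.trans hpq⟩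
  have hinj : ∀ p ∈ C, ∀ q ∈ C, idx p = idx q → p = q := by
    intro p hp q hq e
    rcases lt_trichotomy (μ p).2 (μ q).2 with h1 | h1 | h1
    · exact absurd e (hmono p hp q hq h1).ne
    · exact h.place_inj (hCj p hp) (hCj q hq) h1
    · exact absurd e (hmono q hq p hp h1).ne'
  set X := C.filter fun p => idx p = 0 with hX
  have key : ∀ p, ∃ q, p ∈ C \ X →
      (((μ q).2 : ℕ) + 1 = idx p ∧ allocationOf μ q = some i ∧
        (I.prefT i).rel (some q) (some p)) := by
    intro p
    by_cases hp : p ∈ C \ X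
    swap
    · exact ⟨p, fun c => absurd c hp⟩
    simp only [hX, Finset.mem_sdiff, Finset.mem_filter, not_and] at hp
    have h0 := hp.2 hp.1
    have h1 := hle p hp.1
    have h2 := hlt p hp.1
    have h3 := (μ p).2.2
    obtain ⟨q, hq, hqp⟩ := h.holder_of_place_lt (l := ⟨idx p - 1, by omega⟩) (hCj p hp.1)
      (hpref p hp.1).1 (hpref p hp.1).2 (Fin.lt_def.2 (by simp only; omega))
      (by simp only; omega)
    refine ⟨q, fun _ => ⟨?_, ?_, hqp⟩⟩
    · rw [hq]; simp only; omega
    · simp [allocationOf, hq]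
  choose g hg using key
  refine ⟨X, Finset.filter_subset _ _, ?_, ?_⟩
  · rw [Finset.card_le_one]
    intro p hp q hq
    rw [hX, Finset.mem_filter] at hp hq
    exact hinj p hp.1 q hq.1 (hp.2.trans hq.2.symm)
  · have ginj : Set.InjOn g (C \ X : Finset (Fin m)) := by
      intro p hp q hq e
      have h1 := (hg p hp).1
      have h2 := (hg q hq).1
      rw [e] at h1
      exact hinj p (Finset.mem_sdiff.1 hp).1 q (Finset.mem_sdiff.1 hq).1 (h1.symm.trans h2)
    refine ⟨places ((C \ X).image g), ?_, ?_⟩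
    · refine Multiset.map_le_map (Finset.val_le_iff.2 fun q hq => ?_)
      obtain ⟨p, hp, rfl⟩ := Finset.mem_image.1 hq
      simpa [bundle] using (hg p hp).2.1
    · unfold places
      rw [Finset.image_val_of_injOn ginj, Multiset.map_map, Multiset.rel_map]
      exact Multiset.rel_refl_of_refl_on fun p hp => (hg p hp).2.2

omit h

/-! ### Pareto optimality -/

/-- If a multiset dominates the values of a function elementwise, it consists of the values of a
function that dominates the given one pointwise. -/
theorem exists_eq_map_of_rel {α β : Type} [DecidableEq α] {r : β → β → Prop} {f : α → β}
    (K : Finset α) : ∀ M : Multiset β, Multiset.Rel r M (K.val.map f) →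
      ∃ g : α → β, M = K.val.map g ∧ ∀ k ∈ K, r (g k) (f k) := by
  induction K using Finset.induction_on with
  | empty =>
    intro M hM
    simp only [Finset.empty_val, Multiset.map_zero, Multiset.rel_zero_right] at hM
    exact ⟨f, by simp [hM], by simp⟩
  | insert a K ha ih =>
    intro M hM
    rw [Finset.insert_val_of_notMem ha, Multiset.map_cons, Multiset.rel_cons_right] at hM
    obtain ⟨b, M', hb, hM', rfl⟩ := hM
    obtain ⟨g, rfl, hg⟩ := ih M' hM'
    have hne : ∀ k ∈ K, k ≠ a := fun k hk e => ha (e ▸ hk)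
    refine ⟨Function.update g a b, ?_, ?_⟩
    · rw [Finset.insert_val_of_notMem ha, Multiset.map_cons, Function.update_self]
      congr 1
      exact Multiset.map_congr rfl fun k hk => (Function.update_of_ne (hne k hk) _ _).symm
    · intro k hk
      rcases Finset.mem_insert.1 hk with rfl | hk
      · rwa [Function.update_self]
      · rw [Function.update_of_ne (hne k hk)]
        exact hg k hk

/-- The values of a partial bijection from `K` to `Q` are the members of `Q` and as many copies of
`none` as are needed. -/
theorem map_eq_some_add_replicate {α β : Type} [DecidableEq β] (K : Finset α) (Q : Finset β)
    (f : α → Option β)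
    (h1 : ∀ k ∈ K, ∀ p, f k = some p → p ∈ Q) (h2 : ∀ p ∈ Q, ∃ k ∈ K, f k = some p)
    (h3 : ∀ k ∈ K, ∀ l ∈ K, ∀ p, f k = some p → f l = some p → k = l) :
    K.val.map f = Q.val.map some + Multiset.replicate (K.card - Q.card) none := by
  classical
  have e1 : (K.filter fun k => f k ≠ none).val.map f = Q.val.map some := by
    rw [Multiset.Nodup.ext]
    · intro x
      simp only [Multiset.mem_map, Finset.mem_val, Finset.mem_filter]
      constructor
      · rintro ⟨k, ⟨hk, hne⟩, rfl⟩
        obtain ⟨p, hp⟩ := Option.ne_none_iff_exists'.1 hne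
        exact ⟨p, h1 k hk p hp, hp.symm⟩
      · rintro ⟨p, hp, rfl⟩
        obtain ⟨k, hk, e⟩ := h2 p hp
        exact ⟨k, ⟨hk, by simp [e]⟩, e⟩
    · refine Multiset.Nodup.map_on ?_ (Finset.nodup _)
      intro k hk l hl e
      simp only [Finset.mem_val, Finset.mem_filter] at hk hl
      obtain ⟨p, hp⟩ := Option.ne_none_iff_exists'.1 hk.2
      exact h3 k hk.1 l hl.1 p hp (e ▸ hp)
    · exact Q.nodup.map (Option.some_injective _)
  have e2 : (K.filter fun k => ¬ f k ≠ none).val.map f =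
      Multiset.replicate (K.filter fun k => ¬ f k ≠ none).card none := by
    rw [Multiset.eq_replicate]
    refine ⟨by rw [Multiset.card_map, Finset.card_val], fun x hx => ?_⟩
    simp only [Multiset.mem_map, Finset.mem_val, Finset.mem_filter, not_not] at hx
    obtain ⟨k, ⟨_, hk⟩, rfl⟩ := hx
    exact hk
  have e3 : K.val.map f = Q.val.map some +
      Multiset.replicate (K.filter fun k => ¬ f k ≠ none).card none := by
    conv_rhs => rw [← e1, ← e2, ← Multiset.map_add]
    rw [Finset.filter_val, Finset.filter_val, Multiset.filter_add_not]
  rw [e3]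
  congr 2
  have := congrArg Multiset.card e3
  simp only [Multiset.card_map, Multiset.card_add, Multiset.card_replicate, Finset.card_val] at this
  omega

/-- The places of team `i` among the slots. -/
def placesOf (I : MatchingInstance n m) (i : Fin n) : Finset (Fin m) :=
  Finset.univ.filter fun k => (k : ℕ) < I.quota i

theorem card_placesOf (I : MatchingInstance n m) (i : Fin n) :
    (placesOf I i).card = I.quota i := by
  have hq := I.quota_le i
  have : placesOf I i = Finset.univ.map (Fin.castLEEmb hq) := by
    ext k
    simp only [placesOf, Finset.mem_filter, Finset.mem_univ, true_and, Finset.mem_map]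
    constructor
    · intro hk
      exact ⟨⟨k, hk⟩, rfl⟩
    · rintro ⟨l, rfl⟩
      exact l.2
  rw [this, Finset.card_map, Finset.card_fin]

/-- The total weight of an assignment of slots, in terms of the occupants `f i k` of the places. -/
theorem sum_weight_eq {f : Fin n → Fin m → Option (Fin m)}
    (h0 : ∀ p, allocationOf μ p = none → (μ p).2 = p)
    (h1 : ∀ p i, allocationOf μ p = some i → (μ p).2 ∈ placesOf I i ∧ f i (μ p).2 = some p ∧
      (I.prefT i).rel (some p) none)
    (h2 : ∀ i, ∀ k ∈ placesOf I i, ∀ p, f i k = some p → μ p = (i.succ, k)) :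
    ∑ p, I.weight p (μ p) = ∑ p : Fin m, ((p : ℕ) + 1) +
      ∑ i, ∑ k ∈ placesOf I i, (I.prefT i).rank (f i k) * placeScale m k := by
  have e : ∀ p, I.weight p (μ p) = (p : ℕ) + 1 + ∑ i, ∑ k ∈ placesOf I i,
      if f i k = some p then (I.prefT i).rank (some p) * placeScale m k else 0 := by
    intro p
    rcases hp : allocationOf μ p with _ | i
    · have e1 : μ p = (0, p) := Prod.ext (outcomeOf_eq_none.1 hp) (h0 p hp)
      rw [Finset.sum_eq_zero, e1, weight_private, add_zero]
      intro i _
      refine Finset.sum_eq_zero fun k hk => if_neg fun hf => ?_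
      rw [h2 i k hk p hf] at e1
      exact Fin.succ_ne_zero _ (congrArg Prod.fst e1)
    · obtain ⟨a, b, c⟩ := h1 p i hp
      have hμ := allocationOf_eq_some hp
      rw [Finset.sum_eq_single i, Finset.sum_eq_single (μ p).2, if_pos b]
      · conv_lhs => rw [hμ]
        exact weight_succ (by simpa [placesOf] using a) c
      · intro k hk hne
        refine if_neg fun hf => hne ?_
        rw [h2 i k hk p hf]
      · exact fun hne => absurd a hne
      · intro i' _ hne
        refine Finset.sum_eq_zero fun k hk => if_neg fun hf => hne ?_
        rw [h2 i' k hk p hf] at hμ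
        exact Fin.succ_injective _ (congrArg Prod.fst hμ)
      · simp
  rw [Finset.sum_congr rfl fun p _ => e p, Finset.sum_add_distrib, Finset.sum_comm]
  congr 1
  refine Finset.sum_congr rfl fun i _ => ?_
  rw [Finset.sum_comm]
  refine Finset.sum_congr rfl fun k _ => ?_
  rcases f i k with _ | q
  · simp [Pref.rank_none]
  · simp

theorem AuctionOutcome.private_place (h : AuctionOutcome I.weight I.slotTier μ π) {p : Fin m}
    (hp : allocationOf μ p = none) : (μ p).2 = p := by
  have e : μ p = (0, (μ p).2) := Prod.ext (outcomeOf_eq_none.1 hp) rfl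
  exact (eq_of_weight_private (e ▸ (h.demands p).2.1)).symm

theorem AuctionOutcome.paretoOptimal (h : AuctionOutcome I.weight I.slotTier μ π) :
    ParetoOptimal I (allocationOf μ) := by
  classical
  rintro ⟨A', hfeas, hP, hT, hstrict⟩
  -- The occupant of each place under `μ`.
  have hocc : ∃ occ : Fin n → Fin m → Option (Fin m),
      ∀ i k p, occ i k = some p ↔ μ p = (Fin.succ i, k) := by
    have : ∀ (i : Fin n) k, ∃ x : Option (Fin m), ∀ p, x = some p ↔ μ p = (i.succ, k) := by
      intro i k
      by_cases hx : ∃ p, μ p = (i.succ, k)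
      · obtain ⟨p, hp⟩ := hx
        refine ⟨some p, fun q => ⟨?_, ?_⟩⟩
        · rintro ⟨⟩; exact hp
        · intro hq; rw [h.inj (hp.trans hq.symm)]
      · refine ⟨none, fun q => ⟨by simp, fun hq => absurd ⟨q, hq⟩ hx⟩⟩
    choose occ hocc using this
    exact ⟨occ, hocc⟩
  obtain ⟨occ, hocc⟩ := hocc
  have hoccR : ∀ i, ∀ k, (I.prefT i).rel (occ i k) none := by
    intro i k
    rcases e : occ i k with _ | p
    · exact (I.prefT i).refl _
    · have := (h.demands p).2.1
      rw [(hocc i k p).1 e] at this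
      exact (of_weight_succ_pos this).2
  have hfill : ∀ i, filledPlaces I i (bundle (allocationOf μ) i) =
      (placesOf I i).val.map (occ i) := by
    intro i
    rw [map_eq_some_add_replicate (placesOf I i) (bundle (allocationOf μ) i), card_placesOf]
    · rfl
    · intro k _ p hp
      rw [mem_bundle, allocationOf, (hocc i k p).1 hp, outcomeOf_succ]
    · intro p hp
      have hp' : allocationOf μ p = some i := by simpa [bundle] using hp
      exact ⟨(μ p).2, by simpa [placesOf] using (h.of_mem hp').1,
        (hocc i _ p).2 (allocationOf_eq_some hp')⟩
    · intro k _ l _ p hk hl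
      have := ((hocc i k p).1 hk).symm.trans ((hocc i l p).1 hl)
      exact congrArg Prod.snd this
  have hcard : ∀ A : Allocation n m, Feasible I A → ∀ i,
      Multiset.card (filledPlaces I i (bundle A i)) = I.quota i := by
    intro A hA i
    have := hA i
    simp only [filledPlaces, places, Multiset.card_add, Multiset.card_map, Finset.card_val,
      Multiset.card_replicate]
    omega
  -- The occupants under `A'`, matched with those under `μ` whom they replace.
  have hg : ∀ i, ∃ g : Fin m → Option (Fin m),
      filledPlaces I i (bundle A' i) = (placesOf I i).val.map g ∧
      ∀ k ∈ placesOf I i, (I.prefT i).rel (g k) (occ i k) := by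
    intro i
    obtain ⟨Q', hQ', hrel⟩ := hT i
    have e : Q' = filledPlaces I i (bundle A' i) := by
      refine Multiset.eq_of_le_of_card_le hQ' ?_
      rw [Multiset.card_eq_card_of_rel hrel, hcard _ hfeas, hcard _ h.feasible]
    rw [e, hfill] at hrel
    exact exists_eq_map_of_rel _ _ hrel
  choose g hg hgrel using hg
  have hginj : ∀ i, ∀ k ∈ placesOf I i, ∀ l ∈ placesOf I i, ∀ p,
      g i k = some p → g i l = some p → k = l := by
    intro i k hk l hl p h1 h2
    by_contra hne
    have hc : Multiset.count (some p) (filledPlaces I i (bundle A' i)) ≤ 1 := by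
      rw [filledPlaces, Multiset.count_add, Multiset.count_replicate, if_neg (by simp), add_zero]
      exact Multiset.nodup_iff_count_le_one.1
        ((Finset.nodup _).map (Option.some_injective _)) _
    rw [hg i, Multiset.count_map] at hc
    have : ({k, l} : Finset (Fin m)) ⊆ (placesOf I i).filter fun a => some p = g i a := by
      intro a ha
      rcases Finset.mem_insert.1 ha with rfl | ha
      · exact Finset.mem_filter.2 ⟨hk, h1.symm⟩
      · rw [Finset.mem_singleton.1 ha]; exact Finset.mem_filter.2 ⟨hl, h2.symm⟩
    have hc' := Finset.card_le_card this
    rw [Finset.card_pair hne] at hc'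
    rw [← Finset.filter_val, Finset.card_val] at hc
    omega
  have hmem : ∀ i p, A' p = some i ↔ ∃ k ∈ placesOf I i, g i k = some p := by
    intro i p
    have : some p ∈ filledPlaces I i (bundle A' i) ↔ A' p = some i := by
      simp [filledPlaces, places, bundle, Multiset.mem_replicate]
    rw [← this, hg i]
    simp
  have hμ' : ∀ p, ∃ s : Slot n m, outcomeOf s.1 = A' p ∧ (A' p = none → s.2 = p) ∧
      ∀ i, A' p = some i → s.2 ∈ placesOf I i ∧ g i s.2 = some p := by
    intro p
    rcases e : A' p with _ | i
    · exact ⟨(0, p), by simp⟩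
    · obtain ⟨k, hk, hgk⟩ := (hmem i p).1 e
      refine ⟨(i.succ, k), by simp, by simp, ?_⟩
      rintro i' ⟨⟩
      exact ⟨hk, hgk⟩
  choose μ' hμ1 hμ2 hμ3 using hμ'
  have hμA : allocationOf μ' = A' := funext hμ1
  have hinj : Function.Injective μ' := by
    intro p q e
    have eA : A' p = A' q := by rw [← hμ1, ← hμ1, e]
    rcases hp : A' p with _ | i
    · rw [← hμ2 p hp, ← hμ2 q (eA ▸ hp), e]
    · have h1 := (hμ3 p i hp).2
      rw [e, (hμ3 q i (eA ▸ hp)).2] at h1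
      exact (Option.some.inj h1).symm
  have hle : ∀ p, I.slotTier p (μ' p) ≤ I.slotTier p (μ p) := by
    intro p
    rw [MatchingInstance.slotTier, MatchingInstance.slotTier, hμ1, Pref.tier_le_iff]
    exact hP p
  obtain ⟨hsum, hsum'⟩ := h.sum_weight_le (residues I) hinj hle
  have e1 := sum_weight_eq (I := I) (μ := μ) (f := occ) (fun p => h.private_place)
    (fun p i hp => ⟨by simpa [placesOf] using (h.of_mem hp).1,
      (hocc i _ p).2 (allocationOf_eq_some hp), (h.of_mem hp).2⟩)
    (fun i k _ p hp => (hocc i k p).1 hp)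
  have e2 := sum_weight_eq (I := I) (μ := μ') (f := g)
    (fun p hp => hμ2 p (hμA ▸ hp))
    (fun p i hp => by
      rw [hμA] at hp
      obtain ⟨a, b⟩ := hμ3 p i hp
      refine ⟨a, b, ?_⟩
      rw [← b]
      exact (I.prefT i).trans _ _ _ (hgrel i _ a) (hoccR i _))
    (fun i k hk p hp => by
      have hA : A' p = some i := (hmem i p).2 ⟨k, hk, hp⟩
      refine Prod.ext (outcomeOf_eq_some.1 ((hμ1 p).trans hA)) ?_
      exact hginj i _ (hμ3 p i hA).1 k hk p (hμ3 p i hA).2 hp)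
  have hterm : ∀ i, ∀ k ∈ placesOf I i, (I.prefT i).rank (occ i k) * placeScale m k ≤
      (I.prefT i).rank (g i k) * placeScale m k := fun i k hk =>
    Nat.mul_le_mul_right _ ((I.prefT i).rank_mono (hgrel i k hk))
  have hval := Finset.sum_le_sum fun i (_ : i ∈ Finset.univ) => Finset.sum_le_sum (hterm i)
  rcases hstrict with ⟨p, hp⟩ | ⟨i, hi⟩
  · have := hsum' ⟨p, by
      rw [MatchingInstance.slotTier, MatchingInstance.slotTier, hμ1, Pref.tier_lt_iff]
      exact hp⟩
    omega
  · have hk : ∃ k ∈ placesOf I i, ¬ (I.prefT i).rel (occ i k) (g i k) := by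
      by_contra hk
      push Not at hk
      refine hi ⟨_, le_rfl, ?_⟩
      rw [hfill, hg i, Multiset.rel_map]
      exact Multiset.rel_refl_of_refl_on hk
    obtain ⟨k, hk, hne⟩ := hk
    have hlt := (I.prefT i).rank_lt hne (hoccR i k)
    have : ∑ i, ∑ k ∈ placesOf I i, (I.prefT i).rank (occ i k) * placeScale m k <
        ∑ i, ∑ k ∈ placesOf I i, (I.prefT i).rank (g i k) * placeScale m k := by
      refine Finset.sum_lt_sum (fun i _ => Finset.sum_le_sum (hterm i)) ⟨i, Finset.mem_univ _, ?_⟩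
      refine Finset.sum_lt_sum (hterm i) ⟨k, hk, ?_⟩
      refine Nat.mul_lt_mul_of_pos_right hlt ?_
      unfold placeScale; positivity
    omega

/-- The weights do not depend on the preferences of the participants. -/
theorem weight_eq_of_misreport {I I' : MatchingInstance n m} {X : Finset (Fin m)}
    (hI : Misreport I I' X) : I'.weight = I.weight := by
  obtain ⟨h1, h2, -⟩ := hI
  cases I
  cases I'
  simp only at h1 h2
  subst h1 h2
  rfl

theorem exists_not_worse_of_misreport {I I' : MatchingInstance n m} {X : Finset (Fin m)}
    (hI : Misreport I I' X) (hX : X.Nonempty) {μ ν : Fin m → Slot n m} {π ρ : Slot n m → ℕ}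
    (h : AuctionOutcome I.weight I.slotTier μ π)
    (h' : AuctionOutcome I'.weight I'.slotTier ν ρ) :
    ∃ p ∈ X, (I.prefP p).rel (allocationOf μ p) (allocationOf ν p) := by
  rw [weight_eq_of_misreport hI] at h'
  obtain ⟨p, hp, hle⟩ := h.group_strategyproof h' (residues I) (X := X) hX (by
    intro p hp
    funext s
    rw [MatchingInstance.slotTier, MatchingInstance.slotTier, hI.2.2 p (by simpa using hp)])
  exact ⟨p, hp, (I.prefP p).tier_le_iff.1 hle⟩

end Properties

end Weights

/-! ### Total correctness of programs -/

section Hoare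

/-- Started in `σ`, the program `c` halts within `T` steps in a memory that satisfies `Q`. -/
def Ends (c : Program) (σ : Memory) (T : ℕ) (Q : Memory → Prop) : Prop :=
  ∃ σ' t, Exec c σ σ' t ∧ t ≤ T ∧ Q σ'

/-- The arrays to which a program assigns. -/
def Program.writes : Program → List ℕ
  | .skip => []
  | .assign x _ _ => [x]
  | .seq c₁ c₂ => c₁.writes ++ c₂.writes
  | .ite _ c₁ c₂ => c₁.writes ++ c₂.writes
  | .while _ c => c.writes

/-- The memories `σ` and `σ'` agree except for the arrays in `W`. -/
def AgreeOff (W : List ℕ) (σ σ' : Memory) : Prop := ∀ x, x ∉ W → σ' x = σ x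

theorem AgreeOff.refl (W : List ℕ) (σ : Memory) : AgreeOff W σ σ := fun _ _ => rfl

theorem AgreeOff.trans {W : List ℕ} {σ σ' σ'' : Memory} (h : AgreeOff W σ σ')
    (h' : AgreeOff W σ' σ'') : AgreeOff W σ σ'' := fun x hx => (h' x hx).trans (h x hx)

theorem AgreeOff.mono {W W' : List ℕ} {σ σ' : Memory} (h : AgreeOff W σ σ') (hW : W ⊆ W') :
    AgreeOff W' σ σ' := fun x hx => h x fun hx' => hx (hW hx')

theorem Memory.write_of_ne {x y : ℕ} (h : y ≠ x) (σ : Memory) (idx : List ℕ) (v : ℕ) :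
    σ.write x idx v y = σ y := by
  funext idy
  simp [Memory.write, h]

theorem AgreeOff.write {W : List ℕ} {x : ℕ} (hx : x ∈ W) (σ : Memory) (idx : List ℕ) (v : ℕ) :
    AgreeOff W σ (σ.write x idx v) :=
  fun _ hy => Memory.write_of_ne (fun e => hy (by rw [e]; exact hx)) _ _ _

theorem Exec.agreeOff {c : Program} {σ σ' : Memory} {t : ℕ} (h : Exec c σ σ' t) :
    AgreeOff c.writes σ σ' := by
  induction h with
  | skip σ => exact AgreeOff.refl _ _
  | assign σ x idx e => exact AgreeOff.write (by simp [Program.writes]) _ _ _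
  | seq _ _ ih₁ ih₂ =>
    exact (ih₁.mono (List.subset_append_left _ _)).trans (ih₂.mono (List.subset_append_right _ _))
  | ite_true _ _ ih => exact ih.mono (List.subset_append_left _ _)
  | ite_false _ _ ih => exact ih.mono (List.subset_append_right _ _)
  | while_true _ _ _ ih₁ ih₂ => exact ih₁.trans ih₂
  | while_false _ => exact AgreeOff.refl _ _

section Rules

variable {c c₁ c₂ : Program} {σ : Memory} {T T₁ T₂ : ℕ} {Q R : Memory → Prop} {e : Expr}

theorem Ends.mono (h : Ends c σ T₁ Q) (hT : T₁ ≤ T₂) (hQ : ∀ σ', Q σ' → R σ') :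
    Ends c σ T₂ R := by
  obtain ⟨σ', t, h1, h2, h3⟩ := h
  exact ⟨σ', t, h1, h2.trans hT, hQ _ h3⟩

theorem Ends.frame (h : Ends c σ T Q) :
    Ends c σ T fun σ' => Q σ' ∧ AgreeOff c.writes σ σ' := by
  obtain ⟨σ', t, h1, h2, h3⟩ := h
  exact ⟨σ', t, h1, h2, h3, h1.agreeOff⟩

theorem Ends.seq (h₁ : Ends c₁ σ T₁ R) (h₂ : ∀ σ', R σ' → Ends c₂ σ' T₂ Q) :
    Ends (.seq c₁ c₂) σ (T₁ + T₂) Q := by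
  obtain ⟨σ', t, h1, h2, h3⟩ := h₁
  obtain ⟨σ'', t', h1', h2', h3'⟩ := h₂ σ' h3
  exact ⟨σ'', t + t', .seq h1 h1', add_le_add h2 h2', h3'⟩

theorem Ends.ite (h₁ : e.eval σ ≠ 0 → Ends c₁ σ T Q) (h₂ : e.eval σ = 0 → Ends c₂ σ T Q) :
    Ends (.ite e c₁ c₂) σ (T + 1) Q := by
  by_cases he : e.eval σ = 0
  · obtain ⟨σ', t, h1, h2, h3⟩ := h₂ he
    exact ⟨σ', t + 1, .ite_false he h1, by omega, h3⟩
  · obtain ⟨σ', t, h1, h2, h3⟩ := h₁ he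
    exact ⟨σ', t + 1, .ite_true he h1, by omega, h3⟩

/-- A loop ends if each pass through its body lowers a number `v` attached to the memory. -/
theorem Ends.while (P : ℕ → Memory → Prop)
    (hs : ∀ v σ, P v σ → e.eval σ ≠ 0 → Ends c σ T fun σ' => ∃ v' < v, P v' σ') :
    ∀ v σ, P v σ → Ends (.while e c) σ (v * (T + 1) + 1)
      fun σ' => (∃ v', P v' σ') ∧ e.eval σ' = 0 := by
  intro v
  induction v using Nat.strong_induction_on with
  | _ v ih =>
    intro σ h
    by_cases he : e.eval σ = 0
    · exact ⟨σ, 1, .while_false he, by omega, ⟨v, h⟩, he⟩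
    · obtain ⟨σ', t, h1, h2, v', hv', h3⟩ := hs v σ h he
      obtain ⟨σ'', t', h1', h2', h3'⟩ := ih v' hv' σ' h3
      refine ⟨σ'', t + t' + 1, .while_true he h1 h1', ?_, h3'⟩
      have : (v' + 1) * (T + 1) ≤ v * (T + 1) := Nat.mul_le_mul_right _ hv'
      rw [add_mul, one_mul] at this
      omega

/-- The effect of a program without loops. -/
def Program.run : Program → Memory → Memory
  | .skip, σ => σ
  | .assign x idx e, σ => σ.write x (List.ofFn fun j => (idx j).eval σ) (e.eval σ)
  | .seq c₁ c₂, σ => c₂.run (c₁.run σ)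
  | .ite e c₁ c₂, σ => if e.eval σ = 0 then c₂.run σ else c₁.run σ
  | .while _ _, σ => σ

/-- The program has no loops. -/
def Program.straight : Program → Bool
  | .skip => true
  | .assign _ _ _ => true
  | .seq c₁ c₂ => c₁.straight && c₂.straight
  | .ite _ c₁ c₂ => c₁.straight && c₂.straight
  | .while _ _ => false

/-- A bound for the number of steps of a program without loops. -/
def Program.size : Program → ℕ
  | .skip => 1
  | .assign _ _ _ => 1
  | .seq c₁ c₂ => c₁.size + c₂.size
  | .ite _ c₁ c₂ => c₁.size + c₂.size + 1
  | .while _ c => c.size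

theorem Ends.of_run (hc : c.straight = true) (hT : c.size ≤ T) (h : Q (c.run σ)) :
    Ends c σ T Q := by
  refine Ends.mono (T₁ := c.size) (R := Q) (Q := fun σ' => σ' = c.run σ) ?_ hT
    (fun σ' e => e ▸ h)
  clear h hT
  induction c generalizing σ with
  | skip => exact ⟨σ, 1, .skip σ, le_rfl, rfl⟩
  | assign x idx e => exact ⟨_, 1, .assign σ x idx e, le_rfl, rfl⟩
  | seq c₁ c₂ ih₁ ih₂ =>
    simp only [Program.straight, Bool.and_eq_true] at hc
    refine (ih₁ hc.1).seq fun σ' h => ?_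
    subst h
    exact ih₂ hc.2
  | ite e c₁ c₂ ih₁ ih₂ =>
    simp only [Program.straight, Bool.and_eq_true] at hc
    refine Ends.ite (fun he => ?_) (fun he => ?_)
    · refine (ih₁ hc.1).mono (by omega) fun σ' h => ?_
      rw [h, Program.run, if_neg he]
    · refine (ih₂ hc.2).mono (by omega) fun σ' h => ?_
      rw [h, Program.run, if_pos he]
  | _ => simp [Program.straight] at hc

end Rules

/-! ### Abbreviations for programs -/

/-- The value of a scalar variable. -/
def rd0 (x : ℕ) : Expr := .read x ![]
/-- The value of a cell of an array with one index. -/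
def rd1 (x : ℕ) (a : Expr) : Expr := .read x ![a]
/-- The value of a cell of an array with two indices. -/
def rd2 (x : ℕ) (a b : Expr) : Expr := .read x ![a, b]
/-- The value of a cell of an array with three indices. -/
def rd3 (x : ℕ) (a b c : Expr) : Expr := .read x ![a, b, c]
/-- Assignment to a scalar variable. -/
def set0 (x : ℕ) (e : Expr) : Program := .assign x ![] e
/-- Assignment to a cell of an array with one index. -/
def set1 (x : ℕ) (a e : Expr) : Program := .assign x ![a] e
/-- Assignment to a cell of an array with two indices. -/
def set2 (x : ℕ) (a b e : Expr) : Program := .assign x ![a, b] e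
/-- Assignment to a cell of an array with three indices. -/
def set3 (x : ℕ) (a b c e : Expr) : Program := .assign x ![a, b, c] e
/-- Conditional execution. -/
def when (e : Expr) (c : Program) : Program := .ite e c .skip
/-- The loop in which the variable `v` runs from `0` to the value of `e`, exclusively. -/
def forTo (v : ℕ) (e : Expr) (c : Program) : Program :=
  .seq (set0 v (.const 0)) (.while (.lt (rd0 v) e) (.seq c (set0 v (.add (rd0 v) (.const 1)))))

section Eval

variable (σ : Memory) (x : ℕ) (a b c e : Expr)

@[simp] theorem eval_rd0 : (rd0 x).eval σ = σ x [] := by simp [rd0, Expr.eval]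
@[simp] theorem eval_rd1 : (rd1 x a).eval σ = σ x [a.eval σ] := by simp [rd1, Expr.eval]
@[simp] theorem eval_rd2 : (rd2 x a b).eval σ = σ x [a.eval σ, b.eval σ] := by
  simp [rd2, Expr.eval]
@[simp] theorem eval_rd3 : (rd3 x a b c).eval σ = σ x [a.eval σ, b.eval σ, c.eval σ] := by
  simp [rd3, Expr.eval]
@[simp] theorem run_set0 : (set0 x e).run σ = σ.write x [] (e.eval σ) := by
  simp [set0, Program.run]
@[simp] theorem run_set1 : (set1 x a e).run σ = σ.write x [a.eval σ] (e.eval σ) := by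
  simp [set1, Program.run]
@[simp] theorem run_set2 :
    (set2 x a b e).run σ = σ.write x [a.eval σ, b.eval σ] (e.eval σ) := by
  simp [set2, Program.run]
@[simp] theorem run_set3 :
    (set3 x a b c e).run σ = σ.write x [a.eval σ, b.eval σ, c.eval σ] (e.eval σ) := by
  simp [set3, Program.run]

end Eval

section Steps

variable {c c₁ c₂ : Program} {σ : Memory} {T x v i j k : ℕ} {Q : Memory → Prop} {a b d e : Expr}

theorem Ends.guard (P : Prop) (he : e.eval σ ≠ 0 ↔ P) (h₁ : P → Ends c σ T Q) (h₂ : ¬ P → Q σ)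
    (hT : 1 ≤ T) : Ends (when e c) σ (T + 1) Q :=
  Ends.ite (fun h => h₁ (he.1 h))
    fun h => Ends.of_run rfl hT (h₂ fun hP => he.2 hP h)

theorem Ends.cond (P : Prop) (he : e.eval σ ≠ 0 ↔ P) (h₁ : P → Ends c₁ σ T Q)
    (h₂ : ¬ P → Ends c₂ σ T Q) : Ends (.ite e c₁ c₂) σ (T + 1) Q :=
  Ends.ite (fun h => h₁ (he.1 h)) fun h => h₂ fun hP => he.2 hP h

theorem Ends.assign0 (he : e.eval σ = v) (h : Q (σ.write x [] v)) :
    Ends (set0 x e) σ 1 Q :=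
  Ends.of_run rfl le_rfl (by rwa [run_set0, he])

theorem Ends.assign1 (ha : a.eval σ = i) (he : e.eval σ = v) (h : Q (σ.write x [i] v)) :
    Ends (set1 x a e) σ 1 Q :=
  Ends.of_run rfl le_rfl (by rwa [run_set1, ha, he])

theorem Ends.assign2 (ha : a.eval σ = i) (hb : b.eval σ = j) (he : e.eval σ = v)
    (h : Q (σ.write x [i, j] v)) : Ends (set2 x a b e) σ 1 Q :=
  Ends.of_run rfl le_rfl (by rwa [run_set2, ha, hb, he])

theorem Ends.assign3 (ha : a.eval σ = i) (hb : b.eval σ = j) (hd : d.eval σ = k)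
    (he : e.eval σ = v) (h : Q (σ.write x [i, j, k] v)) : Ends (set3 x a b d e) σ 1 Q :=
  Ends.of_run rfl le_rfl (by rwa [run_set3, ha, hb, hd, he])

theorem eval_eq_ne_zero : (Expr.eq a b).eval σ ≠ 0 ↔ a.eval σ = b.eval σ := by
  simp [Expr.eval]

theorem eval_lt_ne_zero : (Expr.lt a b).eval σ ≠ 0 ↔ a.eval σ < b.eval σ := by
  simp [Expr.eval]

end Steps

theorem writes_forTo (v : ℕ) (e : Expr) (c : Program) :
    (forTo v e c).writes = v :: (c.writes ++ [v]) := rfl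

/-- The rule for a loop with an invariant indexed by the number of passes that have been made. The
loop variable may not be assigned to in the body, nor may the bound change. -/
theorem Ends.loop {v : ℕ} {e : Expr} {c : Program} {σ : Memory} {N T : ℕ}
    (I : ℕ → Memory → Prop) (hv : v ∉ c.writes)
    (he : ∀ σ', AgreeOff (v :: c.writes) σ σ' → e.eval σ' = N)
    (h0 : I 0 (σ.write v [] 0))
    (hs : ∀ i < N, ∀ σ', AgreeOff (v :: c.writes) σ σ' → σ' v [] = i → I i σ' →
      Ends c σ' T fun σ'' => I (i + 1) (σ''.write v [] (i + 1))) :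
    Ends (forTo v e c) σ (2 + N * (T + 2)) (I N) := by
  have h1 : Ends (set0 v (.const 0)) σ 1 fun σ' => σ' = σ.write v [] 0 :=
    Ends.of_run rfl le_rfl (by simp [Expr.eval])
  have h2 := Ends.while (e := .lt (rd0 v) e)
    (c := .seq c (set0 v (.add (rd0 v) (.const 1)))) (T := T + 1)
    (fun k σ' => ∃ i, i + k = N ∧ σ' v [] = i ∧ AgreeOff (v :: c.writes) σ σ' ∧ I i σ') (by
      rintro k σ' ⟨i, hik, hi, hag, hI⟩ hc
      simp only [Expr.eval, eval_rd0, hi, he σ' hag] at hc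
      have hiN : i < N := by by_contra hn; simp [hn] at hc
      refine (hs i hiN σ' hag hi hI).frame.seq fun σ'' h => ?_
      have hi' : σ'' v [] = i := by rw [h.2 v hv, hi]
      refine Ends.of_run rfl le_rfl ⟨k - 1, by omega, i + 1, by omega, ?_, ?_, ?_⟩
      · simp [Memory.write, Expr.eval, hi']
      · refine hag.trans ((h.2.mono (by simp)).trans ?_)
        rw [run_set0]
        exact AgreeOff.write (by simp) _ _ _
      · rw [run_set0]
        simpa only [Expr.eval, eval_rd0, hi'] using h.1)
  refine (h1.seq (T₂ := N * (T + 2) + 1) fun σ' e' => ?_).mono (by omega) fun σ' h => h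
  subst e'
  refine (h2 N _ ⟨0, by omega, by simp [Memory.write], AgreeOff.write (by simp) _ _ _, h0⟩).mono
    le_rfl ?_
  rintro σ' ⟨⟨k, i, hik, hi, hag, hI⟩, hc⟩
  simp only [Expr.eval, eval_rd0, hi, he σ' hag] at hc
  have : k = 0 := by by_contra hk; rw [if_pos (by omega)] at hc; omega
  have : i = N := by omega
  exact this ▸ hI

/-- The rule for a loop in which the order of the passes does not matter: the invariant is indexed
by the set of the passes that have been made. -/
theorem Ends.for1 {v : ℕ} {e : Expr} {c : Program} {σ : Memory} {N T : ℕ}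
    (I : Finset (Fin N) → Memory → Prop) (hv : v ∉ c.writes)
    (he : ∀ σ', AgreeOff (v :: c.writes) σ σ' → e.eval σ' = N)
    (hI : ∀ D σ' x, I D σ' → I D (σ'.write v [] x))
    (h0 : I ∅ σ)
    (hs : ∀ (i : Fin N) (D : Finset (Fin N)), i ∉ D → ∀ σ', AgreeOff (v :: c.writes) σ σ' →
      σ' v [] = i → I D σ' → Ends c σ' T (I (insert i D))) :
    Ends (forTo v e c) σ (2 + N * (T + 2)) (I Finset.univ) := by
  refine (Ends.loop (fun i σ' => I (Finset.univ.filter fun j : Fin N => (j : ℕ) < i) σ') hv he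
    (T := T) ?_ ?_).mono le_rfl fun σ' h => ?_
  · simpa using hI _ _ 0 h0
  · intro i hi σ' hag hvi hIi
    refine (hs ⟨i, hi⟩ _ (by simp) σ' hag hvi hIi).mono le_rfl fun σ'' h => hI _ _ _ ?_
    convert h using 1
    ext j
    simp only [Finset.mem_filter, Finset.mem_univ, true_and, Finset.mem_insert, Fin.ext_iff]
    omega
  · simpa using h

theorem Ends.for2 {v₁ v₂ : ℕ} {e₁ e₂ : Expr} {c : Program} {σ : Memory} {N₁ N₂ T : ℕ}
    (I : Finset (Fin N₁ × Fin N₂) → Memory → Prop)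
    (hv : v₁ ≠ v₂ ∧ v₁ ∉ c.writes ∧ v₂ ∉ c.writes)
    (he : ∀ σ', AgreeOff (v₁ :: v₂ :: c.writes) σ σ' → e₁.eval σ' = N₁ ∧ e₂.eval σ' = N₂)
    (hI : ∀ D σ' v x, v = v₁ ∨ v = v₂ → I D σ' → I D (σ'.write v [] x))
    (h0 : I ∅ σ)
    (hs : ∀ (i : Fin N₁) (j : Fin N₂) (D : Finset (Fin N₁ × Fin N₂)), (i, j) ∉ D →
      ∀ σ', AgreeOff (v₁ :: v₂ :: c.writes) σ σ' → σ' v₁ [] = i → σ' v₂ [] = j →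
      I D σ' → Ends c σ' T (I (insert (i, j) D))) :
    Ends (forTo v₁ e₁ (forTo v₂ e₂ c)) σ
      (2 + N₁ * (2 + N₂ * (T + 2) + 2)) (I Finset.univ) := by
  obtain ⟨hv0, hv1, hv2⟩ := hv
  have hsub : v₁ :: (forTo v₂ e₂ c).writes ⊆ v₁ :: v₂ :: c.writes := by
    intro x; simp [writes_forTo]; tauto
  refine (Ends.for1 (fun D σ' => I (D ×ˢ Finset.univ) σ') ?_
    (fun σ' h => (he σ' (h.mono hsub)).1) ?_ (by simpa using h0) ?_).mono le_rfl
    fun σ' h => by simpa using h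
  · simp [writes_forTo, hv0, hv1]
  · exact fun D σ' x h => hI _ _ _ _ (Or.inl rfl) h
  · intro i D hi σ' hag hvi hID
    have hag1 := hag.mono hsub
    have hag2 : ∀ σ'', AgreeOff (v₂ :: c.writes) σ' σ'' →
        AgreeOff (v₁ :: v₂ :: c.writes) σ σ'' := fun σ'' h => hag1.trans (h.mono (by simp))
    refine (Ends.for1 (N := N₂) (fun D' σ' => I (D ×ˢ Finset.univ ∪ {i} ×ˢ D') σ') hv2
      (fun σ'' h => (he σ'' (hag2 _ h)).2) (fun D σ' x h => hI _ _ _ _ (Or.inr rfl) h)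
      (by simpa using hID) ?_).mono le_rfl fun σ'' h => ?_
    · intro j D' hj σ'' hag' hvj hI'
      have hvi' : σ'' v₁ [] = i := by
        rw [hag' v₁ (by simp [hv0, hv1]), hvi]
      refine (hs i j _ ?_ σ'' (hag2 _ hag') hvi' hvj hI').mono le_rfl fun σ₃ h => ?_
      · simp [hi, hj]
      · convert h using 1
        ext ⟨a, b⟩
        simp only [Finset.mem_union, Finset.mem_product, Finset.mem_univ, and_true,
          Finset.mem_singleton, Finset.mem_insert, Prod.mk.injEq]
        tauto
    · convert h using 1
      ext ⟨a, b⟩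
      simp only [Finset.mem_union, Finset.mem_product, Finset.mem_univ, and_true,
        Finset.mem_singleton, Finset.mem_insert, or_comm]

theorem Ends.for3 {v₁ v₂ v₃ : ℕ} {e₁ e₂ e₃ : Expr} {c : Program} {σ : Memory} {N₁ N₂ N₃ T : ℕ}
    (I : Finset (Fin N₁ × Fin N₂ × Fin N₃) → Memory → Prop)
    (hv : v₁ ≠ v₂ ∧ v₁ ≠ v₃ ∧ v₂ ≠ v₃ ∧ v₁ ∉ c.writes ∧ v₂ ∉ c.writes ∧ v₃ ∉ c.writes)
    (he : ∀ σ', AgreeOff (v₁ :: v₂ :: v₃ :: c.writes) σ σ' →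
      e₁.eval σ' = N₁ ∧ e₂.eval σ' = N₂ ∧ e₃.eval σ' = N₃)
    (hI : ∀ D σ' v x, v = v₁ ∨ v = v₂ ∨ v = v₃ → I D σ' → I D (σ'.write v [] x))
    (h0 : I ∅ σ)
    (hs : ∀ (i : Fin N₁) (j : Fin N₂) (k : Fin N₃) (D : Finset (Fin N₁ × Fin N₂ × Fin N₃)),
      (i, j, k) ∉ D → ∀ σ', AgreeOff (v₁ :: v₂ :: v₃ :: c.writes) σ σ' → σ' v₁ [] = i →
      σ' v₂ [] = j → σ' v₃ [] = k → I D σ' → Ends c σ' T (I (insert (i, j, k) D))) :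
    Ends (forTo v₁ e₁ (forTo v₂ e₂ (forTo v₃ e₃ c))) σ
      (2 + N₁ * (2 + N₂ * (2 + N₃ * (T + 2) + 2) + 2)) (I Finset.univ) := by
  obtain ⟨h12, h13, h23, hv1, hv2, hv3⟩ := hv
  have hsub : v₁ :: (forTo v₂ e₂ (forTo v₃ e₃ c)).writes ⊆
      v₁ :: v₂ :: v₃ :: c.writes := by
    intro x; simp [writes_forTo]; tauto
  refine (Ends.for1 (fun D σ' => I (D ×ˢ Finset.univ) σ') ?_
    (fun σ' h => (he σ' (h.mono hsub)).1) ?_ (by simpa using h0) ?_).mono le_rfl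
    fun σ' h => by simpa using h
  · simp [writes_forTo, h12, h13, hv1]
  · exact fun D σ' x h => hI _ _ _ _ (Or.inl rfl) h
  · intro i D hi σ' hag hvi hID
    have hag1 := hag.mono hsub
    have hag2 : ∀ σ'', AgreeOff (v₂ :: v₃ :: c.writes) σ' σ'' →
        AgreeOff (v₁ :: v₂ :: v₃ :: c.writes) σ σ'' := fun σ'' h => hag1.trans (h.mono (by simp))
    refine (Ends.for2 (N₁ := N₂) (N₂ := N₃) (fun D' σ' => I (D ×ˢ Finset.univ ∪ {i} ×ˢ D') σ')
      ⟨h23, hv2, hv3⟩ (fun σ'' h => (he σ'' (hag2 _ h)).2)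
      (fun D σ' v x hv h => hI _ _ _ _ (Or.inr hv) h)
      (by simpa using hID) ?_).mono le_rfl fun σ'' h => ?_
    · intro j k D' hj σ'' hag' hvj hvk hI'
      have hvi' : σ'' v₁ [] = i := by
        rw [hag' v₁ (by simp [h12, h13, hv1]), hvi]
      refine (hs i j k _ ?_ σ'' (hag2 _ hag') hvi' hvj hvk hI').mono le_rfl fun σ₃ h => ?_
      · simp [hi, hj]
      · convert h using 1
        ext ⟨a, b⟩
        simp only [Finset.mem_union, Finset.mem_product, Finset.mem_univ, and_true,
          Finset.mem_singleton, Finset.mem_insert, Prod.mk.injEq]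
        tauto
    · convert h using 1
      ext ⟨a, b⟩
      simp only [Finset.mem_union, Finset.mem_product, Finset.mem_univ, and_true,
        Finset.mem_singleton, Finset.mem_insert, or_comm]

end Hoare

/-! ### Surpluses, demand edges and closures -/

section Searches

variable {n m : ℕ}

/-- The weights stored in a memory. -/
def memWeight (σ : Memory) (p : Fin m) (s : Slot n m) : ℕ := σ 8 [p, s.1, s.2]
/-- The tiers of the slots stored in a memory. -/
def memTier (σ : Memory) (p : Fin m) (s : Slot n m) : ℕ := σ 6 [p, s.1]
/-- The prices stored in a memory. -/
def memPrice (σ : Memory) (s : Slot n m) : ℕ := σ 10 [s.1, s.2]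
/-- The current tiers of the participants stored in a memory. -/
def memStage (σ : Memory) (p : Fin m) : ℕ := σ 11 [p]

/-- `U p` is the largest surplus that `p` can get in her current tier, or `0` if there is none. -/
def IsSurplus {P S : Type} (w rk : P → S → ℕ) (π : S → ℕ) (t : P → ℕ) (U : P → ℕ) : Prop :=
  ∀ p, (∀ s, rk p s = t p → w p s - π s ≤ U p) ∧
    (U p = 0 ∨ ∃ s, rk p s = t p ∧ U p = w p s - π s)

/-- The difference of the weight and the price of the slot at the loop variables. -/
def surplusExpr : Expr := .sub (rd3 8 (rd0 40) (rd0 41) (rd0 42)) (rd2 10 (rd0 41) (rd0 42))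

/-- Tests whether the slot at the loop variables lies in the current tier. -/
def inTierExpr : Expr := .eq (rd2 6 (rd0 40) (rd0 41)) (rd1 11 (rd0 40))

/-- The loop over all participants and slots. -/
def forPairs (c : Program) : Program :=
  forTo 40 (rd0 1) (forTo 41 (.add (rd0 0) (.const 1)) (forTo 42 (rd0 1) c))

theorem write_cell₁ {N : ℕ} (σ : Memory) (x v : ℕ) (p q : Fin N) :
    σ.write x [(p : ℕ)] v x [(q : ℕ)] = if q = p then v else σ x [(q : ℕ)] := by
  simp [Memory.write, Fin.ext_iff]

theorem write_cell₂ {N M : ℕ} (σ : Memory) (x v : ℕ) (p q : Fin N) (a b : Fin M) :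
    σ.write x [(p : ℕ), (a : ℕ)] v x [(q : ℕ), (b : ℕ)] =
      if q = p ∧ b = a then v else σ x [(q : ℕ), (b : ℕ)] := by
  simp [Memory.write, Fin.ext_iff]

/-- The program that computes the largest surpluses. -/
def computeSurplus : Program :=
  .seq (forTo 40 (rd0 1) (set1 12 (rd0 40) (.const 0)))
    (forPairs (when inTierExpr
      (when (.lt (rd1 12 (rd0 40)) surplusExpr) (set1 12 (rd0 40) surplusExpr))))

theorem forPairs_spec {c : Program} {σ : Memory} {T : ℕ} (hn : σ 0 [] = n) (hm : σ 1 [] = m)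
    (I : Finset (Fin m × Slot n m) → Memory → Prop)
    (hc : 0 ∉ c.writes ∧ 1 ∉ c.writes ∧ 40 ∉ c.writes ∧ 41 ∉ c.writes ∧ 42 ∉ c.writes)
    (hI : ∀ D σ' v x, v = 40 ∨ v = 41 ∨ v = 42 → I D σ' → I D (σ'.write v [] x))
    (h0 : I ∅ σ)
    (hs : ∀ (p : Fin m) (s : Slot n m) (D : Finset (Fin m × Slot n m)), (p, s) ∉ D →
      ∀ σ', AgreeOff (40 :: 41 :: 42 :: c.writes) σ σ' → σ' 40 [] = p → σ' 41 [] = s.1 →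
      σ' 42 [] = s.2 → I D σ' → Ends c σ' T (I (insert (p, s) D))) :
    Ends (forPairs c) σ (2 + m * (2 + (n + 1) * (2 + m * (T + 2) + 2) + 2))
      (I Finset.univ) := by
  refine Ends.for3 I (by simpa using hc.2.2) (fun σ' h => ?_) hI h0
    fun p a k D hD σ' hag hp ha hk => hs p (a, k) D hD σ' hag hp ha hk
  have e0 := h 0 (by simpa using hc.1)
  have e1 := h 1 (by simpa using hc.2.1)
  simp [Expr.eval, e0, e1, hn, hm]

theorem computeSurplus_spec {σ : Memory} (hn : σ 0 [] = n) (hm : σ 1 [] = m) :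
    Ends computeSurplus σ (2 + m * 3 + (2 + m * (2 + (n + 1) * (2 + m * 5 + 2) + 2)))
      fun σ' => IsSurplus (memWeight (n := n) (m := m) σ) (memTier σ) (memPrice σ) (memStage σ)
        fun p => σ' 12 [p] := by
  have h1 : Ends (forTo 40 (rd0 1) (set1 12 (rd0 40) (.const 0))) σ (2 + m * 3)
      fun σ' => ∀ p : Fin m, σ' 12 [p] = 0 := by
    refine (Ends.for1 (N := m) (T := 1) (fun D σ' => ∀ p ∈ D, σ' 12 [p] = 0) (by decide)
      (fun σ' h => ?_) (fun D σ' x h p hp => ?_) (by simp)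
      fun p D _ σ' _ hp h => Ends.of_run rfl le_rfl ?_).mono le_rfl fun σ' h p => h p (by simp)
    · simp [h 1 (by decide), hm]
    · simpa [Memory.write] using h p hp
    · intro q hq
      by_cases e : q = p
      · simp [e, hp, Memory.write, Expr.eval]
      · have := h q ((Finset.mem_insert.1 hq).resolve_left e)
        simp [hp, Memory.write, Expr.eval, this]
  refine h1.frame.seq fun σ₁ ⟨hz, hag₁⟩ => ?_
  refine (forPairs_spec (n := n) (m := m) (T := 3) (by rw [hag₁ 0 (by decide), hn])
    (by rw [hag₁ 1 (by decide), hm])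
    (fun D σ' => ∀ p : Fin m,
      (∀ s, (p, s) ∈ D → memTier σ p s = memStage σ p →
        memWeight σ p s - memPrice σ s ≤ σ' 12 [p]) ∧
      (σ' 12 [p] = 0 ∨ ∃ s : Slot n m, memTier σ p s = memStage σ p ∧
        σ' 12 [p] = memWeight σ p s - memPrice σ s))
    (by decide) ?_ (fun p => ⟨by simp, Or.inl (hz p)⟩) ?_).mono le_rfl
    fun σ' h p => ⟨fun s hs => (h p).1 s (by simp) hs, (h p).2⟩
  · intro D σ' v x hv h
    rw [Memory.write_of_ne (by omega)]; exact h
  · intro p s D _ σ' hag' hp ha hk h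
    have hag := (hag₁.mono (W' := [12, 40, 41, 42]) (by decide)).trans (hag'.mono (by decide))
    have e6 := hag 6 (by decide)
    have e8 := hag 8 (by decide)
    have e10 := hag 10 (by decide)
    have e11 := hag 11 (by decide)
    have key : ∀ u : Fin m → ℕ, (∀ q, q ≠ p → u q = σ' 12 [q]) → σ' 12 [p] ≤ u p →
        (memTier σ p s = memStage σ p → memWeight σ p s - memPrice σ s ≤ u p) →
        (u p = σ' 12 [p] ∨
          memTier σ p s = memStage σ p ∧ u p = memWeight σ p s - memPrice σ s) →
        ∀ q, (∀ s', (q, s') ∈ insert (p, s) D → memTier σ q s' = memStage σ q →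
          memWeight σ q s' - memPrice σ s' ≤ u q) ∧
        (u q = 0 ∨ ∃ s : Slot n m, memTier σ q s = memStage σ q ∧
          u q = memWeight σ q s - memPrice σ s) := by
      intro u hne hle hnew hor q
      by_cases hq : q = p
      · subst hq
        refine ⟨fun s' hs' ht => ?_, ?_⟩
        · rcases Finset.mem_insert.1 hs' with e | e
          · obtain ⟨-, rfl⟩ := Prod.mk.inj e
            exact hnew ht
          · exact ((h q).1 s' e ht).trans hle
        · rcases hor with e | ⟨e, e'⟩
          · rw [e]; exact (h q).2
          · exact Or.inr ⟨s, e, e'⟩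
      · rw [hne q hq]
        refine ⟨fun s' hs' ht => (h q).1 s' ?_ ht, (h q).2⟩
        exact (Finset.mem_insert.1 hs').resolve_left fun e => hq (Prod.mk.inj e).1
    refine Ends.guard (T := 2) (memTier σ p s = memStage σ p)
      (by simp [inTierExpr, eval_eq_ne_zero, hp, ha, e6, e11, memTier, memStage]) (fun ht => ?_)
      (fun ht => key _ (fun _ _ => rfl) le_rfl (fun c => absurd c ht) (Or.inl rfl)) (by omega)
    have hval : surplusExpr.eval σ' = memWeight σ p s - memPrice σ s := by
      simp [surplusExpr, Expr.eval, hp, ha, hk, e8, e10, memWeight, memPrice]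
    refine Ends.guard (T := 1) (σ' 12 [p] < memWeight σ p s - memPrice σ s)
      (by simp [eval_lt_ne_zero, hp, hval]) (fun hlt => ?_)
      (fun hlt => key _ (fun _ _ => rfl) le_rfl (fun _ => not_lt.1 hlt) (Or.inl rfl)) le_rfl
    refine Ends.assign1 (i := p) (by simp [hp]) hval (key _ (fun q hq => ?_) ?_ ?_ ?_)
    · simp only [write_cell₁, if_neg hq]
    all_goals simp only [write_cell₁, if_true]
    · exact hlt.le
    · exact fun _ => le_rfl
    · exact Or.inr ⟨ht, trivial⟩

/-- The state of a search from the seeds against the direction of the edges `A`: `F p` is the time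
stamp of `p`, which is `0` before `p` is found and `1` if `p` is a seed, `N p` is the vertex from
which `p` was found, and `c` is the next stamp. -/
structure SearchInv (A : Fin m → Fin m → Prop) (seed : Fin m → Prop) (F N : Fin m → ℕ) (c : ℕ) :
    Prop where
  seed_iff : ∀ p, F p = 1 ↔ seed p
  step : ∀ p, 1 < F p → ∃ q : Fin m, A p q ∧ N p = q ∧ 0 < F q ∧ F q < F p
  lt : ∀ p, F p < c
  two_le : 2 ≤ c
  le : c + (Finset.univ.filter fun p => F p = 0).card ≤ m + 2

theorem SearchInv.found {A : Fin m → Fin m → Prop} {seed : Fin m → Prop} {F N : Fin m → ℕ}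
    {c : ℕ} (h : SearchInv A seed F N c) {p q : Fin m} (hp : F p = 0) (hq : F q ≠ 0)
    (hA : A p q) :
    SearchInv A seed (Function.update F p c) (Function.update N p q) (c + 1) ∧
      (Finset.univ.filter fun a => Function.update F p c a = 0).card <
        (Finset.univ.filter fun a => F a = 0).card := by
  have h2 := h.two_le
  have hcard : (Finset.univ.filter fun a => Function.update F p c a = 0).card <
      (Finset.univ.filter fun a => F a = 0).card := by
    refine Finset.card_lt_card ?_
    rw [Finset.ssubset_iff_of_subset]
    · refine ⟨p, by simp [hp], ?_⟩
      simp only [Finset.mem_filter, Finset.mem_univ, true_and, Function.update_self]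
      omega
    · intro a ha
      simp only [Finset.mem_filter, Finset.mem_univ, true_and] at ha ⊢
      by_cases e : a = p
      · rw [e, hp]
      · rwa [Function.update_of_ne e] at ha
  refine ⟨⟨?_, ?_, ?_, by omega, by have := h.le; omega⟩, hcard⟩
  · intro a
    by_cases e : a = p
    · subst e
      rw [Function.update_self, ← h.seed_iff, hp]
      omega
    · rw [Function.update_of_ne e, h.seed_iff]
  · intro a ha
    by_cases e : a = p
    · subst e
      have hqa : q ≠ a := fun e => hq (e ▸ hp)
      refine ⟨q, hA, by simp, ?_⟩
      rw [Function.update_self, Function.update_of_ne hqa]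
      exact ⟨by omega, h.lt q⟩
    · rw [Function.update_of_ne e] at ha
      obtain ⟨b, h1, h2, h3, h4⟩ := h.step a ha
      have hb : b ≠ p := fun e => by rw [e, hp] at h3; omega
      exact ⟨b, h1, by rwa [Function.update_of_ne e], by rwa [Function.update_of_ne hb],
        by rwa [Function.update_of_ne hb, Function.update_of_ne e]⟩
  · intro a
    by_cases e : a = p
    · rw [e, Function.update_self]; omega
    · rw [Function.update_of_ne e]
      exact (h.lt a).trans (by omega)

/-- The result of a search from the seeds against the direction of the edges `A`. -/
structure IsClosure (A : Fin m → Fin m → Prop) (seed : Fin m → Prop) (F N : Fin m → ℕ) :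
    Prop where
  seed_iff : ∀ p, F p = 1 ↔ seed p
  step : ∀ p, 1 < F p → ∃ q : Fin m, A p q ∧ N p = q ∧ 0 < F q ∧ F q < F p
  le : ∀ p, F p ≤ m + 1
  closed : ∀ p q, A p q → F q ≠ 0 → F p ≠ 0

/-- The search along the edges given by the expression `adj` in the loop variables; array `g` holds
the stamps and array `x` the vertices from which the others are found. The passes over all pairs are
repeated until nothing changes. -/
def searchProgram (g x : ℕ) (adj : Expr) : Program :=
  .seq (set0 31 (.const 2)) (.seq (set0 32 (.const 1))
    (.while (rd0 32) (.seq (set0 32 (.const 0)) (forTo 40 (rd0 1) (forTo 41 (rd0 1)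
      (when (.eq (rd1 g (rd0 40)) (.const 0)) (when (rd1 g (rd0 41)) (when adj
        (.seq (set1 g (rd0 40) (rd0 31)) (.seq (set1 x (rd0 40) (rd0 41))
          (.seq (set0 31 (.add (rd0 31) (.const 1))) (set0 32 (.const 1)))))))))))))

/-- The number of steps that a search takes at most. -/
def searchTime (m : ℕ) : ℕ := 2 + ((m + 1) * (1 + (2 + m * (2 + m * 9 + 2)) + 1) + 1)

theorem searchProgram_spec {g x : ℕ} {adj : Expr} {σ : Memory} (hm : σ 1 [] = m)
    (hg : g ∉ [1, 31, 32, 40, 41]) (hx : x ∉ [1, 31, 32, 40, 41]) (hgx : g ≠ x)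
    {A : Fin m → Fin m → Prop} {seed : Fin m → Prop}
    (hadj : ∀ σ' (p q : Fin m), AgreeOff [31, 32, 40, 41, g, x] σ σ' → σ' 40 [] = p →
      σ' 41 [] = q → (adj.eval σ' ≠ 0 ↔ A p q))
    (hseed : ∀ p : Fin m, σ g [p] ≤ 1 ∧ (σ g [p] = 1 ↔ seed p)) :
    Ends (searchProgram g x adj) σ (searchTime m) fun σ' =>
      IsClosure A seed (fun p => σ' g [p]) (fun p => σ' x [p]) := by
  simp only [List.mem_cons, List.not_mem_nil, or_false, not_or] at hg hx
  obtain ⟨hg1, hg31, hg32, hg40, hg41⟩ := hg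
  obtain ⟨hx1, hx31, hx32, hx40, hx41⟩ := hx
  set W := [31, 32, 40, 41, g, x] with hW
  set cnt : Memory → ℕ := fun σ' => (Finset.univ.filter fun p : Fin m => σ' g [p] = 0).card
    with hcnt
  set Inv : Memory → Prop := fun σ' =>
    SearchInv A seed (fun p => σ' g [p]) (fun p => σ' x [p]) (σ' 31 []) with hInv
  have hbody : ∀ σ₁ : Memory, AgreeOff W σ σ₁ → Inv σ₁ → σ₁ 32 [] = 0 →
      Ends (forTo 40 (rd0 1) (forTo 41 (rd0 1)
        (when (.eq (rd1 g (rd0 40)) (.const 0)) (when (rd1 g (rd0 41)) (when adj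
          (.seq (set1 g (rd0 40) (rd0 31)) (.seq (set1 x (rd0 40) (rd0 41))
            (.seq (set0 31 (.add (rd0 31) (.const 1))) (set0 32 (.const 1)))))))))) σ₁
        (2 + m * (2 + m * 9 + 2)) fun σ' => Inv σ' ∧
          (σ' 32 [] = 0 → ∀ p q : Fin m, A p q → σ' g [q] ≠ 0 → σ' g [p] ≠ 0) ∧
          (σ' 32 [] ≠ 0 → cnt σ' < cnt σ₁) := by
    intro σ₁ hag₁ hI₁ hc₁
    refine (Ends.for2 (N₁ := m) (N₂ := m) (T := 7) (fun D σ' => Inv σ' ∧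
        (σ' 32 [] = 0 → (∀ p q : Fin m, (p, q) ∈ D → A p q → σ' g [q] ≠ 0 → σ' g [p] ≠ 0) ∧
          cnt σ' ≤ cnt σ₁) ∧
        (σ' 32 [] ≠ 0 → cnt σ' < cnt σ₁)) ?_ ?_ ?_ ?_ ?_).mono le_rfl ?_
    · simp [Program.writes, when, set1, set0]
      omega
    · intro σ' h
      have e1 := h 1 (by simp [Program.writes, when, set1, set0]; omega)
      have e1' := hag₁ 1 (by simp [hW]; omega)
      simp [e1, e1', hm]
    · intro D σ' v y hv h
      have e : ∀ z, z ≠ 40 → z ≠ 41 → σ'.write v [] y z = σ' z := fun z h1 h2 =>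
        Memory.write_of_ne (by omega) _ _ _
      simpa only [hInv, hcnt, e g hg40 hg41, e x hx40 hx41, e 31 (by omega) (by omega),
        e 32 (by omega) (by omega)] using h
    · exact ⟨hI₁, fun _ => ⟨by simp, le_rfl⟩, fun h => absurd hc₁ h⟩
    · intro p q D _ σ' hag' hp hq h
      have hag : AgreeOff W σ σ' := hag₁.trans (hag'.mono (by
        intro y
        simp only [hW, Program.writes, when, set1, set0, List.append_nil, List.mem_cons,
          List.mem_append, List.not_mem_nil, or_false]
        tauto))
      have hsame : (A p q → σ' g [(q : ℕ)] ≠ 0 → σ' g [(p : ℕ)] ≠ 0) →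
          Inv σ' ∧ (σ' 32 [] = 0 → (∀ p' q' : Fin m, (p', q') ∈ insert (p, q) D → A p' q' →
            σ' g [(q' : ℕ)] ≠ 0 → σ' g [(p' : ℕ)] ≠ 0) ∧ cnt σ' ≤ cnt σ₁) ∧
          (σ' 32 [] ≠ 0 → cnt σ' < cnt σ₁) := by
        intro hcl
        refine ⟨h.1, fun h0 => ⟨fun p' q' hm' => ?_, (h.2.1 h0).2⟩, h.2.2⟩
        rcases Finset.mem_insert.1 hm' with e | e
        · obtain ⟨rfl, rfl⟩ := Prod.mk.inj e
          exact hcl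
        · exact (h.2.1 h0).1 p' q' e
      refine Ends.guard (T := 6) (σ' g [(p : ℕ)] = 0)
        (by simp [hp, Expr.eval]) (fun hp0 => ?_)
        (fun hp0 => hsame fun _ _ => hp0) (by omega)
      refine Ends.guard (T := 5) (σ' g [(q : ℕ)] ≠ 0) (by simp [hq]) (fun hq0 => ?_)
        (fun hq0 => hsame fun _ hq1 => absurd hq1 hq0) (by omega)
      refine Ends.guard (T := 4) (A p q) (hadj σ' p q hag hp hq) (fun hA => ?_)
        (fun hA => hsame fun hA' => absurd hA' hA) (by omega)
      obtain ⟨h1, h2⟩ := h.1.found hp0 hq0 hA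
      refine Ends.of_run rfl le_rfl ?_
      set τ := Program.run (.seq (set1 g (rd0 40) (rd0 31)) (.seq (set1 x (rd0 40) (rd0 41))
            (.seq (set0 31 (.add (rd0 31) (.const 1))) (set0 32 (.const 1))))) σ' with hτ
      have hτg : (fun a : Fin m => τ g [(a : ℕ)]) =
          Function.update (fun a : Fin m => σ' g [(a : ℕ)]) p (σ' 31 []) := by
        funext a
        simp only [hτ, Program.run, run_set0, run_set1, eval_rd0]
        rw [Memory.write_of_ne hg32, Memory.write_of_ne hg31, Memory.write_of_ne hgx, hp,
          write_cell₁, Function.update_apply]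
      have hτx : (fun a : Fin m => τ x [(a : ℕ)]) =
          Function.update (fun a : Fin m => σ' x [(a : ℕ)]) p q := by
        funext a
        simp only [hτ, Program.run, run_set0, run_set1, eval_rd0]
        rw [Memory.write_of_ne hx32, Memory.write_of_ne hx31,
          Memory.write_of_ne (Ne.symm hg40), Memory.write_of_ne (Ne.symm hg41), hp, hq,
          write_cell₁, Function.update_apply, Memory.write_of_ne hgx.symm]
      have hτ31 : τ 31 [] = σ' 31 [] + 1 := by
        simp [hτ, Program.run, Memory.write, Expr.eval, Ne.symm hg31, Ne.symm hx31]
      have hτ32 : τ 32 [] ≠ 0 := by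
        simp [hτ, Program.run, Memory.write, Expr.eval]
      have hcτ : cnt τ < cnt σ' := by
        have e : ∀ a : Fin m, τ g [(a : ℕ)] =
          Function.update (fun a : Fin m => σ' g [(a : ℕ)]) p (σ' 31 []) a := congrFun hτg
        simpa only [hcnt, e] using h2
      refine ⟨?_, fun h0 => absurd h0 hτ32, fun _ => hcτ.trans_le ?_⟩
      · rw [hInv]
        simp only [hτg, hτx, hτ31]
        exact h1
      · by_cases h0 : σ' 32 [] = 0
        · exact (h.2.1 h0).2
        · exact (h.2.2 h0).le
    · exact fun σ' h => ⟨h.1, fun h0 p q => (h.2.1 h0).1 p q (by simp), h.2.2⟩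
  have hinit : ∀ σ₁ : Memory, (∀ z, z ≠ 31 → z ≠ 32 → σ₁ z = σ z) → σ₁ 31 [] = 2 → Inv σ₁ := by
    intro σ₁ h h31
    refine ⟨fun p => ?_, fun p hp => ?_, fun p => ?_, ?_, ?_⟩
    · simp only [h g hg31 hg32]; exact (hseed p).2
    · simp only [h g hg31 hg32] at hp
      have := (hseed p).1
      omega
    · simp only [h g hg31 hg32, h31]
      have := (hseed p).1
      omega
    · rw [h31]
    · rw [h31]
      have := Finset.card_filter_le (Finset.univ : Finset (Fin m)) fun p => σ₁ g [(p : ℕ)] = 0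
      rw [Finset.card_fin] at this
      omega
  have hsub : ∀ {σ₁ σ₂ : Memory}, AgreeOff (forTo 40 (rd0 1) (forTo 41 (rd0 1)
        (when (.eq (rd1 g (rd0 40)) (.const 0)) (when (rd1 g (rd0 41)) (when adj
          (.seq (set1 g (rd0 40) (rd0 31)) (.seq (set1 x (rd0 40) (rd0 41))
            (.seq (set0 31 (.add (rd0 31) (.const 1))) (set0 32 (.const 1)))))))))).writes σ₁ σ₂ →
      AgreeOff W σ₁ σ₂ := by
    intro σ₁ σ₂ h
    refine h.mono ?_
    intro y
    simp only [hW, writes_forTo, Program.writes, when, set1, set0, List.append_nil, List.mem_cons,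
      List.mem_append, List.not_mem_nil, or_false]
    tauto
  have hwhile := Ends.while (e := rd0 32) (T := 1 + (2 + m * (2 + m * 9 + 2)))
    (c := .seq (set0 32 (.const 0)) (forTo 40 (rd0 1) (forTo 41 (rd0 1)
      (when (.eq (rd1 g (rd0 40)) (.const 0)) (when (rd1 g (rd0 41)) (when adj
        (.seq (set1 g (rd0 40) (rd0 31)) (.seq (set1 x (rd0 40) (rd0 41))
          (.seq (set0 31 (.add (rd0 31) (.const 1))) (set0 32 (.const 1)))))))))))
    (fun v σ' => AgreeOff W σ σ' ∧ Inv σ' ∧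
      (σ' 32 [] = 0 → ∀ p q : Fin m, A p q → σ' g [(q : ℕ)] ≠ 0 → σ' g [(p : ℕ)] ≠ 0) ∧
      (σ' 32 [] ≠ 0 → cnt σ' < v)) (by
    rintro v σ₁ ⟨hag, hI, _, hlt⟩ h32
    have hlt' := hlt (by simpa using h32)
    have he : ∀ z, z ≠ 32 → σ₁.write 32 [] 0 z = σ₁ z := fun z hz =>
      Memory.write_of_ne hz _ _ _
    refine (Ends.assign0 (v := 0) (Q := fun σ₂ => σ₂ = σ₁.write 32 [] 0) rfl rfl).seq
      fun σ₂ e₂ => ?_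
    subst e₂
    have hag₂ : AgreeOff W σ (σ₁.write 32 [] 0) :=
      hag.trans (AgreeOff.write (by simp [hW]) _ _ _)
    have hI₂ : Inv (σ₁.write 32 [] 0) := by
      simpa only [hInv, he g hg32, he x hx32, he 31 (by omega)] using hI
    have hc₂ : cnt (σ₁.write 32 [] 0) = cnt σ₁ := by
      simp only [hcnt, he g hg32]
    refine (hbody _ hag₂ hI₂ (by simp [Memory.write])).frame.mono le_rfl ?_
    rintro σ₃ ⟨⟨h1, h2, h3⟩, h4⟩
    refine ⟨if σ₃ 32 [] = 0 then 0 else cnt σ₁, ?_, hag₂.trans (hsub h4), h1, h2, fun h0 => ?_⟩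
    · split_ifs <;> omega
    · rw [if_neg h0]
      exact (h3 h0).trans_eq hc₂)
  have h1 : Ends (set0 31 (.const 2)) σ 1 fun σ₁ => σ₁ = σ.write 31 [] 2 :=
    Ends.assign0 rfl rfl
  refine (h1.seq (T₂ := 1 + ((m + 1) * (1 + (2 + m * (2 + m * 9 + 2)) + 1) + 1))
    fun σ₁ e₁ => ?_).mono (by unfold searchTime; omega) fun _ h => h
  subst e₁
  refine (Ends.assign0 (v := 1) (Q := fun σ₂ => σ₂ = (σ.write 31 [] 2).write 32 [] 1) rfl
    rfl).seq fun σ₂ e₂ => ?_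
  have hne : ∀ z, z ≠ 31 → z ≠ 32 → σ₂ z = σ z := fun z hz hz' => by
    rw [e₂, Memory.write_of_ne hz', Memory.write_of_ne hz]
  refine (hwhile (m + 1) σ₂ ⟨?_, ?_, ?_, ?_⟩).mono le_rfl ?_
  · intro z hz
    simp only [hW, List.mem_cons, List.not_mem_nil, or_false, not_or] at hz
    exact hne z hz.1 hz.2.1
  · exact hinit _ hne (by simp [e₂, Memory.write])
  · simp [e₂, Memory.write]
  · intro _
    have := Finset.card_filter_le (Finset.univ : Finset (Fin m)) fun p => σ₂ g [(p : ℕ)] = 0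
    rw [Finset.card_fin] at this
    simp only [hcnt]
    omega
  · rintro σ₃ ⟨⟨v, _, h2, h3, _⟩, h5⟩
    have h4 : σ₃ 32 [] = 0 := by simpa using h5
    refine ⟨h2.seed_iff, h2.step, fun p => ?_, h3 h4⟩
    have h6 := h2.lt p
    have h7 := h2.le
    -- A found vertex is not counted among the others.
    by_cases hp : σ₃ g [(p : ℕ)] = 0
    · simp [hp]
    · have : (Finset.univ.filter fun p : Fin m => σ₃ g [(p : ℕ)] = 0).card ≤ m := by
        simpa using Finset.card_filter_le (Finset.univ : Finset (Fin m))
          fun p => σ₃ g [(p : ℕ)] = 0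
      omega

end Searches

/-! ### Progress of the auction -/

section Edges

section Progress

variable {P S : Type} {w rk : P → S → ℕ} {hold : S → Option P} {π : S → ℕ} {t : P → ℕ}
  {U : P → ℕ}

/-- The auction can move on at `q` without a change of the prices: no slot in the current tier has a
positive surplus for `q`, or `q` demands a free slot. -/
def CanMove (w rk : P → S → ℕ) (hold : S → Option P) (π : S → ℕ) (t : P → ℕ) (q : P) : Prop :=
  (∀ s, rk q s = t q → w q s ≤ π s) ∨ ∃ s, hold s = none ∧ Demands w rk π t q s

theorem IsSurplus.demands_iff (hU : IsSurplus w rk π t U) {p : P} (hp : U p ≠ 0) {s : S} :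
    Demands w rk π t p s ↔ rk p s = t p ∧ w p s = π s + U p := by
  obtain ⟨h1, h2⟩ := hU p
  constructor
  · rintro ⟨h3, h4, h5, h6⟩
    obtain ⟨s', h7, h8⟩ := h2.resolve_left hp
    have := h6 s' h7
    have := h1 s h3
    exact ⟨h3, by omega⟩
  · rintro ⟨h3, h4⟩
    refine ⟨h3, by omega, by omega, fun s' hs' => ?_⟩
    have := h1 s' hs'
    omega

theorem IsSurplus.eq_zero_iff (hU : IsSurplus w rk π t U) {p : P} :
    U p = 0 ↔ ∀ s, rk p s = t p → w p s ≤ π s := by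
  obtain ⟨h1, h2⟩ := hU p
  constructor
  · intro h s hs
    have := h1 s hs
    omega
  · intro h
    rcases h2 with h2 | ⟨s, hs, h2⟩
    · exact h2
    · have := h s hs
      omega

/-- The amount by which the prices of the slots held by `R` rise: the largest one for which the
surpluses of the members of `R` stay nonnegative and at least those of the other slots. -/
structure IsRise (w rk : P → S → ℕ) (hold : S → Option P) (π : S → ℕ) (t : P → ℕ) (U : P → ℕ)
    (R : Set P) (δ : ℕ) : Prop where
  le : ∀ p ∈ R, δ ≤ U p
  le_sub : ∀ p ∈ R, ∀ s, rk p s = t p → (¬ ∃ q ∈ R, hold s = some q) →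
    δ ≤ U p - (w p s - π s)
  attained : (∃ p ∈ R, δ = U p) ∨ ∃ p ∈ R, ∃ s, rk p s = t p ∧
    (¬ ∃ q ∈ R, hold s = some q) ∧ δ = U p - (w p s - π s)

theorem IsRise.bound {R : Set P} {δ : ℕ} (hU : IsSurplus w rk π t U)
    (hR : ∀ p ∈ R, U p ≠ 0) (hδ : IsRise w rk hold π t U R δ) :
    ∀ p ∈ R, ∀ s, Demands w rk π t p s → π s + δ ≤ w p s ∧
      ∀ s', rk p s' = t p → (¬ ∃ q ∈ R, hold s' = some q) → w p s' + (π s + δ) ≤ w p s + π s' := by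
  intro p hp s hs
  obtain ⟨_, h2⟩ := (hU.demands_iff (hR p hp)).1 hs
  have h3 := hδ.le p hp
  refine ⟨by omega, fun s' hs' hn => ?_⟩
  have h4 := hδ.le_sub p hp s' hs' hn
  have h5 := (hU p).1 s' hs'
  omega

/-- After the rise of the prices, the auction can move on at some member of `R`, or some member of
`R` demands a slot whose holder is not in `R`. -/
theorem IsRise.progress {R : Set P} {δ : ℕ} (hU : IsSurplus w rk π t U)
    (hR : ∀ p ∈ R, U p ≠ 0) (hδ : IsRise w rk hold π t U R δ) :
    (∃ p ∈ R, CanMove w rk hold (raise hold R δ π) t p) ∨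
      ∃ q ∈ R, ∃ p ∉ R, ∃ s, hold s = some p ∧ Demands w rk (raise hold R δ π) t q s := by
  have e1 : ∀ s, (∃ q ∈ R, hold s = some q) → raise hold R δ π s = π s + δ := fun s h => if_pos h
  have e2 : ∀ s, (¬ ∃ q ∈ R, hold s = some q) → raise hold R δ π s = π s := fun s h => if_neg h
  have hzero : ∀ p ∈ R, δ = U p → CanMove w rk hold (raise hold R δ π) t p := by
    intro p hp e
    refine Or.inl fun s hs => ?_
    have h1 := (hU p).1 s hs
    by_cases hN : ∃ q ∈ R, hold s = some q
    · rw [e1 s hN]; omega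
    · rw [e2 s hN]
      have h2 := hδ.le_sub p hp s hs hN
      have h3 := hR p hp
      omega
  rcases hδ.attained with ⟨p, hp, e⟩ | ⟨p, hp, s, hs, hN, e⟩
  · exact Or.inl ⟨p, hp, hzero p hp e⟩
  · by_cases hle : w p s ≤ π s
    · exact Or.inl ⟨p, hp, hzero p hp (by omega)⟩
    · have h0 := (hU p).1 s hs
      have hd : Demands w rk (raise hold R δ π) t p s := by
        refine ⟨hs, by omega, by rw [e2 s hN]; omega, fun s' hs' => ?_⟩
        rw [e2 s hN]
        have h1 := (hU p).1 s' hs'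
        have h2 := hδ.le p hp
        by_cases hN' : ∃ q ∈ R, hold s' = some q
        · rw [e1 s' hN']; omega
        · rw [e2 s' hN']
          have h3 := hδ.le_sub p hp s' hs' hN'
          omega
      rcases hh : hold s with _ | q
      · exact Or.inl ⟨p, hp, Or.inr ⟨s, hh, hd⟩⟩
      · exact Or.inr ⟨p, hp, q, fun hq => hN ⟨q, hq, hh⟩, s, hh, hd⟩

end Progress

/-! ### The program for demand edges -/

variable {n m : ℕ}

/-- Array `9` of the memory holds the codes of the holders of the slots. -/
def MemHolds (σ : Memory) (hold : Slot n m → Option (Fin m)) : Prop :=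
  ∀ s, σ 9 [(s.1 : ℕ), (s.2 : ℕ)] = code (hold s)

/-- What is known after the pairs in `D` have been searched for demand edges; `wants p s` says that
`p` demands `s` with a positive surplus `U p`. -/
structure EdgesInv (wants : Fin m → Slot n m → Prop) (hold : Slot n m → Option (Fin m))
    (U : Fin m → ℕ) (D : Finset (Fin m × Slot n m)) (σ : Memory) : Prop where
  adj : ∀ p s q, (p, s) ∈ D → wants p s → hold s = some q →
    σ 13 [(p : ℕ), (q : ℕ)] ≠ 0 ∧ σ 18 [(q : ℕ)] = s.1 ∧ σ 19 [(q : ℕ)] = s.2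
  of_adj : ∀ p q : Fin m, σ 13 [(p : ℕ), (q : ℕ)] ≠ 0 →
    ∃ s, (p, s) ∈ D ∧ wants p s ∧ hold s = some q
  free : ∀ p s, (p, s) ∈ D → wants p s → hold s = none → σ 14 [(p : ℕ)] = 1
  le : ∀ p : Fin m, σ 14 [(p : ℕ)] ≤ 1
  zero : ∀ p, U p = 0 → σ 14 [(p : ℕ)] = 1
  of_one : ∀ p : Fin m, σ 14 [(p : ℕ)] = 1 → U p = 0 ∨ ∃ s, (p, s) ∈ D ∧ wants p s ∧
    hold s = none ∧ σ 16 [(p : ℕ)] = s.1 ∧ σ 17 [(p : ℕ)] = s.2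

/-- The code of the holder of the slot at the loop variables. -/
def holderExpr : Expr := rd2 9 (rd0 41) (rd0 42)

/-- The program that finds the demand edges `13` between participants, the slots `18`, `19` of the
participants at their ends, and the participants at whom the auction can move on, marked in `14` and
with a free slot in `16`, `17`. -/
def computeEdges : Program :=
  .seq (forTo 40 (rd0 1) (forTo 41 (rd0 1) (set2 13 (rd0 40) (rd0 41) (.const 0))))
    (.seq (forTo 40 (rd0 1) (set1 14 (rd0 40) (.eq (rd1 12 (rd0 40)) (.const 0))))
      (forPairs (when inTierExpr (when (rd1 12 (rd0 40))
        (when (.eq (rd3 8 (rd0 40) (rd0 41) (rd0 42))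
            (.add (rd2 10 (rd0 41) (rd0 42)) (rd1 12 (rd0 40))))
          (.ite holderExpr
            (.seq (set2 13 (rd0 40) (.sub holderExpr (.const 1)) (.const 1))
              (.seq (set1 18 (.sub holderExpr (.const 1)) (rd0 41))
                (set1 19 (.sub holderExpr (.const 1)) (rd0 42))))
            (.seq (set1 14 (rd0 40) (.const 1))
              (.seq (set1 16 (rd0 40) (rd0 41)) (set1 17 (rd0 40) (rd0 42))))))))))

theorem code_some {k : ℕ} (i : Fin k) : code (some i) = i + 1 := rfl

theorem code_ne_zero {k : ℕ} {x : Option (Fin k)} : code x ≠ 0 ↔ ∃ i, x = some i := by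
  cases x <;> simp [code]

theorem EdgesInv.skip {wants : Fin m → Slot n m → Prop} {hold : Slot n m → Option (Fin m)}
    {U : Fin m → ℕ} {D : Finset (Fin m × Slot n m)} {σ : Memory} (h : EdgesInv wants hold U D σ)
    {p : Fin m} {s : Slot n m} (hp : ¬ wants p s) : EdgesInv wants hold U (insert (p, s) D) σ := by
  have key : ∀ {p' s'}, (p', s') ∈ insert (p, s) D → wants p' s' → (p', s') ∈ D := by
    intro p' s' hm hw
    refine (Finset.mem_insert.1 hm).resolve_left fun e => hp ?_
    obtain ⟨rfl, rfl⟩ := Prod.mk.inj e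
    exact hw
  refine ⟨fun p' s' q hm hw => h.adj p' s' q (key hm hw) hw, fun p' q hne => ?_,
    fun p' s' hm hw => h.free p' s' (key hm hw) hw, h.le, h.zero, fun p' h1 => ?_⟩
  · obtain ⟨s', h1, h2⟩ := h.of_adj p' q hne
    exact ⟨s', Finset.mem_insert_of_mem h1, h2⟩
  · refine (h.of_one p' h1).imp id ?_
    rintro ⟨s', h1, h2⟩
    exact ⟨s', Finset.mem_insert_of_mem h1, h2⟩

theorem computeEdges_spec {σ : Memory} (hn : σ 0 [] = n) (hm : σ 1 [] = m)
    {hold : Slot n m → Option (Fin m)} (hh : MemHolds σ hold)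
    (hinj : ∀ s s' p, hold s = some p → hold s' = some p → s = s') :
    Ends computeEdges σ ((2 + m * (2 + m * 3 + 2)) + ((2 + m * 3) +
        (2 + m * (2 + (n + 1) * (2 + m * 12 + 2) + 2)))) fun σ' =>
      EdgesInv (fun p s => memTier σ p s = memStage σ p ∧ σ 12 [(p : ℕ)] ≠ 0 ∧
        memWeight σ p s = memPrice σ s + σ 12 [(p : ℕ)]) hold
        (fun p => σ 12 [(p : ℕ)]) Finset.univ σ' := by
  have h1 : Ends (forTo 40 (rd0 1) (forTo 41 (rd0 1) (set2 13 (rd0 40) (rd0 41) (.const 0)))) σ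
      (2 + m * (2 + m * 3 + 2)) fun σ' => ∀ p q : Fin m, σ' 13 [(p : ℕ), (q : ℕ)] = 0 := by
    refine (Ends.for2 (N₁ := m) (N₂ := m) (T := 1)
      (fun D σ' => ∀ p q, (p, q) ∈ D → σ' 13 [(p : ℕ), (q : ℕ)] = 0) (by decide)
      (fun σ' h => by simp [h 1 (by decide), hm]) (fun D σ' v x hv h => ?_) (by simp)
      fun p q D _ σ' _ hp hq h => Ends.assign2 (i := p) (j := q) (by simp [hp]) (by simp [hq])
        rfl ?_).mono le_rfl fun σ' h p q => h p q (by simp)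
    · rw [Memory.write_of_ne (by omega)]; exact h
    · intro p' q' hm'
      rw [write_cell₂]
      split_ifs with e
      · rfl
      · refine h p' q' ((Finset.mem_insert.1 hm').resolve_left fun e' => e ?_)
        exact Prod.mk.inj e'
  refine h1.frame.seq fun σ₁ ⟨hz, hag₁⟩ => ?_
  have h2 : Ends (forTo 40 (rd0 1) (set1 14 (rd0 40) (.eq (rd1 12 (rd0 40)) (.const 0)))) σ₁
      (2 + m * 3) fun σ' => ∀ p : Fin m, σ' 14 [(p : ℕ)] = if σ 12 [(p : ℕ)] = 0 then 1 else 0 := by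
    refine (Ends.for1 (N := m) (T := 1) (fun D σ' => ∀ p ∈ D,
      σ' 14 [(p : ℕ)] = if σ 12 [(p : ℕ)] = 0 then 1 else 0) (by decide)
      (fun σ' h => ?_) (fun D σ' x h => ?_) (by simp)
      fun p D _ σ' hag hp h => ?_).mono le_rfl fun σ' h p => h p (by simp)
    · simp [h 1 (by decide), hag₁ 1 (by decide), hm]
    · rw [Memory.write_of_ne (by omega)]; exact h
    · refine Ends.assign1 (i := p) (by simp [hp]) rfl ?_
      intro q hq
      rw [write_cell₁]
      split_ifs with e
      · subst e
        simp [Expr.eval, hag 12 (by decide), hag₁ 12 (by decide), *]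
      · subst e
        simp [Expr.eval, hag 12 (by decide), hag₁ 12 (by decide), *]
      · simpa [*] using h q ((Finset.mem_insert.1 hq).resolve_left e)
      · simpa [*] using h q ((Finset.mem_insert.1 hq).resolve_left e)
  refine h2.frame.seq fun σ₂ ⟨hg, hag₂'⟩ => ?_
  have hag₂ : AgreeOff [13, 14, 16, 17, 18, 19, 40, 41, 42] σ σ₂ :=
    (hag₁.mono (by decide)).trans (hag₂'.mono (by decide))
  set wants : Fin m → Slot n m → Prop := fun p s => memTier σ p s = memStage σ p ∧
    σ 12 [(p : ℕ)] ≠ 0 ∧ memWeight σ p s = memPrice σ s + σ 12 [(p : ℕ)] with hwants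
  refine (forPairs_spec (n := n) (m := m) (T := 10) (by rw [hag₂ 0 (by decide), hn])
    (by rw [hag₂ 1 (by decide), hm])
    (EdgesInv wants hold fun p => σ 12 [(p : ℕ)]) (by decide) ?_ ?_ ?_).mono le_rfl
    fun σ' h => h
  · intro D σ' v x hv h
    have e : ∀ z, z ≠ 40 → z ≠ 41 → z ≠ 42 → σ'.write v [] x z = σ' z := fun z _ _ _ =>
      Memory.write_of_ne (by omega) _ _ _
    obtain ⟨a1, a2, a3, a4, a5, a6⟩ := h
    constructor <;> simpa only [e 13 (by omega) (by omega) (by omega),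
      e 14 (by omega) (by omega) (by omega), e 16 (by omega) (by omega) (by omega),
      e 17 (by omega) (by omega) (by omega), e 18 (by omega) (by omega) (by omega),
      e 19 (by omega) (by omega) (by omega)]
  · have hz' : ∀ p q : Fin m, σ₂ 13 [(p : ℕ), (q : ℕ)] = 0 := by
      intro p q; rw [hag₂' 13 (by decide), hz]
    refine ⟨by simp, fun p q hne => absurd (hz' p q) hne, by simp, fun p => ?_, fun p hp => ?_,
      fun p hp => ?_⟩
    · rw [hg]; split_ifs <;> omega
    · rw [hg, if_pos hp]
    · rw [hg] at hp
      by_contra hcon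
      push Not at hcon
      rw [if_neg hcon.1] at hp
      omega
  · intro p s D _ σ' hag' hp ha hk h
    have hag : AgreeOff [13, 14, 16, 17, 18, 19, 40, 41, 42] σ σ' :=
      hag₂.trans (hag'.mono (by decide))
    have e6 := hag 6 (by decide)
    have e8 := hag 8 (by decide)
    have e9 := hag 9 (by decide)
    have e10 := hag 10 (by decide)
    have e11 := hag 11 (by decide)
    have e12 := hag 12 (by decide)
    refine Ends.guard (T := 9) (memTier σ p s = memStage σ p)
      (by simp [inTierExpr, eval_eq_ne_zero, hp, ha, e6, e11, memTier, memStage]) (fun c1 => ?_)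
      (fun c1 => h.skip fun c => c1 c.1) (by omega)
    refine Ends.guard (T := 8) (σ 12 [(p : ℕ)] ≠ 0) (by simp [hp, e12]) (fun c2 => ?_)
      (fun c2 => h.skip fun c => c2 c.2.1) (by omega)
    refine Ends.guard (T := 7) (memWeight σ p s = memPrice σ s + σ 12 [(p : ℕ)])
      (by rw [eval_eq_ne_zero]
          simp [Expr.eval, hp, ha, hk, e8, e10, e12, memWeight, memPrice]) (fun c3 => ?_)
      (fun c3 => h.skip fun c => c3 c.2.2) (by omega)
    have hw : wants p s := ⟨c1, c2, c3⟩
    have hhold : holderExpr.eval σ' = code (hold s) := by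
      simp [holderExpr, ha, hk, e9, hh s]
    refine Ends.cond (T := 6) (∃ q, hold s = some q) (by rw [hhold, code_ne_zero]) ?_ ?_
    · rintro ⟨q, hq⟩
      have hq' : (Expr.sub holderExpr (.const 1)).eval σ' = q := by
        simp [Expr.eval, hhold, hq, code_some]
      refine Ends.of_run rfl (by decide) ?_
      set τ := Program.run (.seq (set2 13 (rd0 40) (.sub holderExpr (.const 1)) (.const 1))
              (.seq (set1 18 (.sub holderExpr (.const 1)) (rd0 41))
                (set1 19 (.sub holderExpr (.const 1)) (rd0 42)))) σ' with hτ
      have hτe : τ = ((σ'.write 13 [(p : ℕ), (q : ℕ)] 1).write 18 [(q : ℕ)] s.1).write 19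
          [(q : ℕ)] s.2 := by
        have hx : ∀ z i v, z ≠ 9 → z ≠ 41 → z ≠ 42 →
            (Expr.sub holderExpr (.const 1)).eval (σ'.write z i v) = q := by
          intro z i v h1 h2 h3
          rw [← hq']
          simp [holderExpr, Expr.eval, Memory.write, h1.symm, h2.symm, h3.symm]
        have hx' : ∀ z i v z' i' v', z ≠ 9 → z ≠ 41 → z ≠ 42 → z' ≠ 9 → z' ≠ 41 → z' ≠ 42 →
            (Expr.sub holderExpr (.const 1)).eval ((σ'.write z i v).write z' i' v') = q := by
          intro z i v z' i' v' h1 h2 h3 h4 h5 h6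
          rw [← hq']
          simp [holderExpr, Expr.eval, Memory.write, h1.symm, h2.symm, h3.symm, h4.symm, h5.symm,
            h6.symm]
        simp only [hτ, Program.run, run_set2, run_set1, hq', eval_rd0, hp]
        rw [hx _ _ _ (by omega) (by omega) (by omega),
          hx' _ _ _ _ _ _ (by omega) (by omega) (by omega) (by omega) (by omega) (by omega),
          Memory.write_of_ne (by omega), Memory.write_of_ne (by omega),
          Memory.write_of_ne (by omega), ha, hk]
        rfl
      have t13 : ∀ a b : Fin m, τ 13 [(a : ℕ), (b : ℕ)] =
          if a = p ∧ b = q then 1 else σ' 13 [(a : ℕ), (b : ℕ)] := by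
        intro a b
        rw [hτe, Memory.write_of_ne (by omega), Memory.write_of_ne (by omega), write_cell₂]
      have t18 : ∀ a : Fin m, τ 18 [(a : ℕ)] = if a = q then (s.1 : ℕ) else σ' 18 [(a : ℕ)] := by
        intro a
        rw [hτe, Memory.write_of_ne (by omega), write_cell₁, Memory.write_of_ne (by omega)]
      have t19 : ∀ a : Fin m, τ 19 [(a : ℕ)] = if a = q then (s.2 : ℕ) else σ' 19 [(a : ℕ)] := by
        intro a
        rw [hτe, write_cell₁, Memory.write_of_ne (by omega), Memory.write_of_ne (by omega)]
      have t : ∀ z, z ≠ 13 → z ≠ 18 → z ≠ 19 → τ z = σ' z := fun z h1 h2 h3 => by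
        rw [hτe, Memory.write_of_ne h3, Memory.write_of_ne h2, Memory.write_of_ne h1]
      have t14 := t 14 (by omega) (by omega) (by omega)
      have t16 := t 16 (by omega) (by omega) (by omega)
      have t17 := t 17 (by omega) (by omega) (by omega)
      refine ⟨?_, ?_, ?_, ?_, ?_, ?_⟩
      · intro a s' b hm' hw' hb
        rw [t13, t18, t19]
        by_cases hbq : b = q
        · subst hbq
          obtain rfl := hinj _ _ _ hb hq
          rw [if_pos rfl, if_pos rfl]
          refine ⟨?_, rfl, rfl⟩
          rcases Finset.mem_insert.1 hm' with e | e
          · rw [(Prod.mk.inj e).1, if_pos ⟨rfl, rfl⟩]; omega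
          · split_ifs
            · omega
            · exact (h.adj a s' b e hw' hb).1
        · rw [if_neg hbq, if_neg hbq, if_neg fun c => hbq c.2]
          refine h.adj a s' b ((Finset.mem_insert.1 hm').resolve_left fun e => hbq ?_) hw' hb
          rw [(Prod.mk.inj e).2, hq] at hb
          exact (Option.some.inj hb).symm
      · intro a b hne
        rw [t13] at hne
        split_ifs at hne with c
        · exact ⟨s, by simp [c.1], c.1 ▸ hw, c.2 ▸ hq⟩
        · obtain ⟨s', b1, b2⟩ := h.of_adj a b hne
          exact ⟨s', Finset.mem_insert_of_mem b1, b2⟩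
      · intro a s' hm' hw' hb
        rw [t14]
        refine h.free a s' ((Finset.mem_insert.1 hm').resolve_left fun e => ?_) hw' hb
        rw [(Prod.mk.inj e).2, hq] at hb
        cases hb
      · rw [t14]; exact h.le
      · rw [t14]; exact h.zero
      · rw [t14, t16, t17]
        intro a ha'
        refine (h.of_one a ha').imp id ?_
        rintro ⟨s', b1, b2⟩
        exact ⟨s', Finset.mem_insert_of_mem b1, b2⟩
    · intro hq
      have hq : hold s = none := by
        rcases e : hold s with _ | q
        · rfl
        · exact absurd ⟨q, e⟩ hq
      refine Ends.of_run rfl (by decide) ?_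
      set τ := Program.run (.seq (set1 14 (rd0 40) (.const 1))
              (.seq (set1 16 (rd0 40) (rd0 41)) (set1 17 (rd0 40) (rd0 42)))) σ' with hτ
      have hτe : τ = ((σ'.write 14 [(p : ℕ)] 1).write 16 [(p : ℕ)] s.1).write 17 [(p : ℕ)] s.2 := by
        simp only [hτ, Program.run, run_set1, eval_rd0]
        simp [Memory.write_of_ne, hp, ha, hk, Expr.eval]
      have t14 : ∀ a : Fin m, τ 14 [(a : ℕ)] = if a = p then 1 else σ' 14 [(a : ℕ)] := by
        intro a
        rw [hτe, Memory.write_of_ne (by omega), Memory.write_of_ne (by omega), write_cell₁]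
      have t16 : ∀ a : Fin m, τ 16 [(a : ℕ)] = if a = p then (s.1 : ℕ) else σ' 16 [(a : ℕ)] := by
        intro a
        rw [hτe, Memory.write_of_ne (by omega), write_cell₁, Memory.write_of_ne (by omega)]
      have t17 : ∀ a : Fin m, τ 17 [(a : ℕ)] = if a = p then (s.2 : ℕ) else σ' 17 [(a : ℕ)] := by
        intro a
        rw [hτe, write_cell₁, Memory.write_of_ne (by omega), Memory.write_of_ne (by omega)]
      have t : ∀ z, z ≠ 14 → z ≠ 16 → z ≠ 17 → τ z = σ' z := fun z h1 h2 h3 => by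
        rw [hτe, Memory.write_of_ne h3, Memory.write_of_ne h2, Memory.write_of_ne h1]
      have t13 := t 13 (by omega) (by omega) (by omega)
      have t18 := t 18 (by omega) (by omega) (by omega)
      have t19 := t 19 (by omega) (by omega) (by omega)
      refine ⟨?_, ?_, ?_, ?_, ?_, ?_⟩
      · rw [t13, t18, t19]
        intro a s' b hm' hw' hb
        refine h.adj a s' b ((Finset.mem_insert.1 hm').resolve_left fun e => ?_) hw' hb
        rw [(Prod.mk.inj e).2, hq] at hb
        cases hb
      · rw [t13]
        intro a b hne
        obtain ⟨s', b1, b2⟩ := h.of_adj a b hne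
        exact ⟨s', Finset.mem_insert_of_mem b1, b2⟩
      · intro a s' hm' hw' hb
        rw [t14]
        split_ifs with e
        · rfl
        · refine h.free a s' ((Finset.mem_insert.1 hm').resolve_left fun e' => e ?_) hw' hb
          exact (Prod.mk.inj e').1
      · intro a
        rw [t14]
        have := h.le a
        split_ifs <;> omega
      · intro a ha'
        rw [t14]
        have := h.zero a ha'
        split_ifs <;> omega
      · intro a ha'
        rw [t16, t17]
        by_cases e : a = p
        · subst e
          exact Or.inr ⟨s, by simp, hw, hq, by simp, by simp⟩
        · rw [t14, if_neg e] at ha'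
          rw [if_neg e, if_neg e]
          refine (h.of_one a ha').imp id ?_
          rintro ⟨s', b1, b2⟩
          exact ⟨s', Finset.mem_insert_of_mem b1, b2⟩

end Edges

/-! ### One step of the auction -/

section Step

variable {n m : ℕ}

/-- The memory describes a state of the auction in which `hold` gives the holders of the slots. -/
structure AuctionMem (w rk : Fin m → Slot n m → ℕ) (hold : Slot n m → Option (Fin m))
    (σ : Memory) : Prop where
  teams : σ 0 [] = n
  participants : σ 1 [] = m
  weight : memWeight σ = w
  tier : memTier σ = rk
  holds : MemHolds σ hold
  inv : AuctionInv w rk hold (memPrice σ) (memStage σ)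

/-- The participants in `E` have entered the auction, and all of them but `r` have a slot. -/
structure Carries (E : Set (Fin m)) (hold : Slot n m → Option (Fin m)) (r : Fin m) : Prop where
  unmatched : ∀ s, hold s ≠ some r
  mem_iff : ∀ p, p ∈ E ↔ p = r ∨ ∃ s, hold s = some p

variable {w rk : Fin m → Slot n m → ℕ} {hold : Slot n m → Option (Fin m)} {σ : Memory}
  {E : Set (Fin m)} {r : Fin m}

theorem memPrice_congr {σ' : Memory} (h : σ' 10 = σ 10) :
    (memPrice σ' : Slot n m → ℕ) = memPrice σ := by
  funext s; simp [memPrice, h]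

theorem memStage_congr {σ' : Memory} (h : σ' 11 = σ 11) :
    (memStage σ' : Fin m → ℕ) = memStage σ := by
  funext s; simp [memStage, h]

theorem AuctionMem.of_eq (h : AuctionMem w rk hold σ) {σ' : Memory}
    {hold' : Slot n m → Option (Fin m)} (h0 : σ' 0 = σ 0) (h1 : σ' 1 = σ 1) (h6 : σ' 6 = σ 6)
    (h8 : σ' 8 = σ 8) (hh : MemHolds σ' hold')
    (hi : AuctionInv w rk hold' (memPrice σ') (memStage σ')) : AuctionMem w rk hold' σ' where
  teams := by rw [h0, h.teams]
  participants := by rw [h1, h.participants]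
  weight := by rw [← h.weight]; funext p s; simp [memWeight, h8]
  tier := by rw [← h.tier]; funext p s; simp [memTier, h6]
  holds := hh
  inv := hi

theorem AuctionMem.of_agreeOff (h : AuctionMem w rk hold σ) {σ' : Memory} {W : List ℕ}
    (hag : AgreeOff W σ σ') (hW : ∀ z ∈ [0, 1, 6, 8, 9, 10, 11], z ∉ W) :
    AuctionMem w rk hold σ' := by
  refine h.of_eq (hag _ (hW 0 (by decide))) (hag _ (hW 1 (by decide))) (hag _ (hW 6 (by decide)))
    (hag _ (hW 8 (by decide))) ?_ ?_
  · intro s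
    rw [hag _ (hW 9 (by decide))]
    exact h.holds s
  · rw [memPrice_congr (hag _ (hW 10 (by decide))), memStage_congr (hag _ (hW 11 (by decide)))]
    exact h.inv

theorem MemHolds.write (h : MemHolds σ hold) (s : Slot n m) (p : Fin m) :
    MemHolds (σ.write 9 [(s.1 : ℕ), (s.2 : ℕ)] (p + 1)) (Function.update hold s (some p)) := by
  intro s'
  by_cases e : s' = s
  · subst e
    simp [Memory.write, code]
  · rw [Function.update_of_ne e, ← h s']
    have : ¬ ((s'.1 : ℕ) = s.1 ∧ (s'.2 : ℕ) = s.2) := fun c =>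
      e (Prod.ext (Fin.ext c.1) (Fin.ext c.2))
    simp [Memory.write, this]

/-- If `r` takes the slot of `q`, then `q` is the one without a slot. -/
theorem Carries.pass (h : Carries E hold r) {q : Fin m} {s : Slot n m}
    (hinj : ∀ s s' p, hold s = some p → hold s' = some p → s = s') (hs : hold s = some q) :
    Carries E (Function.update hold s (some r)) q := by
  have hqr : q ≠ r := fun e => h.unmatched s (e ▸ hs)
  constructor
  · intro s' hs'
    by_cases e : s' = s
    · rw [e, Function.update_self] at hs'
      exact hqr (Option.some.inj hs').symm
    · rw [Function.update_of_ne e] at hs'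
      exact e (hinj _ _ _ hs' hs)
  · intro p
    rw [h.mem_iff]
    constructor
    · rintro (rfl | ⟨s', hs'⟩)
      · exact Or.inr ⟨s, by simp⟩
      · by_cases e : s' = s
        · rw [e, hs] at hs'
          exact Or.inl (Option.some.inj hs').symm
        · exact Or.inr ⟨s', by rw [Function.update_of_ne e, hs']⟩
    · rintro (rfl | ⟨s', hs'⟩)
      · exact Or.inr ⟨s, hs⟩
      · by_cases e : s' = s
        · rw [e, Function.update_self] at hs'
          exact Or.inl (Option.some.inj hs').symm
        · rw [Function.update_of_ne e] at hs'
          exact Or.inr ⟨s', hs'⟩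

theorem Carries.settle (h : Carries E hold r) {s : Slot n m} (hs : hold s = none) (p : Fin m) :
    p ∈ E ↔ ∃ s', Function.update hold s (some r) s' = some p := by
  rw [h.mem_iff]
  constructor
  · rintro (rfl | ⟨s', hs'⟩)
    · exact ⟨s, by simp⟩
    · refine ⟨s', ?_⟩
      rw [Function.update_of_ne, hs']
      rintro rfl
      rw [hs] at hs'
      cases hs'
  · rintro ⟨s', hs'⟩
    by_cases e : s' = s
    · rw [e, Function.update_self] at hs'
      exact Or.inl (Option.some.inj hs').symm
    · rw [Function.update_of_ne e] at hs'
      exact Or.inr ⟨s', hs'⟩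

/-- The results of the search for the participants at whom the auction can move on, and for the
demand paths that lead to them. -/
structure Searched (w rk : Fin m → Slot n m → ℕ) (hold : Slot n m → Option (Fin m))
    (σ : Memory) : Prop where
  surplus : IsSurplus w rk (memPrice σ) (memStage σ) fun p => σ 12 [(p : ℕ)]
  adj_iff : ∀ p q : Fin m, σ 13 [(p : ℕ), (q : ℕ)] ≠ 0 ↔ σ 12 [(p : ℕ)] ≠ 0 ∧
    ∃ s, hold s = some q ∧ Demands w rk (memPrice σ) (memStage σ) p s
  slot : ∀ (p q : Fin m) s, σ 12 [(p : ℕ)] ≠ 0 →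
    Demands w rk (memPrice σ) (memStage σ) p s → hold s = some q →
    σ 18 [(q : ℕ)] = s.1 ∧ σ 19 [(q : ℕ)] = s.2
  closure : IsClosure (fun p q : Fin m => σ 13 [(p : ℕ), (q : ℕ)] ≠ 0)
    (CanMove w rk hold (memPrice σ) (memStage σ)) (fun p => σ 14 [(p : ℕ)])
    (fun p => σ 15 [(p : ℕ)])
  free : ∀ p : Fin m, σ 14 [(p : ℕ)] = 1 → σ 12 [(p : ℕ)] ≠ 0 → ∃ s, hold s = none ∧
    Demands w rk (memPrice σ) (memStage σ) p s ∧ σ 16 [(p : ℕ)] = s.1 ∧ σ 17 [(p : ℕ)] = s.2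

/-- The program that searches for the possible moves. -/
def findMoves : Program :=
  .seq computeSurplus (.seq computeEdges (searchProgram 14 15 (rd2 13 (rd0 40) (rd0 41))))

/-- The number of steps that the search for the possible moves takes at most. -/
def findMovesTime (n m : ℕ) : ℕ :=
  (2 + m * 3 + (2 + m * (2 + (n + 1) * (2 + m * 5 + 2) + 2))) +
    (((2 + m * (2 + m * 3 + 2)) + ((2 + m * 3) +
        (2 + m * (2 + (n + 1) * (2 + m * 12 + 2) + 2)))) + searchTime m)

/-- A participant without a positive surplus is a possible move herself, so the program records
demands of the others only. -/
theorem findMoves_spec (h : AuctionMem w rk hold σ) :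
    Ends findMoves σ (findMovesTime n m) (Searched w rk hold) := by
  refine (computeSurplus_spec (n := n) (m := m) h.teams h.participants).frame.seq
    fun σ₁ ⟨hU, hag₁⟩ => ?_
  have h₁ := h.of_agreeOff hag₁ (by decide)
  rw [h.weight, h.tier, ← memPrice_congr (hag₁ 10 (by decide)),
    ← memStage_congr (hag₁ 11 (by decide))] at hU
  refine (computeEdges_spec h₁.teams h₁.participants h₁.holds h₁.inv.inj).frame.seq
    fun σ₂ ⟨hE, hag₂⟩ => ?_
  have h₂ := h₁.of_agreeOff hag₂ (by decide)
  have hP₂ : (memPrice σ₂ : Slot n m → ℕ) = memPrice σ₁ := memPrice_congr (hag₂ 10 (by decide))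
  have hS₂ : (memStage σ₂ : Fin m → ℕ) = memStage σ₁ := memStage_congr (hag₂ 11 (by decide))
  rw [h₁.weight, h₁.tier] at hE
  rw [← hag₂ 12 (by decide)] at hU hE
  rw [← hP₂, ← hS₂] at hU hE
  have hwants : ∀ (p : Fin m) s, (rk p s = memStage σ₂ p ∧ σ₂ 12 [(p : ℕ)] ≠ 0 ∧
      w p s = memPrice σ₂ s + σ₂ 12 [(p : ℕ)]) ↔
      σ₂ 12 [(p : ℕ)] ≠ 0 ∧ Demands w rk (memPrice σ₂) (memStage σ₂) p s := by
    intro p s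
    constructor
    · rintro ⟨a, b, c⟩
      exact ⟨b, (hU.demands_iff b).2 ⟨a, c⟩⟩
    · rintro ⟨b, c⟩
      obtain ⟨a, d⟩ := (hU.demands_iff b).1 c
      exact ⟨a, b, d⟩
  simp only [hwants] at hE
  refine (searchProgram_spec (m := m) h₂.participants (by decide) (by decide) (by decide)
    (A := fun p q : Fin m => σ₂ 13 [(p : ℕ), (q : ℕ)] ≠ 0)
    (seed := CanMove w rk hold (memPrice σ₂) (memStage σ₂)) ?_ ?_).frame.mono le_rfl ?_
  · intro σ' p q hag hp hq
    simp [hp, hq, hag 13 (by decide)]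
  · refine fun p => ⟨hE.le p, ?_⟩
    constructor
    · intro h1
      rcases hE.of_one p h1 with h2 | ⟨s, -, h2, h3, -⟩
      · exact Or.inl (hU.eq_zero_iff.1 h2)
      · exact Or.inr ⟨s, h3, h2.2⟩
    · rintro (h1 | ⟨s, h1, h2⟩)
      · exact hE.zero p (hU.eq_zero_iff.2 h1)
      · by_cases h0 : σ₂ 12 [(p : ℕ)] = 0
        · exact hE.zero p h0
        · exact hE.free p s (by simp) ⟨h0, h2⟩ h1
  · rintro σ₃ ⟨hC, hag₃⟩
    have e12 := hag₃ 12 (by decide)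
    have e13 := hag₃ 13 (by decide)
    have hP : (memPrice σ₃ : Slot n m → ℕ) = memPrice σ₂ := memPrice_congr (hag₃ 10 (by decide))
    have hS : (memStage σ₃ : Fin m → ℕ) = memStage σ₂ := memStage_congr (hag₃ 11 (by decide))
    refine ⟨?_, ?_, ?_, ?_, ?_⟩
    · rw [hP, hS, e12]; exact hU
    · intro p q
      rw [hP, hS, e12, e13]
      constructor
      · intro h1
        obtain ⟨s, -, h2, h3⟩ := hE.of_adj p q h1
        exact ⟨h2.1, s, h3, h2.2⟩
      · rintro ⟨h1, s, h2, h3⟩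
        exact (hE.adj p s q (by simp) ⟨h1, h3⟩ h2).1
    · intro p q s
      rw [hP, hS, e12, hag₃ 18 (by decide), hag₃ 19 (by decide)]
      intro h1 h2 h3
      exact (hE.adj p s q (by simp) ⟨h1, h2⟩ h3).2
    · rw [hP, hS, e13]; exact hC
    · intro p
      rw [hP, hS, e12, hag₃ 16 (by decide), hag₃ 17 (by decide)]
      intro h1 h2
      have h3 := (hC.seed_iff p).1 h1
      have h4 : σ₂ 14 [(p : ℕ)] = 1 := by
        rcases h3 with h3 | ⟨s, h3, h5⟩
        · exact hE.zero p (hU.eq_zero_iff.2 h3)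
        · exact hE.free p s (by simp) ⟨h2, h5⟩ h3
      obtain ⟨s, -, h5, h6, h7⟩ := (hE.of_one p h4).resolve_left h2
      exact ⟨s, h6, h5.2, h7⟩

/-- The index of the participant who holds the token. -/
def tokenExpr : Expr := .sub (rd0 30) (.const 1)

/-- The participant to whom the demand path leads from the holder of the token. -/
def nextExpr : Expr := rd1 15 tokenExpr

/-- The program that passes the slots along a demand path: everybody on it takes the slot of the
next one. -/
def walk : Program :=
  .while (.lt (.const 1) (rd1 14 tokenExpr))
    (.seq (set2 9 (rd1 18 nextExpr) (rd1 19 nextExpr) (rd0 30))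
      (set0 30 (.add nextExpr (.const 1))))

/-- Afterwards the token is with somebody `r'` at whom the auction can move on. Stamps decrease
along the path, so the slots on the rest of it are still held as they were before. -/
theorem walk_spec (h : AuctionMem w rk hold σ) (hS : Searched w rk hold σ)
    (hr : Carries E hold r) (ht : σ 30 [] = r + 1) (hg : σ 14 [(r : ℕ)] ≠ 0) :
    Ends walk σ ((m + 1) * 3 + 1) fun σ' => AgreeOff [9, 30] σ σ' ∧ ∃ hold' r',
      AuctionMem w rk hold' σ' ∧ Carries E hold' r' ∧ σ' 30 [] = r' + 1 ∧
      σ 14 [(r' : ℕ)] = 1 ∧ ∀ s, hold s = none → hold' s = none := by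
  have hw := Ends.while (e := .lt (.const 1) (rd1 14 tokenExpr)) (T := 2)
    (c := .seq (set2 9 (rd1 18 nextExpr) (rd1 19 nextExpr) (rd0 30))
      (set0 30 (.add nextExpr (.const 1))))
    (fun v σ' => AgreeOff [9, 30] σ σ' ∧ ∃ hold' r',
      AuctionMem w rk hold' σ' ∧ Carries E hold' r' ∧ σ' 30 [] = r' + 1 ∧
      σ 14 [(r' : ℕ)] = v ∧ v ≠ 0 ∧ (∀ s, hold s = none → hold' s = none) ∧
      ∀ z : Fin m, 1 < σ 14 [(z : ℕ)] → σ 14 [(z : ℕ)] ≤ v → ∃ (q : Fin m) (s : Slot n m),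
        σ 15 [(z : ℕ)] = q ∧ 0 < σ 14 [(q : ℕ)] ∧ σ 14 [(q : ℕ)] < σ 14 [(z : ℕ)] ∧
        hold' s = some q ∧ σ 18 [(q : ℕ)] = s.1 ∧ σ 19 [(q : ℕ)] = s.2 ∧
        Demands w rk (memPrice σ) (memStage σ) z s) ?_
  · refine (hw (σ 14 [(r : ℕ)]) σ ⟨AgreeOff.refl _ _, hold, r, h, hr, ht, rfl, hg, fun _ h => h,
      ?_⟩).mono ?_ ?_
    · intro z hz _
      obtain ⟨q, h1, h2, h3, h4⟩ := hS.closure.step z hz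
      obtain ⟨h5, s, h6, h7⟩ := (hS.adj_iff z q).1 h1
      obtain ⟨h8, h9⟩ := hS.slot z q s h5 h7 h6
      exact ⟨q, s, h2, h3, h4, h6, h8, h9, h7⟩
    · have := Nat.mul_le_mul_right 3 (hS.closure.le r)
      omega
    · rintro σ' ⟨⟨v, hag, hold', r', h1, h2, h3, h4, h5, h6, -⟩, he⟩
      refine ⟨hag, hold', r', h1, h2, h3, ?_, h6⟩
      have e : ¬ (1 < σ 14 [(r' : ℕ)]) := by
        intro c
        exact eval_lt_ne_zero.2 (by simpa [tokenExpr, Expr.eval, h3, hag 14 (by decide)] using c) he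
      omega
  · rintro v σ' ⟨hag, hold', r', h1, h2, h3, h4, h5, h6, h7⟩ he
    have hv : 1 < σ 14 [(r' : ℕ)] := by
      simpa [tokenExpr, Expr.eval, h3, hag 14 (by decide)] using eval_lt_ne_zero.1 he
    obtain ⟨q, s, a1, a2, a3, a4, a5, a6, a7⟩ := h7 r' hv h4.le
    have hnext : ∀ τ : Memory, τ 30 [] = r' + 1 → τ 15 = σ 15 → nextExpr.eval τ = q := by
      intro τ e1 e2
      simp [nextExpr, tokenExpr, Expr.eval, e1, e2, a1]
    have e15 := hag 15 (by decide)
    refine (Ends.assign2 (i := (s.1 : ℕ)) (j := (s.2 : ℕ)) (v := r' + 1)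
      (Q := fun τ => τ = σ'.write 9 [(s.1 : ℕ), (s.2 : ℕ)] (r' + 1)) ?_ ?_ ?_
      rfl).seq (T₂ := 1) fun τ hτ => ?_
    · simp [hnext σ' h3 e15, hag 18 (by decide), a5]
    · simp [hnext σ' h3 e15, hag 19 (by decide), a6]
    · simp [h3]
    have ne9 : ∀ z, z ≠ 9 → τ z = σ' z := fun z hz => by rw [hτ, Memory.write_of_ne hz]
    have hP : (memPrice σ' : Slot n m → ℕ) = memPrice σ := memPrice_congr (hag 10 (by decide))
    have hT : (memStage σ' : Fin m → ℕ) = memStage σ := memStage_congr (hag 11 (by decide))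
    refine Ends.assign0 (v := q + 1) ?_ ⟨σ 14 [(q : ℕ)], by omega, ?_,
      Function.update hold' s (some r'), q, ?_, h2.pass h1.inv.inj a4, ?_, rfl, by omega, ?_, ?_⟩
    · have := hnext τ (by rw [ne9 30 (by omega), h3]) (by rw [ne9 15 (by omega), e15])
      simp [Expr.eval, this]
    · refine (hag.trans ?_).trans (AgreeOff.write (by decide) _ _ _)
      rw [hτ]
      exact AgreeOff.write (by decide) _ _ _
    · have hne : ∀ z, z ≠ 9 → z ≠ 30 → τ.write 30 [] (q + 1) z = σ' z := fun z hz hz' => by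
        rw [Memory.write_of_ne hz', ne9 z hz]
      refine h1.of_eq (hne 0 (by omega) (by omega)) (hne 1 (by omega) (by omega))
        (hne 6 (by omega) (by omega)) (hne 8 (by omega) (by omega)) ?_ ?_
      · intro s'
        rw [Memory.write_of_ne (by omega), hτ]
        exact h1.holds.write s r' s'
      · rw [memPrice_congr (hne 10 (by omega) (by omega)),
          memStage_congr (hne 11 (by omega) (by omega))]
        exact h1.inv.take h2.unmatched (by rw [hP, hT]; exact a7)
    · simp [Memory.write]
    · intro s' hs'
      rw [Function.update_of_ne, h6 s' hs']
      rintro rfl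
      rw [h6 _ hs'] at a4
      cases a4
    · intro z hz hz'
      obtain ⟨q', s', b1, b2, b3, b4, b5⟩ := h7 z hz (by omega)
      refine ⟨q', s', b1, b2, b3, ?_, b5⟩
      rw [Function.update_of_ne, b4]
      rintro rfl
      rw [b4] at a4
      rw [Option.some.inj a4] at b3
      omega

/-- The program for the move at the holder of the token: she takes a free slot that she demands, and
the token is gone, or she moves on to the next tier. -/
def move : Program :=
  .ite (rd1 12 tokenExpr)
    (.seq (set2 9 (rd1 16 tokenExpr) (rd1 17 tokenExpr) (rd0 30)) (set0 30 (.const 0)))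
    (set1 11 tokenExpr (.add (rd1 11 tokenExpr) (.const 1)))

theorem move_spec (hS : Searched w rk hold σ) {σ' : Memory} (hag : AgreeOff [9, 30] σ σ')
    {hold' : Slot n m → Option (Fin m)} (h : AuctionMem w rk hold' σ')
    (hr : Carries E hold' r) (ht : σ' 30 [] = r + 1) (hg : σ 14 [(r : ℕ)] = 1)
    (hfree : ∀ s, hold s = none → hold' s = none) :
    Ends move σ' 3 fun σ'' =>
      (∃ hold'', AuctionMem w rk hold'' σ'' ∧ σ'' 30 [] = 0 ∧ memStage σ'' = memStage (m := m) σ ∧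
        ∀ p, p ∈ E ↔ ∃ s, hold'' s = some p) ∨
      (AuctionMem w rk hold' σ'' ∧ σ'' 30 [] = r + 1 ∧
        memStage σ'' = Function.update (memStage σ) r (memStage σ r + 1)) := by
  have e12 := hag 12 (by decide)
  have hP : (memPrice σ' : Slot n m → ℕ) = memPrice σ := memPrice_congr (hag 10 (by decide))
  have hT : (memStage σ' : Fin m → ℕ) = memStage σ := memStage_congr (hag 11 (by decide))
  have htok : ∀ τ : Memory, τ 30 [] = r + 1 → tokenExpr.eval τ = r := by
    intro τ e
    simp [tokenExpr, Expr.eval, e]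
  have htok' := htok σ' ht
  refine Ends.cond (T := 2) (σ 12 [(r : ℕ)] ≠ 0) (by simp [htok', e12]) (fun h0 => ?_)
    (fun h0 => ?_)
  · obtain ⟨s, h1, h2, h3, h4⟩ := hS.free r hg h0
    refine (Ends.assign2 (i := (s.1 : ℕ)) (j := (s.2 : ℕ)) (v := r + 1)
      (Q := fun τ => τ = σ'.write 9 [(s.1 : ℕ), (s.2 : ℕ)] (r + 1)) ?_ ?_ ?_
      rfl).seq (T₂ := 1) fun τ hτ => ?_
    · simp [htok', hag 16 (by decide), h3]
    · simp [htok', hag 17 (by decide), h4]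
    · simp [ht]
    have hne : ∀ z, z ≠ 9 → z ≠ 30 → τ.write 30 [] 0 z = σ' z := fun z hz hz' => by
      rw [Memory.write_of_ne hz', hτ, Memory.write_of_ne hz]
    refine Ends.assign0 (v := 0) rfl (Or.inl ⟨Function.update hold' s (some r), ?_, ?_, ?_,
      hr.settle (hfree s h1)⟩)
    · refine h.of_eq (hne 0 (by omega) (by omega)) (hne 1 (by omega) (by omega))
        (hne 6 (by omega) (by omega)) (hne 8 (by omega) (by omega)) ?_ ?_
      · intro s'
        rw [Memory.write_of_ne (by omega), hτ]
        exact h.holds.write s r s'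
      · rw [memPrice_congr (hne 10 (by omega) (by omega)),
          memStage_congr (hne 11 (by omega) (by omega))]
        exact h.inv.take hr.unmatched (by rw [hP, hT]; exact h2)
    · simp [Memory.write]
    · rw [memStage_congr (hne 11 (by omega) (by omega)), hT]
  · refine Ends.mono (T₁ := 1) ?_ (by omega) (fun _ h => h)
    have hst : (memStage (σ'.write 11 [(r : ℕ)] (memStage σ r + 1)) : Fin m → ℕ) =
        Function.update (memStage σ) r (memStage σ r + 1) := by
      funext p
      rw [memStage, write_cell₁, Function.update_apply, ← hT, memStage]
      simp only [memStage]
    refine Ends.assign1 (i := r) (v := memStage σ r + 1) htok' ?_ (Or.inr ⟨?_, ?_, hst⟩)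
    · simp [Expr.eval, htok', memStage, hag 11 (by decide)]
    · refine h.of_eq (Memory.write_of_ne (by omega) _ _ _) (Memory.write_of_ne (by omega) _ _ _)
        (Memory.write_of_ne (by omega) _ _ _) (Memory.write_of_ne (by omega) _ _ _) ?_ ?_
      · intro s'
        rw [Memory.write_of_ne (by omega)]
        exact h.holds s'
      · rw [hst, memPrice_congr (Memory.write_of_ne (by omega) _ _ _), ← hT]
        refine h.inv.reject hr.unmatched fun s hs => ?_
        rw [hP]
        refine hS.surplus.eq_zero_iff.1 (not_not.1 h0) s ?_
        rw [← hT]; exact hs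
    · rw [Memory.write_of_ne (by omega), ht]

end Step

/-! ### Rises of the prices and the loop of the auction -/

section Rise

variable {n m : ℕ} {w rk : Fin m → Slot n m → ℕ} {hold : Slot n m → Option (Fin m)} {σ : Memory}
  {E : Set (Fin m)} {r : Fin m} {R : Set (Fin m)} {F N : Fin m → ℕ}

/-- If no demand path leads from `r` to a possible move, then none starts at the participants
reached from `r`. -/
theorem Searched.stamp_eq_zero (hS : Searched w rk hold σ) (h0 : σ 14 [(r : ℕ)] = 0)
    (hR : ReachedFrom w rk hold (memPrice σ) (memStage σ) r R) :
    ∀ q ∈ R, σ 14 [(q : ℕ)] = 0 ∧ σ 12 [(q : ℕ)] ≠ 0 := by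
  have hU : ∀ q : Fin m, σ 14 [(q : ℕ)] = 0 → σ 12 [(q : ℕ)] ≠ 0 := by
    intro q hq hu
    have := (hS.closure.seed_iff q).2 (Or.inl (hS.surplus.eq_zero_iff.1 hu))
    omega
  suffices ∀ q ∈ R, σ 14 [(q : ℕ)] = 0 from fun q hq => ⟨this q hq, hU q (this q hq)⟩
  by_contra hcon
  push Not at hcon
  obtain ⟨q, hq, hq0⟩ := hcon
  obtain ⟨q', h1, h2, p, hp, s, hs, hd⟩ := hR.2 {q ∈ R | σ 14 [(q : ℕ)] ≠ 0} (fun _ h => h.1)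
    ⟨q, hq, hq0⟩ fun h => h.2 h0
  have h3 : σ 14 [(q' : ℕ)] = 0 := by
    by_contra c
    exact h2 ⟨h1, c⟩
  exact hS.closure.closed q' p ((hS.adj_iff q' p).2 ⟨hU q' h3, s, hs, hd⟩) hp.2 h3

/-- The participants found from `r` along the demand edges are reached from `r`. -/
theorem Searched.reachedFrom (hS : Searched w rk hold σ)
    (hF : IsClosure (fun p q : Fin m => σ 13 [(q : ℕ), (p : ℕ)] ≠ 0) (· = r) F N) :
    ReachedFrom w rk hold (memPrice σ) (memStage σ) r {p | F p ≠ 0} := by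
  have hr : F r = 1 := (hF.seed_iff r).2 rfl
  refine ⟨by simp [hr], fun Q hQ hne hrQ => ?_⟩
  -- The member of `Q` that was found first was found from outside `Q`.
  obtain ⟨p, hp, hmin⟩ := (Set.toFinite Q).exists_minimalFor F Q hne
  have h0 : F p ≠ 0 := hQ hp
  have h1 : F p ≠ 1 := fun e => hrQ ((hF.seed_iff p).1 e ▸ hp)
  obtain ⟨q, h2, -, h3, h4⟩ := hF.step p (by omega)
  obtain ⟨-, s, h5, h6⟩ := (hS.adj_iff q p).1 h2
  refine ⟨q, by simp only [Set.mem_ofPred_eq]; omega, fun hq => ?_, p, hp, s, h5, h6⟩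
  have := hmin hq h4.le
  omega

/-- Everybody reached from `r` is found. -/
theorem Searched.subset_closure (hS : Searched w rk hold σ) (h0 : σ 14 [(r : ℕ)] = 0)
    (hF : IsClosure (fun p q : Fin m => σ 13 [(q : ℕ), (p : ℕ)] ≠ 0) (· = r) F N)
    (hR : ReachedFrom w rk hold (memPrice σ) (memStage σ) r R) : R ⊆ {p | F p ≠ 0} := by
  by_contra hcon
  obtain ⟨p, hp, hp'⟩ := Set.not_subset.1 hcon
  have hr : F r = 1 := (hF.seed_iff r).2 rfl
  obtain ⟨q, hq, hq', p', hp', s, hs, hd⟩ := hR.2 (R \ {p | F p ≠ 0}) Set.sdiff_subset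
    ⟨p, hp, hp'⟩ fun h => h.2 (by simp [hr])
  have hqF : F q ≠ 0 := by
    by_contra c
    exact hq' ⟨hq, by simpa using c⟩
  exact hp'.2 (hF.closed p' q
    ((hS.adj_iff q p').2 ⟨(hS.stamp_eq_zero h0 hR q hq).2, s, hs, hd⟩) hqF)

/-- The program that finds everybody reached from the holder of the token along the demand
edges. -/
def findReached : Program :=
  .seq (forTo 40 (rd0 1) (set1 20 (rd0 40) (.eq (rd0 40) tokenExpr)))
    (searchProgram 20 21 (rd2 13 (rd0 41) (rd0 40)))

theorem findReached_spec (hm : σ 1 [] = m) (ht : σ 30 [] = r + 1) :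
    Ends findReached σ (2 + m * 3 + searchTime m) fun σ' =>
      IsClosure (fun p q : Fin m => σ 13 [(q : ℕ), (p : ℕ)] ≠ 0) (· = r)
        (fun p => σ' 20 [(p : ℕ)]) (fun p => σ' 21 [(p : ℕ)]) := by
  have h1 : Ends (forTo 40 (rd0 1) (set1 20 (rd0 40) (.eq (rd0 40) tokenExpr))) σ
      (2 + m * 3) fun σ' => ∀ p : Fin m, σ' 20 [(p : ℕ)] = if p = r then 1 else 0 := by
    refine (Ends.for1 (N := m) (T := 1) (fun D σ' => ∀ p ∈ D,
      σ' 20 [(p : ℕ)] = if p = r then 1 else 0) (by decide)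
      (fun σ' h => ?_) (fun D σ' x h => ?_) (by simp)
      fun p D _ σ' hag hp h => ?_).mono le_rfl fun σ' h p => h p (by simp)
    · simp [h 1 (by decide), hm]
    · rw [Memory.write_of_ne (by omega)]; exact h
    · refine Ends.assign1 (i := p) (v := if p = r then 1 else 0) (by simp [hp]) ?_ fun q hq => ?_
      · simp [tokenExpr, Expr.eval, hp, hag 30 (by decide), ht, Fin.ext_iff]
      · rw [write_cell₁]
        by_cases e : q = p
        · rw [if_pos e, e]
        · rw [if_neg e]
          exact h q ((Finset.mem_insert.1 hq).resolve_left e)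
  refine h1.frame.seq fun σ₁ ⟨hs, hag₁⟩ => ?_
  refine searchProgram_spec (by rw [hag₁ 1 (by decide), hm]) (by decide) (by decide) (by decide)
    (fun σ' p q hag hp hq => ?_) fun p => ?_
  · simp [hp, hq, hag 13 (by decide), hag₁ 13 (by decide)]
  · rw [hs]
    split_ifs with e <;> simp [e]

/-- The program that lowers the number in cell `33` to the value of `e` if that is smaller. -/
def lowerTo (e : Expr) : Program := when (.lt e (rd0 33)) (set0 33 e)

theorem lowerTo_spec (σ : Memory) (e : Expr) :
    Ends (lowerTo e) σ 2 fun σ' => σ' 33 [] = min (σ 33 []) (e.eval σ) := by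
  refine Ends.guard (T := 1) (e.eval σ < σ 33 []) (by simp [eval_lt_ne_zero]) (fun h => ?_)
    (fun h => (min_eq_left (not_lt.1 h)).symm) le_rfl
  exact Ends.assign0 rfl (by simp [Memory.write, h.le])

/-- Tests whether the slot at the loop variables is held by nobody in the set marked in `20`. -/
def outsideExpr : Expr :=
  .add (.eq holderExpr (.const 0)) (.eq (rd1 20 (.sub holderExpr (.const 1))) (.const 0))

theorem outsideExpr_eval {τ : Memory} {s : Slot n m} (hh : MemHolds τ hold)
    (ha : τ 41 [] = s.1) (hk : τ 42 [] = s.2) :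
    outsideExpr.eval τ ≠ 0 ↔ ¬ ∃ q ∈ {p : Fin m | τ 20 [(p : ℕ)] ≠ 0}, hold s = some q := by
  have e : holderExpr.eval τ = code (hold s) := by simp [holderExpr, ha, hk, hh s]
  rcases h : hold s with _ | q
  · simp [outsideExpr, Expr.eval, e, h, code]
  · simp [outsideExpr, Expr.eval, e, h, code]

/-- The program that computes the rise of the prices. -/
def computeRise : Program :=
  .seq (set0 33 (rd1 12 tokenExpr))
    (forPairs (when (rd1 20 (rd0 40)) (.seq (lowerTo (rd1 12 (rd0 40)))
      (when inTierExpr (when outsideExpr (lowerTo (.sub (rd1 12 (rd0 40)) surplusExpr)))))))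

theorem computeRise_spec (h : AuctionMem w rk hold σ) (ht : σ 30 [] = r + 1)
    (hr : σ 20 [(r : ℕ)] ≠ 0) :
    Ends computeRise σ (1 + (2 + m * (2 + (n + 1) * (2 + m * 9 + 2) + 2))) fun σ' =>
      IsRise w rk hold (memPrice σ) (memStage σ) (fun p => σ 12 [(p : ℕ)])
        {p : Fin m | σ 20 [(p : ℕ)] ≠ 0} (σ' 33 []) := by
  set R : Set (Fin m) := {p : Fin m | σ 20 [(p : ℕ)] ≠ 0} with hR
  set π : Slot n m → ℕ := memPrice σ with hπ
  set t : Fin m → ℕ := memStage σ with hst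
  set U : Fin m → ℕ := fun p => σ 12 [(p : ℕ)] with hU
  set att : ℕ → Prop := fun d => (∃ p ∈ R, d = U p) ∨ ∃ p ∈ R, ∃ s, rk p s = t p ∧
    (¬ ∃ q ∈ R, hold s = some q) ∧ d = U p - (w p s - π s) with hatt
  set bd : ℕ → Fin m → Slot n m → Prop := fun d p s => p ∈ R → d ≤ U p ∧
    (rk p s = t p → (¬ ∃ q ∈ R, hold s = some q) → d ≤ U p - (w p s - π s)) with hbd
  have hbd_mono : ∀ d d' p s, d' ≤ d → bd d p s → bd d' p s := fun d d' p s hd hb hp =>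
    ⟨hd.trans (hb hp).1, fun h1 h2 => hd.trans ((hb hp).2 h1 h2)⟩
  refine (Ends.assign0 (v := U r) (Q := fun σ₁ => AgreeOff [33] σ σ₁ ∧ σ₁ 33 [] = U r)
    (by simp [tokenExpr, Expr.eval, ht, hU]) ⟨AgreeOff.write (by decide) _ _ _,
      by simp [Memory.write]⟩).seq fun σ₁ ⟨hag₁, hd₁⟩ => ?_
  refine (forPairs_spec (n := n) (m := m) (T := 7) (by rw [hag₁ 0 (by decide), h.teams])
    (by rw [hag₁ 1 (by decide), h.participants])
    (fun D σ' => (∀ p s, (p, s) ∈ D → bd (σ' 33 []) p s) ∧ att (σ' 33 [])) (by decide) ?_ ?_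
    ?_).mono le_rfl fun σ' h' => ?_
  · intro D σ' v x hv h'
    rw [Memory.write_of_ne (by omega)]; exact h'
  · exact ⟨by simp, Or.inl ⟨r, hr, hd₁⟩⟩
  · intro p s D _ σ' hag' hp ha hk hI
    have hag : AgreeOff [33, 40, 41, 42] σ σ' := (hag₁.mono (by decide)).trans
      (hag'.mono (by decide))
    have key : ∀ d, d ≤ σ' 33 [] → bd d p s → att d →
        (∀ p' s', (p', s') ∈ insert (p, s) D → bd d p' s') ∧ att d := by
      refine fun d hd hb hat => ⟨fun p' s' hm' => ?_, hat⟩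
      rcases Finset.mem_insert.1 hm' with e | e
      · obtain ⟨rfl, rfl⟩ := Prod.mk.inj e
        exact hb
      · exact hbd_mono _ _ _ _ hd (hI.1 p' s' e)
    refine Ends.guard (T := 6) (p ∈ R) (by simp [hp, hag 20 (by decide), hR]) (fun hpR => ?_)
      (fun hpR => key _ le_rfl (fun c => absurd c hpR) hI.2) (by omega)
    refine (lowerTo_spec σ' _).frame.seq (T₂ := 4) fun σ₂ ⟨hd₂, hag₂'⟩ => ?_
    have hag₂ : AgreeOff [33, 40, 41, 42] σ σ₂ := hag.trans (hag₂'.mono (by decide))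
    have e40 : σ₂ 40 [] = p := by rw [hag₂' 40 (by decide), hp]
    have e41 : σ₂ 41 [] = s.1 := by rw [hag₂' 41 (by decide), ha]
    have e42 : σ₂ 42 [] = s.2 := by rw [hag₂' 42 (by decide), hk]
    have hUp : (rd1 12 (rd0 40)).eval σ₂ = U p := by
      simp [e40, hag₂ 12 (by decide), hU]
    have hUp' : (rd1 12 (rd0 40)).eval σ' = U p := by
      simp [hp, hag 12 (by decide), hU]
    rw [hUp'] at hd₂
    have hat₂ : att (σ₂ 33 []) := by
      rcases min_choice (σ' 33 []) (U p) with c | c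
      · rw [hd₂, c]; exact hI.2
      · rw [hd₂, c]; exact Or.inl ⟨p, hpR, rfl⟩
    have hle₂ : σ₂ 33 [] ≤ σ' 33 [] := by rw [hd₂]; exact min_le_left _ _
    have hleU : σ₂ 33 [] ≤ U p := by rw [hd₂]; exact min_le_right _ _
    refine Ends.guard (T := 3) (rk p s = t p) ?_ (fun c1 => ?_)
      (fun c1 => key _ hle₂ (fun _ => ⟨hleU, fun c => absurd c c1⟩) hat₂) (by omega)
    · rw [← h.tier]
      simp [inTierExpr, eval_eq_ne_zero, e40, e41, hag₂ 6 (by decide), hag₂ 11 (by decide),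
        memTier, hst, memStage]
    have hh₂ : MemHolds σ₂ hold := fun s' => by rw [hag₂ 9 (by decide)]; exact h.holds s'
    refine Ends.guard (T := 2) (¬ ∃ q ∈ R, hold s = some q)
      (by rw [outsideExpr_eval hh₂ e41 e42, hag₂ 20 (by decide)]) (fun c2 => ?_)
      (fun c2 => key _ hle₂ (fun _ => ⟨hleU, fun _ c => absurd c c2⟩) hat₂) (by omega)
    refine (lowerTo_spec σ₂ _).mono le_rfl fun σ₃ hd₃ => ?_
    have hval : (Expr.sub (rd1 12 (rd0 40)) surplusExpr).eval σ₂ = U p - (w p s - π s) := by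
      rw [← h.weight]
      simp [surplusExpr, Expr.eval, e40, e41, e42, hag₂ 12 (by decide), hag₂ 8 (by decide),
        hag₂ 10 (by decide), hU, memWeight, hπ, memPrice]
    rw [hval] at hd₃
    refine key _ ?_ (fun _ => ⟨?_, fun _ _ => ?_⟩) ?_
    · exact (by rw [hd₃]; exact min_le_left _ _ : σ₃ 33 [] ≤ σ₂ 33 []).trans hle₂
    · exact (by rw [hd₃]; exact min_le_left _ _ : σ₃ 33 [] ≤ σ₂ 33 []).trans hleU
    · rw [hd₃]; exact min_le_right _ _
    · rcases min_choice (σ₂ 33 []) (U p - (w p s - π s)) with c | c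
      · rw [hd₃, c]; exact hat₂
      · rw [hd₃, c]; exact Or.inr ⟨p, hpR, s, c1, c2, rfl⟩
  · refine ⟨fun p hp => (h'.1 p (0, p) (by simp) hp).1,
      fun p hp s h1 h2 => (h'.1 p s (by simp) hp).2 h1 h2, h'.2⟩

/-- The program that raises the prices of the slots held in the set marked in `20`. -/
def raisePrices : Program :=
  forTo 41 (.add (rd0 0) (.const 1)) (forTo 42 (rd0 1) (when holderExpr
    (when (rd1 20 (.sub holderExpr (.const 1)))
      (set2 10 (rd0 41) (rd0 42) (.add (rd2 10 (rd0 41) (rd0 42)) (rd0 33))))))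

theorem raisePrices_spec (h : AuctionMem w rk hold σ) :
    Ends raisePrices σ (2 + (n + 1) * (2 + m * 5 + 2)) fun σ' =>
      memPrice σ' = raise hold {p : Fin m | σ 20 [(p : ℕ)] ≠ 0} (σ 33 []) (memPrice σ) := by
  classical
  refine (Ends.for2 (N₁ := n + 1) (N₂ := m) (T := 3) (fun D σ' => ∀ s : Slot n m,
    memPrice σ' s = if s ∈ D then
      raise hold {p : Fin m | σ 20 [(p : ℕ)] ≠ 0} (σ 33 []) (memPrice σ) s else memPrice σ s)
    (by decide) (fun σ' hag => ?_) (fun D σ' v x hv hI => ?_) (by simp)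
    fun a k D hD σ' hag ha hk hI => ?_).mono le_rfl fun σ' h' => ?_
  · simp [Expr.eval, hag 0 (by decide), hag 1 (by decide), h.teams, h.participants]
  · intro s
    rw [← hI s, memPrice_congr (Memory.write_of_ne (by omega) _ _ _)]
  · have hhold : holderExpr.eval σ' = code (hold (a, k)) := by
      have := h.holds (a, k)
      simp only at this
      simp [holderExpr, ha, hk, hag 9 (by decide), this]
    have hskip : (¬ ∃ q ∈ {p : Fin m | σ 20 [(p : ℕ)] ≠ 0}, hold (a, k) = some q) →
        ∀ s : Slot n m, memPrice σ' s = if s ∈ insert (a, k) D then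
          raise hold {p : Fin m | σ 20 [(p : ℕ)] ≠ 0} (σ 33 []) (memPrice σ) s
          else memPrice σ s := by
      intro hn s
      rw [hI s]
      by_cases e : s = (a, k)
      · rw [e, if_neg hD, if_pos (Finset.mem_insert_self _ _), raise, if_neg hn]
      · simp [e]
    refine Ends.guard (T := 2) (∃ q, hold (a, k) = some q) (by rw [hhold, code_ne_zero])
      (fun c => ?_) (fun c => hskip fun ⟨q, _, hq⟩ => c ⟨q, hq⟩) (by omega)
    obtain ⟨q, hq⟩ := c
    refine Ends.guard (T := 1) (σ 20 [(q : ℕ)] ≠ 0)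
      (by simp [Expr.eval, hhold, hq, code_some, hag 20 (by decide)]) (fun c => ?_)
      (fun c => hskip fun ⟨q', hq', e⟩ => c (by
        rw [hq] at e
        rw [Option.some.inj e]
        exact hq')) le_rfl
    refine Ends.assign2 (i := a) (j := k) (v := memPrice σ (a, k) + σ 33 []) (by simp [ha])
      (by simp [hk]) ?_ fun s => ?_
    · have := hI (a, k)
      rw [if_neg hD] at this
      simp only [memPrice] at this
      simp [Expr.eval, ha, hk, this, memPrice, hag 33 (by decide)]
    · by_cases e : s = (a, k)
      · rw [e, if_pos (Finset.mem_insert_self _ _), raise, if_pos ⟨q, c, hq⟩]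
        simp [memPrice, Memory.write]
      · have e' : ¬ ((s.1 : ℕ) = a ∧ (s.2 : ℕ) = k) := fun c =>
          e (Prod.ext (Fin.ext c.1) (Fin.ext c.2))
        have := hI s
        simp only [memPrice] at this
        simp [memPrice, Memory.write, e, e', this]
  · funext s
    rw [h' s, if_pos (Finset.mem_univ _)]

/-- A participant without a slot has not got beyond the tier of her private slot. -/
theorem AuctionInv.stage_le {π : Slot n m → ℕ} {t : Fin m → ℕ} (h : AuctionInv w rk hold π t)
    (hr : ∀ s, hold s ≠ some r) (hw : ∀ p q, 0 < w q (0, p) ↔ q = p) : t r ≤ rk r (0, r) := by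
  by_contra hlt
  have h1 := h.rej r (0, r) (not_le.1 hlt)
  have h2 := (hw r r).2 rfl
  rcases e : hold (0, r) with _ | q
  · have := h.free _ e
    omega
  · have := (hw r q).1 (h.demands _ _ e).2.1
    exact hr _ (this ▸ e)

/-- The auction is going on for the participants in `E`. If the token is not placed, then `v` bounds
a quantity that each step lowers: it counts the tiers that the participants have left, and then the
participants that rises of the prices can still connect to the holder `r` of the token. The set `R`
witnesses that `j` of them are connected already, or that the auction can move on without a rise. -/
def AuctionState (w rk : Fin m → Slot n m → ℕ) (E : Set (Fin m)) (v : ℕ) (σ : Memory) : Prop :=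
  ∃ hold, AuctionMem w rk hold σ ∧ ((σ 30 [] = 0 ∧ ∀ p, p ∈ E ↔ ∃ s, hold s = some p) ∨
    ∃ (r : Fin m) (R : Set (Fin m)) (j : ℕ), σ 30 [] = r + 1 ∧ Carries E hold r ∧
      ReachedFrom w rk hold (memPrice σ) (memStage σ) r R ∧
      ((∃ q ∈ R, CanMove w rk hold (memPrice σ) (memStage σ) q) ∨ j ≤ R.ncard) ∧
      (∑ p : Fin m, (n + 1 - memStage σ p)) * (m + 3) + (m + 1 - j) + 1 ≤ v)

theorem ReachedFrom.singleton {P S : Type} {w rk : P → S → ℕ} {hold : S → Option P} {π : S → ℕ}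
    {t : P → ℕ} {r : P} : ReachedFrom w rk hold π t r {r} := by
  refine ⟨rfl, fun Q hQ ⟨q, hq⟩ hr => absurd hq ?_⟩
  rw [Set.mem_singleton_iff.1 (hQ hq)]
  exact hr

/-- One step of the auction. -/
def auctionStep : Program :=
  .seq findMoves (.ite (rd1 14 tokenExpr) (.seq walk move)
    (.seq findReached (.seq computeRise raisePrices)))

/-- The number of steps of the machine that a step of the auction takes at most. -/
def auctionStepTime (n m : ℕ) : ℕ :=
  findMovesTime n m + ((m + 1) * 3 + 4 + (2 + m * 3 + searchTime m +
    (1 + (2 + m * (2 + (n + 1) * (2 + m * 9 + 2) + 2)) + (2 + (n + 1) * (2 + m * 5 + 2)))) + 1)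

theorem auctionStep_spec (hw : ∀ p q, 0 < w q (0, p) ↔ q = p) (hrk : ∀ p s, rk p s ≤ n) {v : ℕ}
    (h : AuctionState w rk E v σ) (h0 : σ 30 [] ≠ 0) :
    Ends auctionStep σ (auctionStepTime n m) fun σ' => ∃ v' < v, AuctionState w rk E v' σ' := by
  obtain ⟨hold, hM, h | ⟨r, R, j, ht, hC, hR, hj, hv⟩⟩ := h
  · exact absurd h.1 h0
  refine (findMoves_spec hM).frame.seq fun σ₁ ⟨hS, hag₁⟩ => ?_
  have hM₁ := hM.of_agreeOff hag₁ (by decide)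
  have ht₁ : σ₁ 30 [] = r + 1 := by rw [hag₁ 30 (by decide), ht]
  rw [← memPrice_congr (hag₁ 10 (by decide)), ← memStage_congr (hag₁ 11 (by decide))] at hR hj
  rw [← memStage_congr (hag₁ 11 (by decide))] at hv
  refine Ends.cond (σ₁ 14 [(r : ℕ)] ≠ 0) (by simp [tokenExpr, Expr.eval, ht₁]) (fun hg => ?_)
    (fun hg => ?_)
  · refine ((walk_spec hM₁ hS hC ht₁ hg).seq
      (fun σ₂ ⟨hag, hold', r', h1, h2, h3, h4, h5⟩ =>
        (move_spec hS hag h1 h2 h3 h4 h5).mono (R := fun σ' => ∃ v' < v, AuctionState w rk E v' σ')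
          le_rfl ?_)).mono ?_ fun _ h => h
    · rintro σ₃ (⟨hold'', b1, b2, b3, b4⟩ | ⟨b1, b2, b3⟩)
      · exact ⟨0, by omega, hold'', b1, Or.inl ⟨b2, b4⟩⟩
      -- A tier is used up, which pays for forgetting the participants connected so far.
      · have hlt : memStage σ₁ r' < n + 1 := by
          have := h1.inv.stage_le h2.unmatched hw
          rw [memStage_congr (hag 11 (by decide))] at this
          have := hrk r' (0, r')
          omega
        have hsum : ∑ p : Fin m, (n + 1 - memStage σ₃ p) + 1 =
            ∑ p : Fin m, (n + 1 - memStage σ₁ p) := by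
          rw [b3, ← Finset.add_sum_erase _ _ (Finset.mem_univ r'),
            ← Finset.add_sum_erase _ _ (Finset.mem_univ r'), Function.update_self]
          have : ∑ p ∈ Finset.univ.erase r', (n + 1 - Function.update (memStage σ₁) r'
              (memStage σ₁ r' + 1) p) = ∑ p ∈ Finset.univ.erase r', (n + 1 - memStage σ₁ p) := by
            refine Finset.sum_congr rfl fun p hp => ?_
            rw [Function.update_of_ne (Finset.ne_of_mem_erase hp)]
          rw [this]
          omega
        refine ⟨(∑ p : Fin m, (n + 1 - memStage σ₃ p)) * (m + 3) + (m + 1 - 0) + 1, ?_, hold', b1,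
          Or.inr ⟨r', {r'}, 0, b2, h2, ReachedFrom.singleton, Or.inr (Nat.zero_le _), le_rfl⟩⟩
        rw [← hsum, add_mul] at hv
        omega
    · omega
  · have hg : σ₁ 14 [(r : ℕ)] = 0 := not_not.1 hg
    refine (((findReached_spec hM₁.participants ht₁).frame).seq (T₂ := 1 + (2 + m * (2 + (n + 1) *
      (2 + m * 9 + 2) + 2)) + (2 + (n + 1) * (2 + m * 5 + 2))) fun σ₂ ⟨hF, hag₂⟩ => ?_).mono
      (by omega) fun _ h => h
    have hM₂ := hM₁.of_agreeOff hag₂ (by decide)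
    have ht₂ : σ₂ 30 [] = r + 1 := by rw [hag₂ 30 (by decide), ht₁]
    have hRF := hS.reachedFrom hF
    have hsub := hS.subset_closure hg hF hR
    refine (computeRise_spec hM₂ ht₂ hRF.1).frame.seq fun σ₃ ⟨hδ, hag₃⟩ => ?_
    have hM₃ := hM₂.of_agreeOff hag₃ (by decide)
    refine (raisePrices_spec hM₃).frame.mono le_rfl ?_
    rintro σ₄ ⟨hp, hag₄⟩
    rw [hag₃ 20 (by decide), memPrice_congr (hag₃ 10 (by decide)),
      memPrice_congr (hag₂ 10 (by decide))] at hp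
    rw [memPrice_congr (hag₂ 10 (by decide)), memStage_congr (hag₂ 11 (by decide)),
      hag₂ 12 (by decide)] at hδ
    have hst : (memStage σ₄ : Fin m → ℕ) = memStage σ₁ := by
      rw [memStage_congr (hag₄ 11 (by decide)), memStage_congr (hag₃ 11 (by decide)),
        memStage_congr (hag₂ 11 (by decide))]
    set Fs : Set (Fin m) := {p : Fin m | σ₂ 20 [(p : ℕ)] ≠ 0} with hFs
    have hzero := hS.stamp_eq_zero hg hRF
    have hbound := hδ.bound hS.surplus fun p hp => (hzero p hp).2
    have hM₄ : AuctionMem w rk hold σ₄ := by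
      refine hM₃.of_eq (hag₄ 0 (by decide)) (hag₄ 1 (by decide)) (hag₄ 6 (by decide))
        (hag₄ 8 (by decide)) ?_ ?_
      · intro s
        rw [hag₄ 9 (by decide)]
        exact hM₃.holds s
      · rw [hp, hst]
        exact hM₁.inv.raise hC.unmatched hRF hbound
    have ht₄ : σ₄ 30 [] = r + 1 := by
      rw [hag₄ 30 (by decide), hag₃ 30 (by decide), ht₂]
    have hjR : j ≤ R.ncard := by
      refine hj.resolve_left ?_
      rintro ⟨q, hq, hmv⟩
      have h1 := (hS.closure.seed_iff q).2 hmv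
      have h2 := (hS.stamp_eq_zero hg hR q hq).1
      omega
    have hjF : j ≤ Fs.ncard := hjR.trans (Set.ncard_le_ncard hsub)
    have hFm : Fs.ncard ≤ m := by
      have := Set.ncard_le_card Fs
      rwa [Nat.card_eq_fintype_card, Fintype.card_fin] at this
    have hRF' := hRF.raise hbound
    rw [← hp, ← hst] at hRF'
    have hprog := hδ.progress hS.surplus fun p hp => (hzero p hp).2
    rw [← hp, ← hst] at hprog
    rw [← hst] at hv
    -- If a move has become possible then no further rise is needed, so `j` may be set to its
    -- largest value; otherwise one more participant has been connected.
    rcases hprog with hmv | ⟨q, hq, p, hpF, s, hs, hd⟩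
    · exact ⟨(∑ p : Fin m, (n + 1 - memStage σ₄ p)) * (m + 3) + (m + 1 - (m + 1)) + 1, by omega,
        hold, hM₄, Or.inr ⟨r, Fs, m + 1, ht₄, hC, hRF', Or.inl hmv, le_rfl⟩⟩
    · refine ⟨(∑ p : Fin m, (n + 1 - memStage σ₄ p)) * (m + 3) + (m + 1 - (j + 1)) + 1, by omega,
        hold, hM₄, Or.inr ⟨r, insert p Fs, j + 1, ht₄, hC, hRF'.insert hq hs hd, Or.inr ?_,
          le_rfl⟩⟩
      rw [Set.ncard_insert_of_notMem hpF]
      omega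

/-- The auction: one participant after the other enters and gets the token. -/
def auction : Program :=
  forTo 43 (rd0 1) (.seq (set0 30 (.add (rd0 43) (.const 1))) (.while (rd0 30) auctionStep))

/-- The number of steps of the machine that the auction takes at most. -/
def auctionTime (n m : ℕ) : ℕ :=
  2 + m * (1 + ((m * (n + 1) * (m + 3) + (m + 1) + 1) * (auctionStepTime n m + 1) + 1) + 2)

theorem auction_spec (hw : ∀ p q, 0 < w q (0, p) ↔ q = p) (hrk : ∀ p s, rk p s ≤ n)
    (h : AuctionMem w rk (fun _ => none) σ) :
    Ends auction σ (auctionTime n m) fun σ' => ∃ hold, AuctionMem w rk hold σ' ∧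
      ∀ p, ∃ s, hold s = some p := by
  have hI43 : ∀ {hold : Slot n m → Option (Fin m)} {τ : Memory} (x : ℕ),
      AuctionMem w rk hold τ → AuctionMem w rk hold (τ.write 43 [] x) := fun x h =>
    h.of_agreeOff (AgreeOff.write (W := [43]) (by decide) _ _ _) (by decide)
  refine (Ends.loop (N := m) (T := 1 + ((m * (n + 1) * (m + 3) + (m + 1) + 1) *
    (auctionStepTime n m + 1) + 1)) (fun i σ' => ∃ hold, AuctionMem w rk hold σ' ∧
      ∀ p : Fin m, (p : ℕ) < i ↔ ∃ s, hold s = some p) (by decide) (fun σ' hag => ?_)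
    ⟨_, hI43 _ h, by simp⟩ fun i hi σ' _ hvi ⟨hold, hM, hE⟩ => ?_).mono le_rfl ?_
  · simp [hag 1 (by decide), h.participants]
  · refine (Ends.assign0 (v := i + 1) (Q := fun τ => τ = σ'.write 30 [] (i + 1))
      (by simp [Expr.eval, hvi]) rfl).seq fun τ hτ => ?_
    have hM' : AuctionMem w rk hold τ := by
      rw [hτ]
      exact hM.of_agreeOff (AgreeOff.write (W := [30]) (by decide) _ _ _) (by decide)
    have hC : Carries {p : Fin m | (p : ℕ) < i + 1} hold ⟨i, hi⟩ := by
      constructor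
      · intro s hs
        have := (hE ⟨i, hi⟩).2 ⟨s, hs⟩
        simp at this
      · intro p
        rw [← hE, Fin.ext_iff, Set.mem_ofPred_eq]
        simp only
        omega
    have hstate : AuctionState w rk {p : Fin m | (p : ℕ) < i + 1}
        (m * (n + 1) * (m + 3) + (m + 1) + 1) τ := by
      refine ⟨hold, hM', Or.inr ⟨⟨i, hi⟩, {⟨i, hi⟩}, 0, by simp [hτ, Memory.write], hC,
        ReachedFrom.singleton, Or.inr (Nat.zero_le _), ?_⟩⟩
      have : ∑ p : Fin m, (n + 1 - memStage τ p) ≤ m * (n + 1) := by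
        refine (Finset.sum_le_card_nsmul _ _ (n + 1) fun p _ => Nat.sub_le _ _).trans ?_
        simp
      have := Nat.mul_le_mul_right (m + 3) this
      omega
    refine (Ends.while (AuctionState w rk {p : Fin m | (p : ℕ) < i + 1})
      (fun v σ₁ h1 h2 => auctionStep_spec hw hrk h1 (by simpa using h2)) _ _ hstate).mono le_rfl ?_
    rintro σ₂ ⟨⟨v, hold₂, hM₂, h2⟩, h3⟩
    have h3 : σ₂ 30 [] = 0 := by simpa using h3
    rcases h2 with h2 | ⟨r, _, _, h4, _⟩
    · exact ⟨hold₂, hI43 _ hM₂, fun p => h2.2 p⟩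
    · omega
  · rintro σ' ⟨hold, hM, hE⟩
    exact ⟨hold, hM, fun p => (hE p).1 p.2⟩

end Rise

/-! ### Reading the input -/

section Mechanism

variable {n m : ℕ}

theorem code_injective {k : ℕ} : Function.Injective (code : Option (Fin k) → ℕ) := by
  rintro (_ | i) (_ | j) h
  · rfl
  · simp [code] at h
  · simp [code] at h
  · simp only [code, Nat.add_right_cancel_iff] at h
    rw [Fin.ext h]

theorem toMemory_quota (I : MatchingInstance n m) (i : Fin n) :
    I.toMemory 2 [(i : ℕ)] = I.quota i := by
  simp [MatchingInstance.toMemory]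

theorem toMemory_prefP (I : MatchingInstance n m) (p : Fin m) (u v : Option (Fin n)) :
    I.toMemory 3 [(p : ℕ), code u, code v] ≠ 0 ↔ (I.prefP p).rel u v := by
  simp only [MatchingInstance.toMemory, ne_eq, ite_eq_right_iff, one_ne_zero, imp_false, not_not]
  constructor
  · rintro ⟨q, u', v', h1, h2, h3, h4⟩
    rwa [← Fin.ext h1, ← code_injective h2, ← code_injective h3]
  · exact fun h => ⟨p, u, v, rfl, rfl, rfl, h⟩

theorem toMemory_prefT (I : MatchingInstance n m) (i : Fin n) (u v : Option (Fin m)) :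
    I.toMemory 4 [(i : ℕ), code u, code v] ≠ 0 ↔ (I.prefT i).rel u v := by
  simp only [MatchingInstance.toMemory, ne_eq, ite_eq_right_iff, one_ne_zero, imp_false, not_not]
  constructor
  · rintro ⟨q, u', v', h1, h2, h3, h4⟩
    rwa [← Fin.ext h1, ← code_injective h2, ← code_injective h3]
  · exact fun h => ⟨i, u, v, rfl, rfl, rfl, h⟩

theorem card_filter_outcomeOf (P : Option (Fin n) → Prop) [DecidablePred P] :
    (Finset.univ.filter fun b : Fin (n + 1) => P (outcomeOf b)).card =
      (Finset.univ.filter P).card := by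
  refine Finset.card_bij (fun b _ => outcomeOf b) (by simp) (fun a _ b _ h => ?_) fun u hu => ?_
  · have := congrArg code h
    rw [code_outcomeOf, code_outcomeOf] at this
    exact Fin.ext this
  · rcases u with _ | i
    · exact ⟨0, by simpa using hu, rfl⟩
    · exact ⟨i.succ, by simpa using hu, rfl⟩

/-- One more element is counted after `x` has been treated. -/
theorem card_filter_insert {α β : Type} [Fintype β] [DecidableEq α] [DecidableEq β]
    (f : β → α) (hf : Function.Injective f) (P : β → Prop) [DecidablePred P] {D : Finset α} {b : β}
    (hb : f b ∉ D) :
    (Finset.univ.filter fun y => f y ∈ insert (f b) D ∧ P y).card =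
      (Finset.univ.filter fun y => f y ∈ D ∧ P y).card + if P b then 1 else 0 := by
  split_ifs with h
  · rw [← Finset.card_insert_of_notMem (a := b) (by simp [hb])]
    congr 1
    ext y
    simp only [Finset.mem_filter, Finset.mem_univ, true_and, Finset.mem_insert, hf.eq_iff]
    constructor
    · rintro ⟨h1 | h1, h2⟩
      · exact Or.inl h1
      · exact Or.inr ⟨h1, h2⟩
    · rintro (rfl | ⟨h1, h2⟩)
      · exact ⟨Or.inl rfl, h⟩
      · exact ⟨Or.inr h1, h2⟩
  · rw [add_zero]
    congr 1
    ext y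
    simp only [Finset.mem_filter, Finset.mem_univ, true_and, Finset.mem_insert, hf.eq_iff]
    constructor
    · rintro ⟨rfl | h1, h2⟩
      · exact absurd h2 h
      · exact ⟨h1, h2⟩
    · exact fun ⟨h1, h2⟩ => ⟨Or.inr h1, h2⟩

/-- The program that computes the tiers of the outcomes. -/
def computeTiers : Program :=
  forTo 40 (rd0 1) (forTo 41 (.add (rd0 0) (.const 1)) (forTo 42 (.add (rd0 0) (.const 1))
    (when (.eq (rd3 3 (rd0 40) (rd0 41) (rd0 42)) (.const 0))
      (set2 6 (rd0 40) (rd0 41) (.add (rd2 6 (rd0 40) (rd0 41)) (.const 1))))))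

theorem computeTiers_spec (I : MatchingInstance n m) :
    Ends computeTiers I.toMemory (2 + m * (2 + (n + 1) * (2 + (n + 1) * 4 + 2) + 2)) fun σ' =>
      memTier σ' = I.slotTier := by
  classical
  set P : Fin m → Fin (n + 1) → Fin (n + 1) → Prop := fun p a b =>
    ¬ (I.prefP p).rel (outcomeOf a) (outcomeOf b) with hP
  refine (Ends.for3 (N₁ := m) (N₂ := n + 1) (N₃ := n + 1) (T := 2) (fun D σ' =>
    ∀ (p : Fin m) (a : Fin (n + 1)), σ' 6 [(p : ℕ), (a : ℕ)] =
      (Finset.univ.filter fun b : Fin (n + 1) => (p, a, b) ∈ D ∧ P p a b).card) (by decide)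
    (fun σ' hag => ?_) (fun D σ' v x hv h => ?_) ?_
    fun p a b D hD σ' hag hp ha hb h => ?_).mono le_rfl fun σ' h => ?_
  · have e0 := hag 0 (by decide)
    have e1 := hag 1 (by decide)
    simp [Expr.eval, e0, e1, MatchingInstance.toMemory]
  · rw [Memory.write_of_ne (by omega)]; exact h
  · simp [MatchingInstance.toMemory]
  · have hins := card_filter_insert (fun y : Fin (n + 1) => (p, a, y))
      (fun x y e => by simpa using e) (P p a) hD
    have hne : ∀ p' a', ¬ (p' = p ∧ a' = a) →
        (Finset.univ.filter fun b' : Fin (n + 1) => (p', a', b') ∈ insert (p, a, b) D ∧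
          P p' a' b') =
          Finset.univ.filter fun b' : Fin (n + 1) => (p', a', b') ∈ D ∧ P p' a' b' := by
      intro p' a' hpa
      ext y
      simp only [Finset.mem_filter, Finset.mem_univ, true_and, Finset.mem_insert, Prod.mk.injEq]
      tauto
    have hread : (rd3 3 (rd0 40) (rd0 41) (rd0 42)).eval σ' =
        I.toMemory 3 [(p : ℕ), code (outcomeOf a), code (outcomeOf b)] := by
      simp [hp, ha, hb, hag 3 (by decide), code_outcomeOf]
    refine Ends.guard (T := 1) (P p a b) ?_ (fun c => ?_) (fun c => ?_) le_rfl
    · simp only [hP]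
      rw [eval_eq_ne_zero, hread, ← toMemory_prefP, not_not]
      simp [Expr.eval]
    · refine Ends.assign2 (i := p) (j := a) (v := σ' 6 [(p : ℕ), (a : ℕ)] + 1) (by simp [hp])
        (by simp [ha]) (by simp [Expr.eval, hp, ha]) fun p' a' => ?_
      have : σ'.write 6 [(p : ℕ), (a : ℕ)] (σ' 6 [(p : ℕ), (a : ℕ)] + 1) 6 [(p' : ℕ), (a' : ℕ)] =
          if p' = p ∧ a' = a then σ' 6 [(p : ℕ), (a : ℕ)] + 1
          else σ' 6 [(p' : ℕ), (a' : ℕ)] := by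
        simp [Memory.write, Fin.ext_iff]
      rw [this]
      split_ifs with e
      · obtain ⟨rfl, rfl⟩ := e
        rw [hins, if_pos c, h]
      · rw [hne _ _ e, h]
    · intro p' a'
      by_cases e : p' = p ∧ a' = a
      · obtain ⟨rfl, rfl⟩ := e
        rw [hins, if_neg c, h, add_zero]
      · rw [hne _ _ e, h]
  · funext p s
    rw [memTier, h, MatchingInstance.slotTier, Pref.tier]
    rw [← card_filter_outcomeOf]
    simp only [Finset.mem_univ, true_and, hP]

/-- The program that computes the scales of the places, the scale of the last place first. -/
def computeScales : Program :=
  .seq (set1 7 (.const 0) (.add (.add (rd0 1) (rd0 1)) (.const 2)))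
    (forTo 40 (rd0 1) (.seq (set1 7 (.add (rd0 40) (.const 1)) (.const 0))
      (forTo 41 (.add (rd0 1) (.const 1)) (set1 7 (.add (rd0 40) (.const 1))
        (.add (rd1 7 (.add (rd0 40) (.const 1))) (rd1 7 (rd0 40)))))))

theorem computeScales_spec {σ : Memory} (hm : σ 1 [] = m) :
    Ends computeScales σ (1 + (2 + m * (1 + (2 + (m + 1) * 3) + 2))) fun σ' =>
      ∀ l ≤ m, σ' 7 [l] = (2 * m + 2) * (m + 1) ^ l := by
  refine (Ends.assign1 (i := 0) (v := 2 * m + 2)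
    (Q := fun σ₁ => AgreeOff [7] σ σ₁ ∧ σ₁ 7 [0] = 2 * m + 2) rfl
    (by simp [Expr.eval, hm]; omega) ⟨AgreeOff.write (by decide) _ _ _,
      by simp [Memory.write]⟩).seq fun σ₁ ⟨hag₁, h₁⟩ => ?_
  refine (Ends.loop (N := m) (T := 1 + (2 + (m + 1) * 3)) (fun j σ' =>
    ∀ l ≤ j, σ' 7 [l] = (2 * m + 2) * (m + 1) ^ l) (by decide) (fun σ' hag => ?_) ?_
    fun j hj σ' hag hvj h => ?_).mono le_rfl fun _ h => h
  · simp [hag 1 (by decide), hag₁ 1 (by decide), hm]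
  · intro l hl
    obtain rfl := Nat.le_zero.1 hl
    rw [Memory.write_of_ne (by omega), h₁]
    simp
  · refine (Ends.assign1 (i := j + 1) (v := 0) (Q := fun τ => τ = σ'.write 7 [j + 1] 0)
      (by simp [Expr.eval, hvj]) rfl rfl).seq fun τ hτ => ?_
    have hagτ : AgreeOff [7] σ' τ := hτ ▸ AgreeOff.write (by decide) _ _ _
    refine (Ends.loop (N := m + 1) (T := 1) (fun i σ₂ => σ₂ 7 [j + 1] = i * σ' 7 [j] ∧
      ∀ l ≤ j, σ₂ 7 [l] = σ' 7 [l]) (by decide) (fun σ₂ hag' => ?_) ?_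
      fun i hi σ₂ hag' _ h₂ => ?_).mono le_rfl fun σ₂ h₂ l hl => ?_
    · simp [Expr.eval, hag' 1 (by decide), hagτ 1 (by decide), hag 1 (by decide),
        hag₁ 1 (by decide), hm]
    · rw [Memory.write_of_ne (by omega), hτ]
      refine ⟨by simp [Memory.write], fun l hl => ?_⟩
      simp only [Memory.write, true_and, List.cons.injEq, and_true]
      rw [if_neg (by omega)]
    · have e40 : σ₂ 40 [] = j := by rw [hag' 40 (by decide), hagτ 40 (by decide), hvj]
      refine Ends.assign1 (i := j + 1) (v := (i + 1) * σ' 7 [j]) (by simp [Expr.eval, e40]) ?_ ?_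
      · simp only [Expr.eval, eval_rd1, eval_rd0, e40, h₂.1, h₂.2 j le_rfl]
        ring
      · rw [Memory.write_of_ne (by omega)]
        refine ⟨by simp [Memory.write], fun l hl => ?_⟩
        rw [← h₂.2 l hl]
        simp only [Memory.write, true_and, List.cons.injEq, and_true]
        rw [if_neg (by omega)]
    · rw [Memory.write_of_ne (by omega)]
      rcases Nat.le_succ_iff.1 hl with hl | rfl
      · rw [h₂.2 l hl, h l hl]
      · rw [h₂.1, h j le_rfl, Nat.succ_eq_add_one]
        ring

/-- The program that computes the weights. -/
def computeWeights : Program :=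
  forPairs (.ite (rd0 41)
    (when (.lt (rd0 42) (rd1 2 (.sub (rd0 41) (.const 1))))
      (when (rd3 4 (.sub (rd0 41) (.const 1)) (.add (rd0 40) (.const 1)) (.const 0))
        (.seq (set3 8 (rd0 40) (rd0 41) (rd0 42) (.add (rd0 40) (.const 1)))
          (forTo 44 (.add (rd0 1) (.const 1))
            (when (.eq (rd3 4 (.sub (rd0 41) (.const 1)) (rd0 44) (.add (rd0 40) (.const 1)))
                (.const 0))
              (when (rd3 4 (.sub (rd0 41) (.const 1)) (rd0 44) (.const 0))
                (set3 8 (rd0 40) (rd0 41) (rd0 42) (.add (rd3 8 (rd0 40) (rd0 41) (rd0 42))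
                  (rd1 7 (.sub (rd0 1) (rd0 42)))))))))))
    (when (.eq (rd0 42) (rd0 40))
      (set3 8 (rd0 40) (rd0 41) (rd0 42) (.add (rd0 40) (.const 1)))))

theorem memWeight_write (σ : Memory) (p q : Fin m) (s s' : Slot n m) (v : ℕ) :
    memWeight (σ.write 8 [(p : ℕ), (s.1 : ℕ), (s.2 : ℕ)] v) q s' =
      if (q, s') = (p, s) then v else memWeight σ q s' := by
  simp [memWeight, Memory.write, Prod.ext_iff, Fin.ext_iff]

theorem memWeight_write_of_ne {x : ℕ} (h : x ≠ 8) (σ : Memory) (idx : List ℕ) (v : ℕ) :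
    (memWeight (σ.write x idx v) : Fin m → Slot n m → ℕ) = memWeight σ := by
  funext p s
  rw [memWeight, Memory.write_of_ne h.symm, memWeight]

theorem computeWeights_spec (I : MatchingInstance n m) {σ : Memory} (hn : σ 0 [] = n)
    (hm : σ 1 [] = m) (h2 : σ 2 = I.toMemory 2) (h4 : σ 4 = I.toMemory 4)
    (h7 : ∀ l ≤ m, σ 7 [l] = (2 * m + 2) * (m + 1) ^ l)
    (h8 : ∀ (p : Fin m) (s : Slot n m), memWeight σ p s = 0) :
    Ends computeWeights σ
      (2 + m * (2 + (n + 1) * (2 + m * (1 + (2 + (m + 1) * 5) + 3 + 2) + 2) + 2))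
      fun σ' => memWeight σ' = I.weight := by
  classical
  refine (forPairs_spec (n := n) (m := m) (T := 1 + (2 + (m + 1) * 5) + 3) hn hm (fun D σ' =>
    ∀ p s, memWeight σ' p s = if (p, s) ∈ D then I.weight p s else 0) (by decide)
    (fun D σ' v x hv h => ?_) (by simpa using h8)
    fun p s D hD σ' hag hp ha hk h => ?_).mono le_rfl fun σ' h => ?_
  · rw [memWeight_write_of_ne (by omega)]; exact h
  · have key : ∀ τ : Memory, memWeight τ p s = I.weight p s →
        (∀ q s', (q, s') ≠ (p, s) → memWeight τ q s' = memWeight σ' q s') →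
        ∀ q s', memWeight τ q s' = if (q, s') ∈ insert (p, s) D then I.weight q s' else 0 := by
      intro τ h1 h3 q s'
      by_cases e : (q, s') = (p, s)
      · obtain ⟨rfl, rfl⟩ := Prod.mk.inj e
        rw [if_pos (Finset.mem_insert_self _ _), h1]
      · rw [h3 q s' e, h]
        simp only [Finset.mem_insert, e, false_or]
    have hskip : I.weight p s = 0 →
        ∀ q s', memWeight σ' q s' = if (q, s') ∈ insert (p, s) D then I.weight q s' else 0 :=
      fun h0 => key σ' (by rw [h0, h, if_neg hD]) fun _ _ _ => rfl
    refine Ends.cond (T := 1 + (2 + (m + 1) * 5) + 2) (∃ i : Fin n, s.1 = i.succ) ?_ ?_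
      fun hno => ?_
    · rw [← code_outcomeOf] at ha
      simp only [eval_rd0, ha, code_ne_zero, outcomeOf_eq_some]
    · rintro ⟨i, hi⟩
      obtain ⟨a, k⟩ := s
      simp only at hi ha hk
      subst hi
      have hsub : ∀ τ : Memory, τ 41 [] = σ' 41 [] →
          (Expr.sub (rd0 41) (.const 1)).eval τ = i := by
        intro τ e
        simp [Expr.eval, e, ha]
      have h4' : ∀ τ : Memory, τ 4 = σ' 4 → τ 4 = I.toMemory 4 := fun τ e => by
        rw [e, hag 4 (by decide), h4]
      refine Ends.guard (T := 1 + (2 + (m + 1) * 5) + 1) ((k : ℕ) < I.quota i) ?_ (fun c1 => ?_)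
        (fun c1 => hskip ?_) (by omega)
      · rw [eval_lt_ne_zero, eval_rd1, hsub σ' rfl, hag 2 (by decide), h2, toMemory_quota]
        simp [hk]
      swap
      · by_contra h0
        exact c1 (of_weight_succ_pos (Nat.pos_of_ne_zero h0)).1
      refine Ends.guard (T := 1 + (2 + (m + 1) * 5)) ((I.prefT i).rel (some p) none) ?_
        (fun c2 => ?_) (fun c2 => hskip ?_) (by omega)
      · rw [← toMemory_prefT, eval_rd3, hsub σ' rfl, h4' σ' rfl]
        simp [Expr.eval, hp, code]
      swap
      · by_contra h0
        exact c2 (of_weight_succ_pos (Nat.pos_of_ne_zero h0)).2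
      refine (Ends.assign3 (i := p) (j := (i.succ : Fin (n + 1))) (k := k) (v := p + 1)
        (Q := fun τ => τ = σ'.write 8 [(p : ℕ), ((i.succ : Fin (n + 1)) : ℕ), (k : ℕ)] (p + 1))
        (by simp [hp]) (by simp [ha]) (by simp [hk]) (by simp [Expr.eval, hp]) rfl).seq
        fun τ hτ => ?_
      have hagτ : AgreeOff [8] σ' τ := hτ ▸ AgreeOff.write (by decide) _ _ _
      set P : Fin (m + 1) → Prop := fun x => ¬ (I.prefT i).rel (outcomeOf x) (some p) ∧
        (I.prefT i).rel (outcomeOf x) none with hP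
      refine (Ends.for1 (N := m + 1) (T := 3) (fun X σ₂ => ∀ q s', memWeight σ₂ q s' =
        if (q, s') = (p, (i.succ, k)) then p + 1 +
          (Finset.univ.filter fun x => x ∈ X ∧ P x).card * placeScale m k
        else memWeight σ' q s') (by decide) (fun σ₂ hag' => ?_) (fun X σ₂ x h => ?_) ?_
        fun x X hx σ₂ hag' hvx h => ?_).mono le_rfl fun σ₂ h => key σ₂ ?_ ?_
      · simp [Expr.eval, hag' 1 (by decide), hagτ 1 (by decide), hag 1 (by decide), hm]
      · rw [memWeight_write_of_ne (by omega)]; exact h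
      · intro q s'
        rw [hτ]
        simpa using memWeight_write σ' p q (i.succ, k) s' (p + 1)
      · have hagσ : AgreeOff [8, 44] σ' σ₂ := (hagτ.mono (by decide)).trans (hag'.mono (by decide))
        have e40 : σ₂ 40 [] = p := by rw [hagσ 40 (by decide), hp]
        have e41 : σ₂ 41 [] = (i.succ : Fin (n + 1)) := by rw [hagσ 41 (by decide), ha]
        have e42 : σ₂ 42 [] = k := by rw [hagσ 42 (by decide), hk]
        have es := hsub σ₂ (by rw [hagσ 41 (by decide)])
        have e4 := h4' σ₂ (hagσ 4 (by decide))
        have hins := card_filter_insert (fun y : Fin (m + 1) => y) (fun x y e => e) P hx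
        have hskip' : ¬ P x → ∀ q s', memWeight σ₂ q s' =
            if (q, s') = (p, (i.succ, k)) then p + 1 +
              (Finset.univ.filter fun y => y ∈ insert x X ∧ P y).card * placeScale m k
            else memWeight σ' q s' := by
          intro c q s'
          rw [hins, if_neg c, add_zero, h q s']
        refine Ends.guard (T := 2) (¬ (I.prefT i).rel (outcomeOf x) (some p)) ?_ (fun c3 => ?_)
          (fun c3 => hskip' fun c => c3 c.1) (by omega)
        · rw [eval_eq_ne_zero, eval_rd3, es, e4, ← toMemory_prefT, code_outcomeOf, not_not]
          simp [Expr.eval, e40, hvx, code]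
        refine Ends.guard (T := 1) ((I.prefT i).rel (outcomeOf x) none) ?_ (fun c4 => ?_)
          (fun c4 => hskip' fun c => c4 c.2) (by omega)
        · rw [eval_rd3, es, e4, ← toMemory_prefT, code_outcomeOf]
          simp [Expr.eval, hvx, code]
        have hval := h p (i.succ, k)
        rw [if_pos rfl] at hval
        have hsc : σ₂ 7 [m - k] = placeScale m k := by
          rw [hagσ 7 (by decide), hag 7 (by decide), h7 _ (Nat.sub_le _ _), placeScale]
        refine Ends.assign3 (i := p) (j := (i.succ : Fin (n + 1))) (k := k)
          (v := memWeight σ₂ p ((i.succ : Fin (n + 1)), k) + placeScale m k) (by simp [e40])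
          (by simp [e41]) (by simp [e42]) ?_ fun q s' => ?_
        · have e1 : σ₂ 1 [] = m := by rw [hagσ 1 (by decide), hag 1 (by decide), hm]
          simp [Expr.eval, e40, e41, e42, e1, hsc, memWeight]
        · refine (memWeight_write σ₂ p q (i.succ, k) s' _).trans ?_
          split_ifs with e
          · rw [hval, hins, if_pos ⟨c3, c4⟩]
            ring
          · rw [h q s', if_neg e]
      · rw [h p (i.succ, k), if_pos rfl, weight_succ c1 c2, Pref.rank, ← card_filter_outcomeOf]
        simp only [Finset.mem_univ, true_and, hP]
      · exact fun q s' e => by rw [h q s', if_neg e]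
    · obtain ⟨a, k⟩ := s
      have ha0 : a = 0 := by
        cases a using Fin.cases with
        | zero => rfl
        | succ i => exact absurd ⟨i, rfl⟩ hno
      subst ha0
      refine Ends.mono (T₁ := 2) ?_ (by omega) fun _ h => h
      refine Ends.guard (T := 1) (k = p) (by simp [eval_eq_ne_zero, hk, hp, Fin.ext_iff])
        (fun c => ?_) (fun c => hskip (by simp [MatchingInstance.weight, c])) le_rfl
      subst c
      refine Ends.assign3 (i := k) (j := ((0 : Fin (n + 1)) : ℕ)) (k := k) (v := k + 1)
        (by simp [hp]) (by simp [ha]) (by simp [hk]) (by simp [Expr.eval, hp])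
        (key _ ?_ fun q s' e => ?_)
      · refine (memWeight_write σ' k k (0, k) (0, k) _).trans ?_
        rw [if_pos rfl, weight_private]
      · refine (memWeight_write σ' k q (0, k) s' _).trans ?_
        rw [if_neg e]
  · funext p s
    rw [h p s, if_pos (Finset.mem_univ _)]

/-! ### The mechanism -/

/-- The program that writes down the outcomes of the participants. -/
def writeOutcomes : Program :=
  forTo 41 (.add (rd0 0) (.const 1)) (forTo 42 (rd0 1)
    (when holderExpr (set1 5 (.sub holderExpr (.const 1)) (rd0 41))))

theorem writeOutcomes_spec {w rk : Fin m → Slot n m → ℕ} {hold : Slot n m → Option (Fin m)}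
    {σ : Memory} (h : AuctionMem w rk hold σ) :
    Ends writeOutcomes σ (2 + (n + 1) * (2 + m * 4 + 2)) fun σ' =>
      ∀ s p, hold s = some p → σ' 5 [(p : ℕ)] = s.1 := by
  refine (Ends.for2 (N₁ := n + 1) (N₂ := m) (T := 2) (fun D σ' => ∀ (s : Slot n m) p, s ∈ D →
    hold s = some p → σ' 5 [(p : ℕ)] = s.1) (by decide) (fun σ' hag => ?_)
    (fun D σ' v x hv hI => ?_) (by simp) fun a k D hD σ' hag ha hk hI => ?_).mono le_rfl
    fun σ' h' s p => h' s p (by simp)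
  · simp [Expr.eval, hag 0 (by decide), hag 1 (by decide), h.teams, h.participants]
  · rw [Memory.write_of_ne (by omega)]; exact hI
  · have hhold : holderExpr.eval σ' = code (hold (a, k)) := by
      have := h.holds (a, k)
      simp only at this
      simp [holderExpr, ha, hk, hag 9 (by decide), this]
    refine Ends.guard (T := 1) (∃ q, hold (a, k) = some q) (by rw [hhold, code_ne_zero])
      (fun c => ?_) (fun c s p hs hp => ?_) le_rfl
    · obtain ⟨q, hq⟩ := c
      refine Ends.assign1 (i := q) (v := a) (by simp [Expr.eval, hhold, hq, code_some])
        (by simp [ha]) fun s p hs hp => ?_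
      rw [write_cell₁]
      rcases Finset.mem_insert.1 hs with rfl | hs
      · rw [hq] at hp
        rw [if_pos (Option.some.inj hp).symm]
      · rw [if_neg, hI s p hs hp]
        rintro rfl
        exact hD (h.inv.inj _ _ _ hp hq ▸ hs)
    · rcases Finset.mem_insert.1 hs with rfl | hs
      · exact absurd ⟨p, hp⟩ c
      · exact hI s p hs hp

/-- The program of the mechanism. -/
def mechanismProgram : Program :=
  .seq computeTiers (.seq computeScales (.seq computeWeights (.seq auction writeOutcomes)))

/-- The number of steps that the mechanism takes at most. -/
def mechanismTime (n m : ℕ) : ℕ :=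
  (2 + m * (2 + (n + 1) * (2 + (n + 1) * 4 + 2) + 2)) +
    ((1 + (2 + m * (1 + (2 + (m + 1) * 3) + 2))) +
      ((2 + m * (2 + (n + 1) * (2 + m * (1 + (2 + (m + 1) * 5) + 3 + 2) + 2) + 2)) +
        (auctionTime n m + (2 + (n + 1) * (2 + m * 4 + 2)))))

theorem Pref.tier_outcome_le (r : Pref (Option (Fin n))) (a : Option (Fin n)) : r.tier a ≤ n := by
  classical
  have : (Finset.univ.filter fun b => ¬ r.rel a b) ⊆ Finset.univ.erase a := by
    intro b hb
    simp only [Finset.mem_filter, Finset.mem_univ, true_and] at hb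
    simp only [Finset.mem_erase, Finset.mem_univ, and_true]
    rintro rfl
    exact hb (r.refl _)
  refine (Finset.card_le_card this).trans ?_
  simp

theorem mechanismProgram_spec (I : MatchingInstance n m) :
    Ends mechanismProgram I.toMemory (mechanismTime n m) fun σ' => ∃ μ π,
      AuctionOutcome I.weight I.slotTier μ π ∧
      ∀ p : Fin m, σ' 5 [(p : ℕ)] = code (allocationOf μ p) := by
  refine (computeTiers_spec I).frame.seq fun σ₁ ⟨h₁, hag₁⟩ => ?_
  have hm₁ : σ₁ 1 [] = m := by rw [hag₁ 1 (by decide)]; rfl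
  refine (computeScales_spec hm₁).frame.seq fun σ₂ ⟨h₂, hag₂'⟩ => ?_
  have hag₂ : AgreeOff [6, 7, 40, 41, 42] I.toMemory σ₂ :=
    (hag₁.mono (by decide)).trans (hag₂'.mono (by decide))
  refine (computeWeights_spec I (by rw [hag₂ 0 (by decide)]; rfl)
    (by rw [hag₂ 1 (by decide)]; rfl) (hag₂ 2 (by decide)) (hag₂ 4 (by decide)) h₂
    fun p s => by rw [memWeight, hag₂ 8 (by decide)]; rfl).frame.seq fun σ₃ ⟨h₃, hag₃'⟩ => ?_
  have hag₃ : AgreeOff [6, 7, 8, 40, 41, 42, 44] I.toMemory σ₃ :=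
    (hag₂.mono (by decide)).trans (hag₃'.mono (by decide))
  have hM : AuctionMem I.weight I.slotTier (fun _ => none) σ₃ := by
    refine ⟨by rw [hag₃ 0 (by decide)]; rfl, by rw [hag₃ 1 (by decide)]; rfl, h₃, ?_, ?_, ?_⟩
    · rw [← h₁]
      funext p s
      simp only [memTier, hag₃' 6 (by decide), hag₂' 6 (by decide)]
    · intro s
      rw [hag₃ 9 (by decide)]
      rfl
    · have e1 : (memPrice σ₃ : Slot n m → ℕ) = fun _ => 0 := by
        funext s
        rw [memPrice, hag₃ 10 (by decide)]
        rfl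
      have e2 : (memStage σ₃ : Fin m → ℕ) = fun _ => 0 := by
        funext p
        rw [memStage, hag₃ 11 (by decide)]
        rfl
      rw [e1, e2]
      exact AuctionInv.init _ _
  refine (auction_spec (fun p q => ⟨eq_of_weight_private, ?_⟩)
    (fun p s => Pref.tier_outcome_le _ _) hM).seq fun σ₄ ⟨hold, hM₄, hall⟩ => ?_
  · rintro rfl
    rw [weight_private]
    omega
  · choose μ hμ using hall
    refine (writeOutcomes_spec hM₄).mono le_rfl fun σ₅ h₅ => ⟨μ, _, hM₄.inv.outcome hμ, fun p => ?_⟩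
    rw [h₅ _ _ (hμ p), allocationOf, code_outcomeOf]

/-- The function is bounded by a polynomial in the sum of its arguments. -/
def PolyBounded (T : ℕ → ℕ → ℕ) : Prop :=
  ∃ B : Polynomial ℕ, ∀ n m, T n m ≤ B.eval (n + m)

theorem PolyBounded.const (k : ℕ) : PolyBounded fun _ _ => k :=
  ⟨.C k, fun n m => by simp⟩

theorem PolyBounded.fst : PolyBounded fun n _ => n := ⟨.X, fun n m => by simp⟩

theorem PolyBounded.snd : PolyBounded fun _ m => m := ⟨.X, fun n m => by simp⟩

theorem PolyBounded.add {T₁ T₂ : ℕ → ℕ → ℕ} (h₁ : PolyBounded T₁) (h₂ : PolyBounded T₂) :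
    PolyBounded fun n m => T₁ n m + T₂ n m := by
  obtain ⟨B₁, h₁⟩ := h₁
  obtain ⟨B₂, h₂⟩ := h₂
  exact ⟨B₁ + B₂, fun n m => by rw [Polynomial.eval_add]; exact add_le_add (h₁ n m) (h₂ n m)⟩

theorem PolyBounded.mul {T₁ T₂ : ℕ → ℕ → ℕ} (h₁ : PolyBounded T₁) (h₂ : PolyBounded T₂) :
    PolyBounded fun n m => T₁ n m * T₂ n m := by
  obtain ⟨B₁, h₁⟩ := h₁
  obtain ⟨B₂, h₂⟩ := h₂
  exact ⟨B₁ * B₂, fun n m => by rw [Polynomial.eval_mul]; exact mul_le_mul' (h₁ n m) (h₂ n m)⟩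

theorem polyBounded_mechanismTime : PolyBounded mechanismTime := by
  unfold mechanismTime auctionTime auctionStepTime findMovesTime searchTime
  repeat' first
    | exact PolyBounded.const _
    | exact PolyBounded.fst
    | exact PolyBounded.snd
    | refine PolyBounded.add ?_ ?_
    | refine PolyBounded.mul ?_ ?_

end Mechanism

end TeamMatching

/-- In the setting with quotas, ties and outside options on both sides, some polynomial-time
algorithm returns allocations that respect the quotas and are weakly stable, extended team-justified
SD-EF1 and Pareto optimal, and is group-strategyproof for participants. -/
theorem theorem6 :
    ∃ f : TeamMatching.Mechanism,
      TeamMatching.PolyTimeComputable f ∧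
      (∀ (n m : ℕ) (I : TeamMatching.MatchingInstance n m),
        TeamMatching.Feasible I (f n m I) ∧
        TeamMatching.WeaklyStable I (f n m I) ∧
        TeamMatching.ExtendedTeamJustifiedSDEF1 I (f n m I) ∧
        TeamMatching.ParetoOptimal I (f n m I)) ∧
      TeamMatching.GroupStrategyproof f := by
  choose σ t hrun ht μ π hμ hout using
    fun (n m : ℕ) (I : TeamMatching.MatchingInstance n m) => TeamMatching.mechanismProgram_spec I
  obtain ⟨B, hB⟩ := TeamMatching.polyBounded_mechanismTime
  refine ⟨fun n m I => TeamMatching.allocationOf (μ n m I), ⟨TeamMatching.mechanismProgram, B,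
    fun n m I => ⟨σ n m I, t n m I, hrun n m I, (ht n m I).trans (hB n m), hout n m I⟩⟩,
    fun n m I => ⟨(hμ n m I).feasible, (hμ n m I).weaklyStable,
      (hμ n m I).extendedTeamJustifiedSDEF1, (hμ n m I).paretoOptimal⟩, ?_⟩
  intro n m I I' X hX hI
  exact TeamMatching.exists_not_worse_of_misreport hI hX (hμ n m I) (hμ n m I')
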